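/- Let $\mathbb T^2=(\mathbb R/2\pi\mathbb Z)^2$, with Fourier coefficients $\hat f(k)=(2\pi)^{-2}\int_{\mathbb T^2}f(x)e^{-ik\cdot x}\,dx$, $k\in\mathbb Z^2$. Let $m=(m^1,m^2):\mathbb R^2\to\mathbb C^2$ be smooth on $\mathbb R^2\setminus\{0\}$, positively homogeneous of degree $0$ there, with $m(-\xi)=\overline{m(\xi)}$ for all $\xi$, $\xi\cdot m(\xi)=0$ for $\xi\ne0$, and odd: $m(-\xi)=-m(\xi)$ for $\xi\neq 0$. Let $T^l$ be the Fourier multiplier with symbol $m^l$, that is $\widehat{T^l[\theta]}(k)=m^l(k)\hat\theta(k)$, and let $L=(-\Delta)^{-1}(\nabla\cdot T^\perp)=(-\Delta)^{-1}(\partial_2T^1-\partial_1T^2)$ be the Fourier multiplier with symbol $\hat L(\xi)=|\xi|^{-2}\big(i\xi_2m^1(\xi)-i\xi_1m^2(\xi)\big)$ for $\xi\ne0$, $\hat L(0)=0$. (a) There is a real-valued function $\ell$ on $\mathbb R^2$ which on $\mathbb R^2\setminus\{0\}$ is even, positively homogeneous of degree $0$ and smooth, such that $m(\xi)=i\,\xi^\perp|\xi|^{-1}\ell(\xi)$,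 where $\xi^\perp=(-\xi_2,\xi_1)$, and $\hat L(\xi)=|\xi|^{-1}\ell(\xi)$ for all $\xi\neq0$. The operator $L$ is bounded and self-adjoint on $L^2(\mathbb T^2;\mathbb C)$. (b) Let $I\subseteq\mathbb R$ be an open interval, and let $\theta\in L^3(I\times\mathbb T^2)$ be real-valued and a weak solution on $I\times\mathbb T^2$ of $$\partial_t\theta+\partial_l(\theta u^l)=0,\qquad u^l=T^l[\theta],$$ that is: $\theta$, $u^l$ and $\theta u^l$ are locally integrable on $I\times\mathbb T^2$, $\hat u^l(t,k)=m^l(k)\hat\theta(t,k)$ for almost every $t\in I$ and all $k\in\mathbb Z^2$, $l=1,2$, and $\int_I\int_{\mathbb T^2}\big(\theta\,\partial_t\varphi+\theta u^l\,\partial_l\varphi\big)\,dx\,dt=0$ for all $\varphi\in C_c^\infty(I\times\mathbb T^2)$. (The condition $\partial_l u^l=0$ then holds automatically.) Then for almost every $t\in I$ the Hamiltonian $$H(t)=\int_{\mathbb T^2}\theta(t,x)\,L\theta(t,x)\,dx$$ is well defined ($\theta(t,\cdot)\in L^2$ and $\theta\, L\theta(t,\cdot)\in L^1$), and $H$ is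 constant in time: there is $c\in\mathbb R$ such that $H(t)=c$ for almost every $t\in I$. (c) The multiplier $m(\xi)=i\langle-\xi_2,\xi_1\rangle|\xi|^{-1}$ (with $m(0)=0$) of the surface quasi-geostrophic (SQG) equation satisfies the above assumptions, and in this case $\hat L(\xi)=|\xi|^{-1}$ for $\xi\neq 0$, that is $L=(-\Delta)^{-1/2}$. Consequently, for every weak solution $\theta\in L^3(I\times\mathbb T^2)$ of the SQG equation, the homogeneous $H^{-1/2}$ norm $\big(\sum_{k\in\mathbb Z^2\setminus\{0\}}|k|^{-1}|\hat\theta(t,k)|^2\big)^{1/2}$ is finite for almost every $t\in I$ and equal to a constant for almost every $t\in I$. -/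

import Mathlib

open MeasureTheory Set Filter
open scoped ContDiff ComplexConjugate

noncomputable section

namespace ActiveScalar

instance two_pi_pos_fact : Fact (0 < 2 * Real.pi) := ⟨Real.two_pi_pos⟩

/-- The circle `ℝ / 2πℤ`. -/
abbrev Circ : Type := AddCircle (2 * Real.pi)

/-- The two-dimensional torus `𝕋² = (ℝ / 2πℤ)²`, with Lebesgue measure of total mass `(2π)²`.
Its dual lattice is `ℤ²`. -/
abbrev Torus : Type := Fin 2 → Circ

/-- Frequency space `ℝ²` with the Euclidean norm. -/
abbrev Freq : Type := EuclideanSpace ℝ (Fin 2)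

/-- The Hilbert space `L²(𝕋²; ℂ)`. -/
abbrev L2 : Type := Lp ℂ 2 (volume : Measure Torus)

/-- A point of the dual lattice `ℤ²`, seen in frequency space. -/
def latticeFreq (k : Fin 2 → ℤ) : Freq := WithLp.toLp 2 (fun j => (k j : ℝ))

/-- The character `x ↦ e^{i k·x}` of the torus. -/
def character (k : Fin 2 → ℤ) : C(Torus, ℂ) :=
  ⟨fun x => ∏ j, fourier (k j) (x j), by fun_prop⟩

/-- The Fourier coefficient `(2π)⁻² ∫ f(x) e^{-i k·x} dx`. -/
def coeff (f : Torus → ℂ) (k : Fin 2 → ℤ) : ℂ :=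
  ((2 * Real.pi : ℝ) ^ 2 : ℂ)⁻¹ * ∫ x, conj (character k x) * f x

/-- The Fourier multiplier with symbol `a` applied to `f`, as the `L²`-convergent Fourier series
`∑ₖ a(k) f̂(k) e^{i k·x}` (the sum runs over the lattice `ℤ²`). -/
def applySymbol (a : Freq → ℂ) (f : Torus → ℂ) : L2 :=
  ∑' k : Fin 2 → ℤ,
    (a (latticeFreq k) * coeff f k) • ContinuousMap.toLp 2 volume ℂ (character k)

/-- The standing assumptions on the multiplier `m = (m¹, m²)` of an active scalar equation in two
dimensions: smooth away from the origin, homogeneous of degree `0`, mapping real scalars to real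
velocities, and with values perpendicular to the frequency. -/
structure IsDriftMultiplier (m : Freq → Fin 2 → ℂ) : Prop where
  smooth : ∀ l, ContDiffOn ℝ ∞ (fun ξ => m ξ l) {0}ᶜ
  homogeneous : ∀ (c : ℝ) (ξ : Freq), 0 < c → ξ ≠ 0 → m (c • ξ) = m ξ
  conj_symm : ∀ ξ l, m (-ξ) l = conj (m ξ l)
  perp : ∀ ξ, ξ ≠ 0 → ∑ l, (ξ l : ℂ) * m ξ l = 0

/-- The multiplier is an odd function of `ξ ≠ 0`. -/
def IsOddMultiplier (m : Freq → Fin 2 → ℂ) : Prop :=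
  ∀ ξ, ξ ≠ 0 → m (-ξ) = -m ξ

/-- The time derivative of a function on `ℝ × 𝕋²`. -/
def timeDeriv (φ : ℝ × Torus → ℝ) (p : ℝ × Torus) : ℝ :=
  deriv (fun s : ℝ => φ (s, p.2)) p.1

/-- The `l`-th spatial partial derivative of a function on `ℝ × 𝕋²`. -/
def spaceDeriv (l : Fin 2) (φ : ℝ × Torus → ℝ) (p : ℝ × Torus) : ℝ :=
  deriv (fun s : ℝ => φ (p.1, p.2 + Pi.single l (s : Circ))) 0

/-- Test functions `φ ∈ C_c^∞(I × 𝕋²)`; smoothness is that of the periodic lift to `ℝ × ℝ²`. -/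
structure IsTestFunction (I : Set ℝ) (φ : ℝ × Torus → ℝ) : Prop where
  smooth : ContDiff ℝ ∞ (fun p : ℝ × (Fin 2 → ℝ) => φ (p.1, fun j => (p.2 j : Circ)))
  compact : HasCompactSupport φ
  support : tsupport φ ⊆ I ×ˢ univ

/-- `(θ, u)` is a weak solution on `I × 𝕋²` of the active scalar equation
`∂ₜθ + ∂ₗ(θ uˡ) = 0`, `uˡ = Tˡ[θ]`, where `Tˡ` is the Fourier multiplier with symbol `mˡ`.
The equation is meant in the sense of distributions, so `θ`, `uˡ` and `θ uˡ` are locally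
integrable; the law `uˡ = Tˡ[θ]` is `ûˡ(t,k) = mˡ(k) θ̂(t,k)` for all `k ∈ ℤ²` and almost every
`t`. When `ξ · m(ξ) = 0`, the condition `∂ₗuˡ = 0` is a consequence of this law. -/
structure IsWeakSolution (m : Freq → Fin 2 → ℂ) (I : Set ℝ)
    (θ : ℝ × Torus → ℝ) (u : ℝ × Torus → Fin 2 → ℝ) : Prop where
  locInt_scalar : LocallyIntegrableOn θ (I ×ˢ univ)
  locInt_drift : ∀ l, LocallyIntegrableOn (fun p => u p l) (I ×ˢ univ)
  locInt_flux : ∀ l, LocallyIntegrableOn (fun p => θ p * u p l) (I ×ˢ univ)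
  drift_eq : ∀ᵐ t ∂(volume.restrict I), ∀ (l : Fin 2) (k : Fin 2 → ℤ),
    coeff (fun x => (u (t, x) l : ℂ)) k
      = m (latticeFreq k) l * coeff (fun x => (θ (t, x) : ℂ)) k
  transport : ∀ φ, IsTestFunction I φ →
    ∫ p in I ×ˢ univ, (θ p * timeDeriv φ p + ∑ l, θ p * u p l * spaceDeriv l φ p) = 0

/-- The symbol of `(-Δ)⁻¹`, with the value `0` at `ξ = 0`. -/
def invLaplaceSymbol (ξ : Freq) : ℂ := ((‖ξ‖ ^ 2 : ℝ) : ℂ)⁻¹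

/-- The symbol of `∇·T^⊥ = ∂₂T¹ - ∂₁T²`. -/
def divPerpSymbol (m : Freq → Fin 2 → ℂ) (ξ : Freq) : ℂ :=
  Complex.I * (ξ 1 : ℂ) * m ξ 0 - Complex.I * (ξ 0 : ℂ) * m ξ 1

/-- The symbol of `L = (-Δ)⁻¹(∇·T^⊥)`; it vanishes at `ξ = 0`. -/
def hamiltonianSymbol (m : Freq → Fin 2 → ℂ) (ξ : Freq) : ℂ :=
  invLaplaceSymbol ξ * divPerpSymbol m ξ

/-- The operator `L = (-Δ)⁻¹(∇·T^⊥)`, with values in `L²`. -/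
def opL (m : Freq → Fin 2 → ℂ) (f : Torus → ℂ) : L2 :=
  applySymbol (hamiltonianSymbol m) f

/-- The Hamiltonian `H(t) = ∫ θ(t,x) Lθ(t,x) dx`. -/
def hamiltonian (m : Freq → Fin 2 → ℂ) (θ : ℝ × Torus → ℝ) (t : ℝ) : ℂ :=
  ∫ x, (θ (t, x) : ℂ) * opL m (fun y => (θ (t, y) : ℂ)) x

/-- The multiplier `m(ξ) = i (-ξ₂, ξ₁) / |ξ|` of the surface quasi-geostrophic equation. -/
def sqgMultiplier (ξ : Freq) : Fin 2 → ℂ :=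
  ![-(Complex.I * (ξ 1 : ℂ) / (‖ξ‖ : ℂ)), Complex.I * (ξ 0 : ℂ) / (‖ξ‖ : ℂ)]

/-- The terms `|k|⁻¹ |f̂(k)|²` of the squared homogeneous `H^{-1/2}` norm; the term at `k = 0`
is `0`. -/
def hMinusHalfTerm (f : Torus → ℂ) (k : Fin 2 → ℤ) : ℝ :=
  ‖latticeFreq k‖⁻¹ * ‖coeff f k‖ ^ 2

/-- The homogeneous `H^{-1/2}` norm `(∑_{k ≠ 0} |k|⁻¹ |f̂(k)|²)^{1/2}`. -/
def hMinusHalfNorm (f : Torus → ℂ) : ℝ :=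
  Real.sqrt (∑' k : Fin 2 → ℤ, hMinusHalfTerm f k)

end ActiveScalar

end

/-!
Write `v = u(t, ·)` and `f = θ(t, ·)`. The condition `ξ · m(ξ) = 0` says that `m(ξ)` is a multiple
of `ξ^⊥`, so `v = ∇^⊥ L f` up to the mean of `v`, and oddness makes `m` purely imaginary away from
the origin, so the symbol of `L` is real and even and `L` is self-adjoint. Formally
`dH/dt = 2 ∫ ∂ₜθ Lθ = 2 ∫ θ u · ∇Lθ`, and this vanishes because `∇Lθ` is `u` rotated by a right
angle. The product `θ u · u^⊥` is integrable as soon as `u ∈ L³`, so the formal computation is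
justified by two ingredients: the boundedness of `T^l` on `L³(𝕋²)`, and a regularization which
respects the cancellation.

*The bound in `L³`.* For `w = √(y² + δ)` the function `w(3x² - w²)` of `x + iy` is subharmonic. Let
`F` be a trigonometric polynomial with frequencies in a half-plane `k · ν ≥ 0`. It extends
holomorphically to complex translations in the direction `ν`, so the integral of this function over
the torus is a convex, bounded, hence nonincreasing function of the imaginary part of the
translation. Comparing its values at `0` and at infinity bounds `‖Im F‖₃` by `‖Re F‖₃`
(`integral_abs_im_pow_le`); this is the bound for the multiplier `sgn (k · ν)`
(`integral_norm_sign_trigPoly_le`). By the method of rotations a smooth odd symbol of degree `0` is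
an average of such signs (`exists_density`), which bounds `T^l` on trigonometric polynomials, and
Fejér means and Fatou's lemma extend the bound to a velocity which is only known to be integrable
with the right Fourier coefficients (`exists_eLpNorm_drift_le`).

*Conservation.* The Hamiltonian is truncated by the weights of the Fejér kernel. Each Fourier
coefficient of a weak solution has a locally integrable weak time derivative, so the truncated
Hamiltonian is absolutely continuous (`IsWeakSolution.exists_norm_sq_coeff_primitive`). Its
derivative is a difference of pairings of Fejér means of `v` with `f v`; it converges to the
integral of `f v · v^⊥ = 0` (`tendsto_truncatedRate`) and is bounded by a multiple of `‖f‖₃³`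
(`enorm_truncatedRate_le`), which is integrable in time since `θ ∈ L³`. The frequency `0` needs
separate care, as `m(0)` may be any real vector: `L` does not see it, and the corresponding parts of
the two pairings cancel (`integral_scalar_mul_drift`). Dominated convergence gives the constancy in
time of the quadratic form `∑ₖ L̂(k) |θ̂(t, k)|²` (`IsWeakSolution.exists_tsum_eq_const`), which by
Parseval's identity is `(2π)⁻² H(t)` (`integral_mul_opL_eq_tsum`).
-/

noncomputable section

namespace ActiveScalar

/-! ### Characters and Fourier coefficients -/

lemma character_apply (k : Fin 2 → ℤ) (x : Torus) :
    character k x = ∏ j, fourier (k j) (x j) := rfl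

lemma norm_character (k : Fin 2 → ℤ) (x : Torus) : ‖character k x‖ = 1 := by
  simp [character_apply, fourier_apply, Circle.norm_coe]

lemma conj_character (k : Fin 2 → ℤ) (x : Torus) :
    conj (character k x) = character (-k) x := by
  simp [character_apply]

lemma character_add (k l : Fin 2 → ℤ) (x : Torus) :
    character (k + l) x = character k x * character l x := by
  simp only [character_apply, ← Finset.prod_mul_distrib, Pi.add_apply, fourier_add]

lemma character_zero (x : Torus) : character 0 x = 1 := by
  simp [character_apply]

lemma character_map_add (k : Fin 2 → ℤ) (x y : Torus) :
    character k (x + y) = character k x * character k y := by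
  simp only [character_apply, ← Finset.prod_mul_distrib, Pi.add_apply, fourier_apply, smul_add,
    AddCircle.toCircle_add, Circle.coe_mul]

lemma character_coe (k : Fin 2 → ℤ) (y : Fin 2 → ℝ) :
    character k (fun j => (y j : Circ)) = Complex.exp (Complex.I * ∑ j, (k j : ℂ) * (y j : ℂ)) := by
  simp only [character_apply, fourier_coe_apply, Fin.prod_univ_two, Fin.sum_univ_two,
    ← Complex.exp_add]
  congr 1
  have : (Real.pi : ℂ) ≠ 0 := by exact_mod_cast Real.pi_ne_zero
  push_cast
  field_simp

lemma volume_torus : (volume : Measure Torus) univ = ENNReal.ofReal ((2 * Real.pi) ^ 2) := by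
  rw [volume_pi, Measure.pi_univ]
  simp only [AddCircle.measure_univ, Fin.prod_univ_two]
  rw [← ENNReal.ofReal_mul Real.two_pi_pos.le, sq]

lemma volume_real_torus : (volume : Measure Torus).real univ = (2 * Real.pi) ^ 2 := by
  rw [measureReal_def, volume_torus, ENNReal.toReal_ofReal (by positivity)]

lemma integral_character (k : Fin 2 → ℤ) :
    ∫ x, character k x = if k = 0 then ((2 * Real.pi : ℝ) ^ 2 : ℂ) else 0 := by
  split_ifs with h
  · subst h
    simp only [character_zero, integral_const, volume_real_torus]
    simp
  · obtain ⟨j, hj⟩ : ∃ j, k j ≠ 0 := by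
      by_contra! h'
      exact h (funext h')
    -- translating by half a period in a direction where `k` is nonzero changes the sign
    refine integral_eq_zero_of_add_right_eq_neg (μ := volume)
      (g := Pi.single j ((2 * Real.pi / 2 / (k j) : ℝ) : Circ)) fun x => ?_
    rw [character_map_add]
    have : character k (Pi.single j ((2 * Real.pi / 2 / (k j) : ℝ) : Circ)) = -1 := by
      rw [character_apply, Finset.prod_eq_single j]
      · have := fourier_add_half_inv_index (T := 2 * Real.pi) hj Real.two_pi_pos 0
        rw [zero_add, fourier_eval_zero] at this
        rw [Pi.single_eq_same]
        exact this
      · intro b _ hb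
        rw [Pi.single_eq_of_ne hb, fourier_eval_zero]
      · simp
    rw [this, mul_neg_one]

lemma two_pi_sq_ne_zero : ((2 * Real.pi : ℝ) ^ 2 : ℂ) ≠ 0 := by
  exact_mod_cast (by positivity : (2 * Real.pi) ^ 2 ≠ 0)

lemma integrable_character_mul {f : Torus → ℂ} (hf : Integrable f) (k : Fin 2 → ℤ) :
    Integrable (fun x => character k x * f x) :=
  hf.bdd_mul (c := 1) (character k).continuous.aestronglyMeasurable
    (Eventually.of_forall fun x => (norm_character k x).le)

lemma integrable_conj_character_mul {f : Torus → ℂ} (hf : Integrable f) (k : Fin 2 → ℤ) :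
    Integrable (fun x => conj (character k x) * f x) := by
  simp only [conj_character]
  exact integrable_character_mul hf _

lemma integral_conj_character_mul (f : Torus → ℂ) (k : Fin 2 → ℤ) :
    ∫ x, conj (character k x) * f x = ((2 * Real.pi : ℝ) ^ 2 : ℂ) * coeff f k := by
  rw [coeff, mul_inv_cancel_left₀ two_pi_sq_ne_zero]

lemma coeff_congr {f g : Torus → ℂ} (h : f =ᵐ[volume] g) (k : Fin 2 → ℤ) :
    coeff f k = coeff g k := by
  unfold coeff
  congr 1
  exact integral_congr_ae (h.mono fun x hx => by simp [hx])

lemma coeff_character (k l : Fin 2 → ℤ) :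
    coeff (character k) l = if l = k then 1 else 0 := by
  simp only [coeff, conj_character, ← character_add, integral_character]
  by_cases h : l = k
  · subst h
    simp only [neg_add_cancel, if_true]
    exact inv_mul_cancel₀ two_pi_sq_ne_zero
  · rw [if_neg, if_neg h, mul_zero]
    intro h'
    exact h (neg_add_eq_zero.1 h')

lemma coeff_add {f g : Torus → ℂ} (hf : Integrable f) (hg : Integrable g) (k : Fin 2 → ℤ) :
    coeff (fun x => f x + g x) k = coeff f k + coeff g k := by
  simp only [coeff, mul_add]
  rw [integral_add (integrable_conj_character_mul hf k) (integrable_conj_character_mul hg k),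
    mul_add]

lemma coeff_const_mul (c : ℂ) (f : Torus → ℂ) (k : Fin 2 → ℤ) :
    coeff (fun x => c * f x) k = c * coeff f k := by
  simp only [coeff, mul_left_comm _ c, integral_const_mul]

lemma coeff_finset_sum {ι : Type*} (s : Finset ι) {f : ι → Torus → ℂ}
    (hf : ∀ i ∈ s, Integrable (f i)) (k : Fin 2 → ℤ) :
    coeff (fun x => ∑ i ∈ s, f i x) k = ∑ i ∈ s, coeff (f i) k := by
  simp only [coeff, Finset.mul_sum]
  rw [integral_finsetSum s fun i hi => integrable_conj_character_mul (hf i hi) k, Finset.mul_sum]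

/-- The coefficients of a real function are conjugate symmetric. -/
lemma coeff_neg_of_real (f : Torus → ℝ) (k : Fin 2 → ℤ) :
    coeff (fun x => (f x : ℂ)) (-k) = conj (coeff (fun x => (f x : ℂ)) k) := by
  simp only [coeff, map_mul, map_inv₀, map_pow, Complex.conj_ofReal, ← integral_conj,
    conj_character]

/-- The trigonometric polynomial with coefficients `c` and frequencies in `s`. -/
def trigPoly (s : Finset (Fin 2 → ℤ)) (c : (Fin 2 → ℤ) → ℂ) (x : Torus) : ℂ :=
  ∑ k ∈ s, c k * character k x

lemma continuous_trigPoly (s : Finset (Fin 2 → ℤ)) (c : (Fin 2 → ℤ) → ℂ) :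
    Continuous (trigPoly s c) := by
  unfold trigPoly
  fun_prop

lemma memLp_of_continuous {E : Type*} [NormedAddCommGroup E] [SecondCountableTopologyEither Torus E]
    {f : Torus → E} (hf : Continuous f) (p : ENNReal) : MemLp f p (volume : Measure Torus) := by
  obtain ⟨C, hC⟩ := isCompact_univ.exists_bound_of_continuousOn hf.continuousOn
  exact MemLp.of_bound hf.aestronglyMeasurable C (Eventually.of_forall fun x => hC x (mem_univ x))

lemma integrable_of_continuous {E : Type*} [NormedAddCommGroup E]
    [SecondCountableTopologyEither Torus E]
    {f : Torus → E} (hf : Continuous f) : Integrable f (volume : Measure Torus) :=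
  memLp_one_iff_integrable.1 (memLp_of_continuous hf 1)

lemma coeff_trigPoly (s : Finset (Fin 2 → ℤ)) (c : (Fin 2 → ℤ) → ℂ) (k : Fin 2 → ℤ) :
    coeff (trigPoly s c) k = if k ∈ s then c k else 0 := by
  unfold trigPoly
  rw [coeff_finset_sum s fun i _ => integrable_of_continuous (by fun_prop)]
  simp only [coeff_const_mul, coeff_character]
  simp

/-- Pairing a trigonometric polynomial with an integrable function. -/
lemma integral_conj_trigPoly_mul (s : Finset (Fin 2 → ℤ)) (c : (Fin 2 → ℤ) → ℂ) {f : Torus → ℂ}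
    (hf : Integrable f) :
    ∫ x, conj (trigPoly s c x) * f x
      = ((2 * Real.pi : ℝ) ^ 2 : ℂ) * ∑ k ∈ s, conj (c k) * coeff f k := by
  simp only [trigPoly, map_sum, map_mul, Finset.sum_mul, mul_assoc]
  rw [integral_finsetSum s fun i _ => (integrable_conj_character_mul hf i).const_mul _,
    Finset.mul_sum]
  refine Finset.sum_congr rfl fun k _ => ?_
  rw [integral_const_mul, integral_conj_character_mul]
  ring

/-- The trigonometric polynomials form a subalgebra separating points. -/
def characterSubalgebra : StarSubalgebra ℂ C(Torus, ℂ) where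
  toSubalgebra := Algebra.adjoin ℂ (range character)
  star_mem' := by
    change Algebra.adjoin ℂ (range character) ≤ star (Algebra.adjoin ℂ (range character))
    refine Subalgebra.star_adjoin_comm ℂ (range character) ▸ Algebra.adjoin_mono ?_
    rintro - ⟨n, rfl⟩
    refine ⟨-n, ?_⟩
    ext x
    simpa using (conj_character n x).symm

lemma characterSubalgebra_coe :
    Subalgebra.toSubmodule characterSubalgebra.toSubalgebra
      = Submodule.span ℂ (range character) := by
  apply Algebra.adjoin_eq_span_of_subset
  refine Subset.trans ?_ Submodule.subset_span
  intro x hx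
  refine Submonoid.closure_induction (fun _ => id) ⟨0, ?_⟩ ?_ hx
  · ext1 z
    exact character_zero z
  · rintro - - - - ⟨m, rfl⟩ ⟨n, rfl⟩
    refine ⟨m + n, ?_⟩
    ext1 z
    exact character_add m n z

lemma character_single (j : Fin 2) (x : Torus) : character (Pi.single j 1) x = fourier 1 (x j) := by
  rw [character_apply, Finset.prod_eq_single j]
  · simp
  · intro b _ hb
    simp [Pi.single_eq_of_ne hb]
  · simp

lemma span_character_closure_eq_top :
    (Submodule.span ℂ (range character)).topologicalClosure = ⊤ := by
  rw [← characterSubalgebra_coe]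
  have : characterSubalgebra.toSubalgebra.SeparatesPoints := by
    intro x y hxy
    obtain ⟨i, hi⟩ := Function.ne_iff.1 hxy
    refine ⟨_, ⟨character (Pi.single i 1), Algebra.subset_adjoin ⟨_, rfl⟩, rfl⟩, fun h => hi ?_⟩
    replace h : character (Pi.single i 1) x = character (Pi.single i 1) y := h
    rw [character_single, character_single, fourier_one, fourier_one] at h
    exact AddCircle.injective_toCircle Real.two_pi_pos.ne' (Subtype.coe_injective h)
  exact congr_arg (Subalgebra.toSubmodule <| StarSubalgebra.toSubalgebra ·)
    (ContinuousMap.starSubalgebra_topologicalClosure_eq_top_of_separatesPoints _ this)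

lemma exists_trigPoly_of_mem_span {f : C(Torus, ℂ)}
    (hf : f ∈ Submodule.span ℂ (range character)) :
    ∃ (s : Finset (Fin 2 → ℤ)) (c : (Fin 2 → ℤ) → ℂ), ⇑f = trigPoly s c := by
  obtain ⟨c, rfl⟩ := (Finsupp.mem_span_range_iff_exists_finsupp).1 hf
  refine ⟨c.support, c, ?_⟩
  ext x
  simp [trigPoly, Finsupp.sum, ContinuousMap.sum_apply]

/-- Trigonometric polynomials are dense in `L^p(𝕋²)` for `p < ∞`. -/
lemma exists_trigPoly_eLpNorm_sub_le {p : ENNReal} [Fact (1 ≤ p)] (hp : p ≠ ⊤) {f : Torus → ℂ}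
    (hf : MemLp f p volume) {ε : ENNReal} (hε : ε ≠ 0) :
    ∃ (s : Finset (Fin 2 → ℤ)) (c : (Fin 2 → ℤ) → ℂ),
      eLpNorm (fun x => f x - trigPoly s c x) p volume ≤ ε := by
  have hd : ((Submodule.span ℂ (range character)).map
      (ContinuousMap.toLp (E := ℂ) p (volume : Measure Torus) ℂ).toLinearMap).topologicalClosure
        = ⊤ := by
    simpa using (ContinuousMap.toLp_denseRange ℂ (volume : Measure Torus) ℂ
      hp).topologicalClosure_map_submodule span_character_closure_eq_top
  have hmem : hf.toLp f ∈ closure (((Submodule.span ℂ (range character)).map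
      (ContinuousMap.toLp (E := ℂ) p (volume : Measure Torus) ℂ).toLinearMap : Submodule ℂ _) :
        Set (Lp ℂ p (volume : Measure Torus))) := by
    rw [← Submodule.topologicalClosure_coe, hd]
    trivial
  obtain ⟨g, hg, hlt⟩ := Metric.mem_closure_iff.1 hmem (min ε 1).toReal
    (ENNReal.toReal_pos (by simp [hε]) (by simp))
  obtain ⟨q, hq, rfl⟩ := hg
  obtain ⟨s, c, hqs⟩ := exists_trigPoly_of_mem_span hq
  refine ⟨s, c, ?_⟩
  have h1 := (ENNReal.ofReal_lt_ofReal_iff (ENNReal.toReal_pos (a := min ε 1)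
    (by simp [hε]) (by simp))).2 hlt
  rw [← edist_dist, Lp.edist_def, ENNReal.ofReal_toReal (by simp)] at h1
  refine le_trans (le_of_eq ?_) (h1.le.trans (min_le_left _ _))
  refine eLpNorm_congr_ae ?_
  filter_upwards [hf.coeFn_toLp, ContinuousMap.coeFn_toLp (p := p) (𝕜 := ℂ) volume q] with x h1 h2
  simp only [Pi.sub_apply, h1, ContinuousLinearMap.coe_coe]
  rw [← hqs, h2]

/-! ### A subharmonic function controlling the conjugate function in `L³` -/

/-- A smoothed version of `|y|(3x² - y²)`: with `w = √(y² + δ)`, the function `w(3x² - w²)` of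
`x + iy`. It is subharmonic on `ℂ`. -/
def cubicSub (δ : ℝ) (z : ℂ) : ℝ :=
  3 * z.re ^ 2 * √(z.im ^ 2 + δ) - √(z.im ^ 2 + δ) ^ 3

/-- The derivative of `cubicSub δ` at `z` in the direction `v`. -/
def cubicSubDeriv (δ : ℝ) (z v : ℂ) : ℝ :=
  6 * z.re * √(z.im ^ 2 + δ) * v.re
    + (3 * z.re ^ 2 / √(z.im ^ 2 + δ) - 3 * √(z.im ^ 2 + δ)) * z.im * v.im

/-- The second derivative of `cubicSub δ` along a curve with position `z`, velocity `v` and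
acceleration `a`. -/
def cubicSubDeriv₂ (δ : ℝ) (z v a : ℂ) : ℝ :=
  6 * √(z.im ^ 2 + δ) * v.re ^ 2 + 12 * z.re * z.im / √(z.im ^ 2 + δ) * v.re * v.im
    + (3 * z.re ^ 2 * δ / √(z.im ^ 2 + δ) ^ 3 - 3 * √(z.im ^ 2 + δ)
        - 3 * z.im ^ 2 / √(z.im ^ 2 + δ)) * v.im ^ 2
    + cubicSubDeriv δ z a

lemma sqrt_sq_add_pos {δ : ℝ} (hδ : 0 < δ) (y : ℝ) : 0 < √(y ^ 2 + δ) :=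
  Real.sqrt_pos.2 (by positivity)

lemma hasDerivAt_re {e : ℝ → ℂ} {e' : ℂ} {r : ℝ} (h : HasDerivAt e e' r) :
    HasDerivAt (fun r => (e r).re) e'.re r :=
  Complex.reCLM.hasFDerivAt.comp_hasDerivAt r h

lemma hasDerivAt_im {e : ℝ → ℂ} {e' : ℂ} {r : ℝ} (h : HasDerivAt e e' r) :
    HasDerivAt (fun r => (e r).im) e'.im r :=
  Complex.imCLM.hasFDerivAt.comp_hasDerivAt r h

lemma hasDerivAt_sqrt_sq_add {δ : ℝ} (hδ : 0 < δ) {y : ℝ → ℝ} {y' r : ℝ}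
    (h : HasDerivAt y y' r) :
    HasDerivAt (fun r => √(y r ^ 2 + δ)) (y r * y' / √(y r ^ 2 + δ)) r := by
  have := ((h.fun_pow 2).add_const δ).sqrt (by positivity)
  convert this using 1
  have := sqrt_sq_add_pos hδ (y r)
  field_simp
  push_cast
  ring

lemma hasDerivAt_cubicSub {δ : ℝ} (hδ : 0 < δ) {e : ℝ → ℂ} {e' : ℂ} {r : ℝ}
    (h : HasDerivAt e e' r) :
    HasDerivAt (fun r => cubicSub δ (e r)) (cubicSubDeriv δ (e r) e') r := by
  have hx := hasDerivAt_re h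
  have hw := hasDerivAt_sqrt_sq_add hδ (hasDerivAt_im h)
  have hp := sqrt_sq_add_pos hδ (e r).im
  refine ((((hx.fun_pow 2).const_mul 3).fun_mul hw).fun_sub (hw.fun_pow 3)).congr_deriv ?_
  simp only [cubicSubDeriv]
  field_simp
  push_cast
  ring

lemma hasDerivAt_cubicSubDeriv {δ : ℝ} (hδ : 0 < δ) {e v : ℝ → ℂ} {a : ℂ} {r : ℝ}
    (h : HasDerivAt e (v r) r) (hv : HasDerivAt v a r) :
    HasDerivAt (fun r => cubicSubDeriv δ (e r) (v r)) (cubicSubDeriv₂ δ (e r) (v r) a) r := by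
  have hx := hasDerivAt_re h
  have hy := hasDerivAt_im h
  have hw := hasDerivAt_sqrt_sq_add hδ hy
  have hvx := hasDerivAt_re hv
  have hvy := hasDerivAt_im hv
  have hp := sqrt_sq_add_pos hδ (e r).im
  have hsq : √((e r).im ^ 2 + δ) ^ 2 = (e r).im ^ 2 + δ := Real.sq_sqrt (by positivity)
  have hδ' : δ = √((e r).im ^ 2 + δ) ^ 2 - (e r).im ^ 2 := by rw [hsq]; ring
  refine ((((hx.const_mul 6).fun_mul hw).fun_mul hvx).fun_add
    (((((hx.fun_pow 2).const_mul 3).fun_div hw hp.ne').fun_sub (hw.const_mul 3)).fun_mul hy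
      |>.fun_mul hvy)).congr_deriv ?_
  simp only [cubicSubDeriv, cubicSubDeriv₂]
  generalize √((e r).im ^ 2 + δ) = w at hp hsq hδ' ⊢
  clear hw
  subst hδ'
  field_simp
  push_cast
  ring

/-- Subharmonicity: the second derivatives along a holomorphic curve in the directions `1` and
`i` have a nonnegative sum. -/
lemma cubicSub_laplacian_nonneg {δ : ℝ} (hδ : 0 < δ) (z v a : ℂ) :
    0 ≤ cubicSubDeriv₂ δ z (Complex.I * v) (-a) + cubicSubDeriv₂ δ z v a := by
  have hp := sqrt_sq_add_pos hδ z.im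
  have hsq : √(z.im ^ 2 + δ) ^ 2 = z.im ^ 2 + δ := Real.sq_sqrt (by positivity)
  have : cubicSubDeriv₂ δ z (Complex.I * v) (-a) + cubicSubDeriv₂ δ z v a
      = (3 * δ / √(z.im ^ 2 + δ) + 3 * z.re ^ 2 * δ / √(z.im ^ 2 + δ) ^ 3)
        * (v.re ^ 2 + v.im ^ 2) := by
    have hδ' : δ = √(z.im ^ 2 + δ) ^ 2 - z.im ^ 2 := by rw [hsq]; ring
    simp only [cubicSubDeriv, cubicSubDeriv₂, Complex.mul_re, Complex.mul_im, Complex.I_re,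
      Complex.I_im, Complex.neg_re, Complex.neg_im]
    generalize √(z.im ^ 2 + δ) = w at *
    subst hδ'
    field_simp
    ring
  rw [this]
  positivity

lemma continuous_cubicSub (δ : ℝ) : Continuous (cubicSub δ) := by
  unfold cubicSub
  fun_prop

lemma continuous_cubicSubDeriv {X : Type*} [TopologicalSpace X] {δ : ℝ} (hδ : 0 < δ)
    {z v : X → ℂ} (hz : Continuous z) (hv : Continuous v) :
    Continuous fun x => cubicSubDeriv δ (z x) (v x) := by
  have hw : Continuous fun x => √((z x).im ^ 2 + δ) := by fun_prop
  have hw0 : ∀ x, √((z x).im ^ 2 + δ) ≠ 0 := fun x => (sqrt_sq_add_pos hδ _).ne'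
  have h1 : Continuous fun x => 3 * (z x).re ^ 2 / √((z x).im ^ 2 + δ) :=
    Continuous.div (by fun_prop) hw hw0
  unfold cubicSubDeriv
  fun_prop

lemma continuous_cubicSubDeriv₂ {X : Type*} [TopologicalSpace X] {δ : ℝ} (hδ : 0 < δ)
    {z v a : X → ℂ} (hz : Continuous z) (hv : Continuous v) (ha : Continuous a) :
    Continuous fun x => cubicSubDeriv₂ δ (z x) (v x) (a x) := by
  have hw : Continuous fun x => √((z x).im ^ 2 + δ) := by fun_prop
  have hw0 : ∀ x, √((z x).im ^ 2 + δ) ≠ 0 := fun x => (sqrt_sq_add_pos hδ _).ne'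
  have h1 : Continuous fun x => 12 * (z x).re * (z x).im / √((z x).im ^ 2 + δ) :=
    Continuous.div (by fun_prop) hw hw0
  have h2 : Continuous fun x => 3 * (z x).re ^ 2 * δ / √((z x).im ^ 2 + δ) ^ 3 :=
    Continuous.div (by fun_prop) (by fun_prop) fun x => pow_ne_zero 3 (hw0 x)
  have h3 : Continuous fun x => 3 * (z x).im ^ 2 / √((z x).im ^ 2 + δ) :=
    Continuous.div (by fun_prop) hw hw0
  have h4 := continuous_cubicSubDeriv hδ hz ha
  unfold cubicSubDeriv₂
  fun_prop

/-- Differentiation under the integral sign on the torus. -/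
lemma hasDerivAt_integral_torus {Q Q' : Torus → ℝ → ℝ}
    (hQ : Continuous (Function.uncurry Q)) (hQ' : Continuous (Function.uncurry Q'))
    (h : ∀ x r, HasDerivAt (Q x) (Q' x r) r) (r₀ : ℝ) :
    HasDerivAt (fun r => ∫ x, Q x r) (∫ x, Q' x r₀) r₀ := by
  obtain ⟨C, hC⟩ := (isCompact_univ.prod (isCompact_closedBall r₀ 1)).exists_bound_of_continuousOn
    (f := Function.uncurry Q') hQ'.continuousOn
  refine (hasDerivAt_integral_of_dominated_loc_of_deriv_le (F := fun r x => Q x r)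
    (F' := fun r x => Q' x r) (bound := fun _ => C) (Metric.ball_mem_nhds r₀ one_pos) ?_ ?_ ?_ ?_ ?_
    ?_).2
  · exact Eventually.of_forall fun r =>
      (hQ.comp (Continuous.prodMk_left r)).aestronglyMeasurable
  · exact integrable_of_continuous (hQ.comp (Continuous.prodMk_left r₀))
  · exact (hQ'.comp (Continuous.prodMk_left r₀)).aestronglyMeasurable
  · exact Eventually.of_forall fun x r hr => hC (x, r) ⟨mem_univ _,
      Metric.ball_subset_closedBall hr⟩
  · exact integrable_const C
  · exact Eventually.of_forall fun x r _ => h x r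

/-- A function on `ℝ` with nonnegative second derivative which is bounded above on `[0, ∞)` is
nowhere larger on `[0, ∞)` than at `0`. -/
lemma le_zero_of_convex_bounded {M M₁ M₂ : ℝ → ℝ} (h₁ : ∀ s, HasDerivAt M (M₁ s) s)
    (h₂ : ∀ s, HasDerivAt M₁ (M₂ s) s) (hpos : ∀ s, 0 ≤ M₂ s) {B : ℝ}
    (hB : ∀ s, 0 ≤ s → M s ≤ B) {s : ℝ} (hs : 0 ≤ s) : M s ≤ M 0 := by
  have hmono : Monotone M₁ := monotone_of_hasDerivAt_nonneg h₂ hpos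
  have hneg : ∀ r, 0 ≤ r → M₁ r ≤ 0 := by
    intro r hr
    by_contra! hlt
    have hlow : ∀ q, r < q → M₁ r * (q - r) ≤ M q - M r := by
      intro q hq
      obtain ⟨ζ, hζ, he⟩ := exists_hasDerivAt_eq_slope M M₁ hq
        (fun y _ => (h₁ y).continuousAt.continuousWithinAt) (fun y _ => h₁ y)
      have h1 : M₁ r ≤ (M q - M r) / (q - r) := he ▸ hmono hζ.1.le
      exact (le_div_iff₀ (sub_pos.2 hq)).1 h1
    have hBr := hB r hr
    have hq := hlow (r + ((B - M r) + 1) / M₁ r) (by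
      have : 0 < ((B - M r) + 1) / M₁ r := div_pos (by linarith) hlt
      linarith)
    have hBq := hB (r + ((B - M r) + 1) / M₁ r) (by
      have : 0 < ((B - M r) + 1) / M₁ r := div_pos (by linarith) hlt
      linarith)
    rw [add_sub_cancel_left, mul_div_cancel₀ _ hlt.ne'] at hq
    linarith
  have hanti : AntitoneOn M (Ici 0) := by
    refine antitoneOn_of_deriv_nonpos (convex_Ici 0)
      (fun y _ => (h₁ y).continuousAt.continuousWithinAt)
      (fun y _ => (h₁ y).differentiableAt.differentiableWithinAt) fun y hy => ?_
    rw [interior_Ici] at hy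
    rw [(h₁ y).deriv]
    exact hneg y (le_of_lt hy)
  exact hanti self_mem_Ici hs hs

/-! ### The conjugate function on a half-plane of frequencies -/

/-- The linear functional `k ↦ k · ν` on the lattice. -/
def slope (ν : Fin 2 → ℝ) (k : Fin 2 → ℤ) : ℝ := ∑ j, (k j : ℝ) * ν j

lemma slope_neg (ν : Fin 2 → ℝ) (k : Fin 2 → ℤ) : slope ν (-k) = -slope ν k := by
  simp only [slope, Fin.sum_univ_two, Pi.neg_apply]
  push_cast
  ring

/-- The `n`-th derivative in `z` of the extension `∑ₖ cₖ e^{i(k·ν)z} e^{ik·x}` of a trigonometric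
polynomial along the complexified direction `ν`. -/
def flowPoly (ν : Fin 2 → ℝ) (s : Finset (Fin 2 → ℤ)) (c : (Fin 2 → ℤ) → ℂ) (n : ℕ) (x : Torus)
    (z : ℂ) : ℂ :=
  ∑ k ∈ s, c k * (Complex.I * slope ν k) ^ n * Complex.exp (Complex.I * slope ν k * z)
    * character k x

lemma flowPoly_zero (ν : Fin 2 → ℝ) (s : Finset (Fin 2 → ℤ)) (c : (Fin 2 → ℤ) → ℂ) (x : Torus) :
    flowPoly ν s c 0 x 0 = trigPoly s c x := by
  simp [flowPoly, trigPoly]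

lemma continuous_flowPoly (ν : Fin 2 → ℝ) (s : Finset (Fin 2 → ℤ)) (c : (Fin 2 → ℤ) → ℂ) (n : ℕ)
    {X : Type*} [TopologicalSpace X] {f : X → Torus} {g : X → ℂ} (hf : Continuous f)
    (hg : Continuous g) : Continuous fun p => flowPoly ν s c n (f p) (g p) := by
  unfold flowPoly
  fun_prop

lemma hasDerivAt_flowPoly (ν : Fin 2 → ℝ) (s : Finset (Fin 2 → ℤ)) (c : (Fin 2 → ℤ) → ℂ) (n : ℕ)
    (x : Torus) (z : ℂ) : HasDerivAt (flowPoly ν s c n x) (flowPoly ν s c (n + 1) x z) z := by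
  unfold flowPoly
  refine HasDerivAt.fun_sum fun k _ => ?_
  have h : HasDerivAt (fun z => Complex.exp (Complex.I * slope ν k * z))
      (Complex.exp (Complex.I * slope ν k * z) * (Complex.I * slope ν k)) z := by
    simpa using ((hasDerivAt_id z).const_mul (Complex.I * slope ν k)).cexp
  refine ((h.const_mul (c k * (Complex.I * slope ν k) ^ n)).mul_const _).congr_deriv ?_
  ring

lemma hasDerivAt_flowPoly_line (ν : Fin 2 → ℝ) (s : Finset (Fin 2 → ℤ)) (c : (Fin 2 → ℤ) → ℂ)
    (n : ℕ) (x : Torus) (z d : ℂ) (r : ℝ) :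
    HasDerivAt (fun r : ℝ => flowPoly ν s c n x (z + d * r))
      (d * flowPoly ν s c (n + 1) x (z + d * r)) r := by
  have h : HasDerivAt (fun r : ℝ => z + d * (r : ℂ)) d r := by
    simpa using ((hasDerivAt_id r).ofReal_comp.const_mul d).const_add z
  have := (hasDerivAt_flowPoly ν s c n x (z + d * r)).scomp r h
  simpa [Function.comp_def] using this

/-- Moving `z` in the real direction is a translation of the torus. -/
lemma flowPoly_add_real (ν : Fin 2 → ℝ) (s : Finset (Fin 2 → ℤ)) (c : (Fin 2 → ℤ) → ℂ) (n : ℕ)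
    (x : Torus) (z : ℂ) (τ : ℝ) :
    flowPoly ν s c n x (z + 1 * τ)
      = flowPoly ν s c n (x + fun j => ((τ * ν j : ℝ) : Circ)) z := by
  unfold flowPoly
  refine Finset.sum_congr rfl fun k _ => ?_
  rw [character_map_add, character_coe, mul_add, Complex.exp_add]
  have : (Complex.I * slope ν k * (1 * τ) : ℂ)
      = Complex.I * ∑ j, (k j : ℂ) * ((τ * ν j : ℝ) : ℂ) := by
    simp only [slope, Fin.sum_univ_two]
    push_cast
    ring
  rw [this]
  ring

section Convexity

variable {δ : ℝ} (ν : Fin 2 → ℝ) (s : Finset (Fin 2 → ℤ)) (c : (Fin 2 → ℤ) → ℂ)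

lemma hasDerivAt_integral_cubicSub (hδ : 0 < δ) (z d : ℂ) (r : ℝ) :
    HasDerivAt (fun r : ℝ => ∫ x, cubicSub δ (flowPoly ν s c 0 x (z + d * r)))
      (∫ x, cubicSubDeriv δ (flowPoly ν s c 0 x (z + d * r))
        (d * flowPoly ν s c 1 x (z + d * r))) r := by
  have hc : ∀ n, Continuous fun p : Torus × ℝ => flowPoly ν s c n p.1 (z + d * p.2) := fun n =>
    continuous_flowPoly ν s c n (by fun_prop) (by fun_prop)
  have h0 := hc 0
  have h1 := hc 1
  refine hasDerivAt_integral_torus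
    (Q := fun x r => cubicSub δ (flowPoly ν s c 0 x (z + d * r)))
    (Q' := fun x r => cubicSubDeriv δ (flowPoly ν s c 0 x (z + d * r))
        (d * flowPoly ν s c 1 x (z + d * r))) ?_ ?_
    (fun x r => hasDerivAt_cubicSub hδ (hasDerivAt_flowPoly_line ν s c 0 x z d r)) r
  · exact (continuous_cubicSub δ).comp h0
  · exact continuous_cubicSubDeriv hδ h0 (continuous_const.mul h1)

lemma hasDerivAt_integral_cubicSubDeriv (hδ : 0 < δ) (z d : ℂ) (r : ℝ) :
    HasDerivAt (fun r : ℝ => ∫ x, cubicSubDeriv δ (flowPoly ν s c 0 x (z + d * r))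
        (d * flowPoly ν s c 1 x (z + d * r)))
      (∫ x, cubicSubDeriv₂ δ (flowPoly ν s c 0 x (z + d * r))
        (d * flowPoly ν s c 1 x (z + d * r)) (d * (d * flowPoly ν s c 2 x (z + d * r)))) r := by
  have hc : ∀ n, Continuous fun p : Torus × ℝ => flowPoly ν s c n p.1 (z + d * p.2) := fun n =>
    continuous_flowPoly ν s c n (by fun_prop) (by fun_prop)
  have h0 := hc 0
  have h1 := hc 1
  have h2 := hc 2
  refine hasDerivAt_integral_torus
    (Q := fun x r => cubicSubDeriv δ (flowPoly ν s c 0 x (z + d * r))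
        (d * flowPoly ν s c 1 x (z + d * r)))
    (Q' := fun x r => cubicSubDeriv₂ δ (flowPoly ν s c 0 x (z + d * r))
        (d * flowPoly ν s c 1 x (z + d * r)) (d * (d * flowPoly ν s c 2 x (z + d * r)))) ?_ ?_
    (fun x r => hasDerivAt_cubicSubDeriv hδ (hasDerivAt_flowPoly_line ν s c 0 x z d r)
      ((hasDerivAt_flowPoly_line ν s c 1 x z d r).const_mul d)) r
  · exact continuous_cubicSubDeriv hδ h0 (continuous_const.mul h1)
  · exact continuous_cubicSubDeriv₂ hδ h0 (continuous_const.mul h1)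
      (continuous_const.mul (continuous_const.mul h2))

/-- Translation invariance: the second derivative in the real direction integrates to `0`. -/
lemma integral_cubicSubDeriv₂_real (hδ : 0 < δ) (z : ℂ) :
    ∫ x, cubicSubDeriv₂ δ (flowPoly ν s c 0 x z) (flowPoly ν s c 1 x z) (flowPoly ν s c 2 x z)
      = 0 := by
  have hconst : ∀ τ : ℝ, ∫ x, cubicSub δ (flowPoly ν s c 0 x (z + 1 * τ))
      = ∫ x, cubicSub δ (flowPoly ν s c 0 x z) := fun τ => by
    simp only [flowPoly_add_real]
    exact integral_add_right_eq_self (fun x => cubicSub δ (flowPoly ν s c 0 x z)) _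
  have hzero : ∀ τ : ℝ, ∫ x, cubicSubDeriv δ (flowPoly ν s c 0 x (z + 1 * τ))
        (1 * flowPoly ν s c 1 x (z + 1 * τ)) = 0 := fun τ => by
    have h := hasDerivAt_integral_cubicSub ν s c hδ z 1 τ
    simp only [hconst] at h
    exact h.unique (hasDerivAt_const τ _)
  have h := hasDerivAt_integral_cubicSubDeriv ν s c hδ z 1 0
  simp only [hzero] at h
  simpa using h.unique (hasDerivAt_const _ _)

lemma integrable_cubicSubDeriv₂ (hδ : 0 < δ) (z d d' : ℂ) :
    Integrable fun x => cubicSubDeriv₂ δ (flowPoly ν s c 0 x z) (d * flowPoly ν s c 1 x z)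
      (d' * flowPoly ν s c 2 x z) := by
  have hc : ∀ n, Continuous fun x : Torus => flowPoly ν s c n x z := fun n =>
    continuous_flowPoly ν s c n (by fun_prop) (by fun_prop)
  have h0 := hc 0
  have h1 := hc 1
  have h2 := hc 2
  exact integrable_of_continuous (continuous_cubicSubDeriv₂ hδ h0 (by fun_prop) (by fun_prop))

lemma integral_cubicSubDeriv₂_imag_nonneg (hδ : 0 < δ) (z : ℂ) :
    0 ≤ ∫ x, cubicSubDeriv₂ δ (flowPoly ν s c 0 x z) (Complex.I * flowPoly ν s c 1 x z)
      (Complex.I * (Complex.I * flowPoly ν s c 2 x z)) := by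
  have h1 := integrable_cubicSubDeriv₂ ν s c hδ z Complex.I (-1)
  have h2 := integrable_cubicSubDeriv₂ ν s c hδ z 1 1
  simp only [one_mul, neg_one_mul] at h1 h2
  simp only [← mul_assoc, Complex.I_mul_I, neg_one_mul]
  have h := integral_add h1 h2
  rw [integral_cubicSubDeriv₂_real ν s c hδ z, add_zero] at h
  rw [← h]
  exact integral_nonneg fun x => cubicSub_laplacian_nonneg hδ _ _ _

end Convexity

lemma norm_exp_I_mul_I_mul (a r : ℝ) :
    ‖Complex.exp (Complex.I * a * (Complex.I * r))‖ = Real.exp (-(a * r)) := by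
  rw [Complex.norm_exp]
  congr 1
  have : (Complex.I * a * (Complex.I * r) : ℂ) = ((-(a * r) : ℝ) : ℂ) := by
    push_cast
    linear_combination (a * r : ℂ) * Complex.I_mul_I
  rw [this, Complex.ofReal_re]

lemma norm_flowPoly_le {ν : Fin 2 → ℝ} {s : Finset (Fin 2 → ℤ)} {c : (Fin 2 → ℤ) → ℂ}
    (hc : ∀ k ∈ s, slope ν k < 0 → c k = 0) (x : Torus) {r : ℝ} (hr : 0 ≤ r) :
    ‖flowPoly ν s c 0 x (Complex.I * r)‖ ≤ ∑ k ∈ s, ‖c k‖ := by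
  refine norm_sum_le_of_le s fun k hk => ?_
  rw [norm_mul, norm_mul, norm_character, mul_one, pow_zero, mul_one, norm_exp_I_mul_I_mul]
  rcases lt_or_ge (slope ν k) 0 with h | h
  · simp [hc k hk h]
  · exact mul_le_of_le_one_right (norm_nonneg _) (Real.exp_le_one_iff.2 (by nlinarith))

lemma tendsto_flowPoly {ν : Fin 2 → ℝ} {s : Finset (Fin 2 → ℤ)} {c : (Fin 2 → ℤ) → ℂ}
    (hc : ∀ k ∈ s, slope ν k < 0 → c k = 0) (x : Torus) :
    Tendsto (fun r : ℝ => flowPoly ν s c 0 x (Complex.I * r)) atTop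
      (nhds (trigPoly s (fun k => if slope ν k = 0 then c k else 0) x)) := by
  refine tendsto_finsetSum s fun k hk => Tendsto.mul_const _ ?_
  simp only [pow_zero, mul_one]
  rcases lt_trichotomy (slope ν k) 0 with h | h | h
  · simp [hc k hk h]
  · simp [h]
  · rw [if_neg h.ne']
    rw [tendsto_zero_iff_norm_tendsto_zero]
    simp only [norm_mul, norm_exp_I_mul_I_mul]
    rw [← mul_zero ‖c k‖]
    exact (Real.tendsto_exp_neg_atTop_nhds_zero.comp (tendsto_id.const_mul_atTop h)).const_mul _

/-- The value at height `0` dominates the value at infinite height. -/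
lemma integral_cubicSub_trigPoly_ge {δ : ℝ} (hδ : 0 < δ) {ν : Fin 2 → ℝ}
    {s : Finset (Fin 2 → ℤ)} {c : (Fin 2 → ℤ) → ℂ} (hc : ∀ k ∈ s, slope ν k < 0 → c k = 0) :
    ∫ x, cubicSub δ (trigPoly s (fun k => if slope ν k = 0 then c k else 0) x)
      ≤ ∫ x, cubicSub δ (trigPoly s c x) := by
  obtain ⟨B, hB⟩ := (isCompact_closedBall (0 : ℂ) (∑ k ∈ s, ‖c k‖)).exists_bound_of_continuousOn
    (f := cubicSub δ) (continuous_cubicSub δ).continuousOn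
  have hbound : ∀ x, ∀ r : ℝ, 0 ≤ r → ‖cubicSub δ (flowPoly ν s c 0 x (Complex.I * r))‖ ≤ B :=
    fun x r hr => hB _ (by simpa using norm_flowPoly_le hc x hr)
  have hcont : ∀ r : ℝ, Continuous fun x => cubicSub δ (flowPoly ν s c 0 x (Complex.I * r)) :=
    fun r => (continuous_cubicSub δ).comp (continuous_flowPoly ν s c 0 (by fun_prop) (by fun_prop))
  have hlim : Tendsto (fun r : ℝ => ∫ x, cubicSub δ (flowPoly ν s c 0 x (Complex.I * r))) atTop
      (nhds (∫ x, cubicSub δ (trigPoly s (fun k => if slope ν k = 0 then c k else 0) x))) := by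
    refine tendsto_integral_filter_of_dominated_convergence (fun _ => B)
      (Eventually.of_forall fun r => (hcont r).aestronglyMeasurable) ?_ (integrable_const _)
      (Eventually.of_forall fun x =>
        ((continuous_cubicSub δ).tendsto _).comp (tendsto_flowPoly hc x))
    filter_upwards [eventually_ge_atTop 0] with r hr
    exact Eventually.of_forall fun x => hbound x r hr
  refine le_of_tendsto hlim ?_
  filter_upwards [eventually_ge_atTop 0] with r hr
  have h := le_zero_of_convex_bounded
    (M := fun r : ℝ => ∫ x, cubicSub δ (flowPoly ν s c 0 x (0 + Complex.I * r)))
    (fun r => hasDerivAt_integral_cubicSub ν s c hδ 0 Complex.I r)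
    (fun r => hasDerivAt_integral_cubicSubDeriv ν s c hδ 0 Complex.I r)
    (fun r => integral_cubicSubDeriv₂_imag_nonneg ν s c hδ _)
    (B := ∫ _ : Torus, B) (fun r hr => by
      refine integral_mono ?_ (integrable_const _) fun x => ?_
      · simpa only [zero_add] using integrable_of_continuous (hcont r)
      · rw [zero_add]
        exact (le_abs_self _).trans (hbound x r hr)) hr
  simpa [flowPoly_zero] using h

/-- **The conjugate function in `L³`.** If the frequencies of a trigonometric polynomial lie in a
closed half-plane, and the part of it carried by the boundary line is real, then its imaginary
part is controlled in `L³` by its real part. -/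
lemma integral_abs_im_pow_le {ν : Fin 2 → ℝ} {s : Finset (Fin 2 → ℤ)} {c : (Fin 2 → ℤ) → ℂ}
    (hc : ∀ k ∈ s, slope ν k < 0 → c k = 0)
    (hreal : ∀ x, (trigPoly s (fun k => if slope ν k = 0 then c k else 0) x).im = 0) :
    ∫ x, |(trigPoly s c x).im| ^ 3 ≤ 18 * ∫ x, |(trigPoly s c x).re| ^ 3 := by
  have hcont := continuous_trigPoly s c
  have i1 : Integrable fun x => |(trigPoly s c x).im| ^ 3 :=
    integrable_of_continuous (by fun_prop)
  have i2 : Integrable fun x => |(trigPoly s c x).re| ^ 3 :=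
    integrable_of_continuous (by fun_prop)
  have i3 : Integrable fun x => (trigPoly s c x).re ^ 2 :=
    integrable_of_continuous (by fun_prop)
  -- the inequality for the smoothed function, with `δ = η²`
  have key : ∀ η : ℝ, 0 < η → ∫ x, |(trigPoly s c x).im| ^ 3
      ≤ (1 / 2 * ∫ x, |(trigPoly s c x).im| ^ 3) + (9 * ∫ x, |(trigPoly s c x).re| ^ 3)
        + 3 * η * (∫ x, (trigPoly s c x).re ^ 2) + (2 * Real.pi) ^ 2 * η ^ 3 := by
    intro η hη
    have h0 := integral_cubicSub_trigPoly_ge (δ := η ^ 2) (by positivity) hc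
    have h1 : -((2 * Real.pi) ^ 2 * η ^ 3)
        ≤ ∫ x, cubicSub (η ^ 2) (trigPoly s (fun k => if slope ν k = 0 then c k else 0) x) := by
      have : ∫ _ : Torus, (-η ^ 3) = -((2 * Real.pi) ^ 2 * η ^ 3) := by
        rw [integral_const, volume_real_torus, smul_eq_mul]
        ring
      rw [← this]
      refine integral_mono (integrable_const _) (integrable_of_continuous
        ((continuous_cubicSub _).comp (continuous_trigPoly _ _))) fun x => ?_
      simp only [cubicSub, hreal]
      rw [zero_pow two_ne_zero, zero_add, Real.sqrt_sq hη.le]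
      have : 0 ≤ 3 * (trigPoly s (fun k => if slope ν k = 0 then c k else 0) x).re ^ 2 * η := by
        positivity
      linarith
    have h2 : ∫ x, (|(trigPoly s c x).im| ^ 3 + cubicSub (η ^ 2) (trigPoly s c x))
        ≤ ∫ x, (1 / 2 * |(trigPoly s c x).im| ^ 3 + 9 * |(trigPoly s c x).re| ^ 3
          + 3 * η * (trigPoly s c x).re ^ 2) := by
      refine integral_mono (i1.add (integrable_of_continuous
        ((continuous_cubicSub _).comp hcont)))
        (((i1.const_mul _).add (i2.const_mul _)).add (i3.const_mul _)) fun x => ?_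
      simp only [cubicSub]
      generalize (trigPoly s c x).re = a
      generalize (trigPoly s c x).im = b
      set w := √(b ^ 2 + η ^ 2) with hw
      have hw1 : |b| ≤ w := Real.abs_le_sqrt (by nlinarith)
      have hw2 : w ≤ |b| + η := by
        rw [hw, Real.sqrt_le_left (by positivity)]
        nlinarith [sq_abs b, abs_nonneg b]
      have hb := abs_nonneg b
      have ha := abs_nonneg a
      have hw3 : |b| ^ 3 ≤ w ^ 3 := by gcongr
      have h3 : 3 * a ^ 2 * |b| ≤ 1 / 2 * |b| ^ 3 + 9 * |a| ^ 3 := by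
        rw [← sq_abs a]
        rcases le_total (|b|) (3 * |a|) with h | h
        · nlinarith [mul_le_mul_of_nonneg_left h (sq_nonneg |a|), pow_nonneg hb 3]
        · nlinarith [mul_le_mul_of_nonneg_left h (mul_nonneg ha hb), pow_nonneg ha 3,
            mul_le_mul_of_nonneg_left h (sq_nonneg |b|)]
      have h4 : 3 * a ^ 2 * w ≤ 3 * a ^ 2 * (|b| + η) := by gcongr
      nlinarith
    have i4 : Integrable fun x => cubicSub (η ^ 2) (trigPoly s c x) :=
      integrable_of_continuous ((continuous_cubicSub _).comp hcont)
    have i5 : Integrable fun x =>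
        1 / 2 * |(trigPoly s c x).im| ^ 3 + 9 * |(trigPoly s c x).re| ^ 3 :=
      (i1.const_mul _).add (i2.const_mul _)
    rw [integral_add i1 i4, integral_add i5 (i3.const_mul _),
      integral_add (i1.const_mul _) (i2.const_mul _), integral_const_mul, integral_const_mul,
      integral_const_mul] at h2
    linarith
  have hlim : Tendsto (fun η : ℝ => (1 / 2 * ∫ x, |(trigPoly s c x).im| ^ 3)
      + (9 * ∫ x, |(trigPoly s c x).re| ^ 3)
        + 3 * η * (∫ x, (trigPoly s c x).re ^ 2) + (2 * Real.pi) ^ 2 * η ^ 3) (nhdsWithin 0 (Ioi 0))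
      (nhds ((1 / 2 * ∫ x, |(trigPoly s c x).im| ^ 3) + (9 * ∫ x, |(trigPoly s c x).re| ^ 3)
        + 3 * 0 * (∫ x, (trigPoly s c x).re ^ 2) + (2 * Real.pi) ^ 2 * 0 ^ 3)) :=
    (Continuous.tendsto (by fun_prop) 0).mono_left nhdsWithin_le_nhds
  have := ge_of_tendsto hlim (eventually_mem_nhdsWithin.mono fun η hη => key η hη)
  linarith

/-- Reality of a trigonometric polynomial, expressed through its coefficients: the frequencies are
symmetric about the origin and the coefficients are conjugate symmetric. -/
structure IsRealTrig (s : Finset (Fin 2 → ℤ)) (c : (Fin 2 → ℤ) → ℂ) : Prop where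
  neg_mem : ∀ k ∈ s, -k ∈ s
  conj_coeff : ∀ k ∈ s, c (-k) = conj (c k)

lemma conj_trigPoly {s : Finset (Fin 2 → ℤ)} (hs : ∀ k ∈ s, -k ∈ s) (c : (Fin 2 → ℤ) → ℂ)
    (x : Torus) : conj (trigPoly s c x) = trigPoly s (fun k => conj (c (-k))) x := by
  simp only [trigPoly, map_sum, map_mul, conj_character]
  refine Finset.sum_nbij' (fun k => -k) (fun k => -k) hs hs ?_ ?_ ?_ <;> simp

lemma trigPoly_congr {s : Finset (Fin 2 → ℤ)} {c d : (Fin 2 → ℤ) → ℂ} (h : ∀ k ∈ s, c k = d k)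
    (x : Torus) : trigPoly s c x = trigPoly s d x :=
  Finset.sum_congr rfl fun k hk => by rw [h k hk]

lemma trigPoly_add (s : Finset (Fin 2 → ℤ)) (c d : (Fin 2 → ℤ) → ℂ) (x : Torus) :
    trigPoly s c x + trigPoly s d x = trigPoly s (fun k => c k + d k) x := by
  simp only [trigPoly, ← Finset.sum_add_distrib, add_mul]

lemma trigPoly_const_mul (s : Finset (Fin 2 → ℤ)) (a : ℂ) (c : (Fin 2 → ℤ) → ℂ) (x : Torus) :
    a * trigPoly s c x = trigPoly s (fun k => a * c k) x := by
  simp only [trigPoly, Finset.mul_sum, mul_assoc]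

/-- The multiplier `sgn (k · ν)` is bounded in `L³` on real trigonometric polynomials, uniformly in
the direction `ν`. -/
lemma integral_norm_sign_trigPoly_le (ν : Fin 2 → ℝ) {s : Finset (Fin 2 → ℤ)}
    {c : (Fin 2 → ℤ) → ℂ} (h : IsRealTrig s c) :
    ∫ x, ‖trigPoly s (fun k => (Real.sign (slope ν k) : ℂ) * c k) x‖ ^ 3
      ≤ 18 * ∫ x, ‖trigPoly s c x‖ ^ 3 := by
  -- `F = f + S f`, with `f` the given polynomial and `S f` its image
  set d : (Fin 2 → ℤ) → ℂ := fun k => (1 + (Real.sign (slope ν k) : ℂ)) * c k with hd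
  have hconj : ∀ x, conj (trigPoly s d x)
      = trigPoly s (fun k => (1 - (Real.sign (slope ν k) : ℂ)) * c k) x := fun x => by
    rw [conj_trigPoly h.neg_mem]
    refine trigPoly_congr (fun k hk => ?_) x
    simp only [hd, slope_neg, Real.sign_neg, map_mul, map_add, map_one, Complex.conj_ofReal,
      h.conj_coeff k hk, Complex.conj_conj]
    push_cast
    ring
  have hre : ∀ x, ((trigPoly s d x).re : ℂ) = trigPoly s c x := fun x => by
    rw [Complex.re_eq_add_conj, hconj, trigPoly_add, div_eq_inv_mul, trigPoly_const_mul]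
    refine trigPoly_congr (fun k _ => ?_) x
    simp only [hd]
    ring
  have him : ∀ x, Complex.I * ((trigPoly s d x).im : ℂ)
      = trigPoly s (fun k => (Real.sign (slope ν k) : ℂ) * c k) x := fun x => by
    rw [Complex.im_eq_sub_conj, hconj, sub_eq_add_neg, ← neg_one_mul (trigPoly s _ x),
      trigPoly_const_mul, trigPoly_add, div_eq_inv_mul, trigPoly_const_mul, trigPoly_const_mul]
    refine trigPoly_congr (fun k _ => ?_) x
    simp only [hd]
    field_simp
    ring
  have key := integral_abs_im_pow_le (ν := ν) (s := s) (c := d) ?_ ?_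
  · calc ∫ x, ‖trigPoly s (fun k => (Real.sign (slope ν k) : ℂ) * c k) x‖ ^ 3
        = ∫ x, |(trigPoly s d x).im| ^ 3 := by
          congr 1 with x
          rw [← him, norm_mul, Complex.norm_I, one_mul, Complex.norm_real, Real.norm_eq_abs]
      _ ≤ 18 * ∫ x, |(trigPoly s d x).re| ^ 3 := key
      _ = 18 * ∫ x, ‖trigPoly s c x‖ ^ 3 := by
          congr 2 with x
          rw [← hre, Complex.norm_real, Real.norm_eq_abs]
  · intro k _ hk
    simp [hd, Real.sign_of_neg hk]
  · intro x
    rw [← Complex.conj_eq_iff_im, conj_trigPoly h.neg_mem]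
    refine trigPoly_congr (fun k hk => ?_) x
    simp only [slope_neg, neg_eq_zero]
    split_ifs with h0
    · simp [hd, h0, slope_neg, h.conj_coeff k hk]
    · simp

/-! ### Odd multipliers as averages of half-plane signs -/

/-- The point of the unit circle with polar angle `α`. -/
def circlePoint (α : ℝ) : Freq := !₂[Real.cos α, Real.sin α]

lemma circlePoint_ne_zero (α : ℝ) : circlePoint α ≠ 0 := by
  intro h
  have h0 : Real.cos α = 0 := by simpa [circlePoint] using congrArg (fun v : Freq => v 0) h
  have h1 : Real.sin α = 0 := by simpa [circlePoint] using congrArg (fun v : Freq => v 1) h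
  have := Real.sin_sq_add_cos_sq α
  simp [h0, h1] at this

lemma contDiff_circlePoint : ContDiff ℝ ∞ circlePoint := by
  rw [contDiff_euclidean]
  intro i
  fin_cases i
  · simpa [circlePoint] using Real.contDiff_cos
  · simpa [circlePoint] using Real.contDiff_sin

lemma exists_polar {ξ : Freq} (hξ : ξ ≠ 0) :
    ∃ r α : ℝ, 0 < r ∧ α ∈ Ioc (-Real.pi) Real.pi ∧ ξ = r • circlePoint α := by
  set z : ℂ := ⟨ξ 0, ξ 1⟩ with hz
  have hz0 : z ≠ 0 := by
    intro h
    apply hξ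
    ext i
    fin_cases i
    · simpa [hz] using congrArg Complex.re h
    · simpa [hz] using congrArg Complex.im h
  refine ⟨‖z‖, z.arg, norm_pos_iff.2 hz0, Complex.arg_mem_Ioc z, ?_⟩
  ext i
  fin_cases i
  · simp [circlePoint, Complex.norm_mul_cos_arg, hz]
  · simp [circlePoint, Complex.norm_mul_sin_arg, hz]

lemma circlePoint_add_pi (α : ℝ) : circlePoint (α + Real.pi) = -circlePoint α := by
  ext i
  fin_cases i <;> simp [circlePoint]

lemma measurable_realSign : Measurable Real.sign :=
  Measurable.ite measurableSet_Iio measurable_const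
    (Measurable.ite measurableSet_Ioi measurable_const measurable_const)

lemma abs_sign_le_one (r : ℝ) : |Real.sign r| ≤ 1 := by
  rcases Real.sign_apply_eq r with h | h | h <;> simp [h]

lemma sign_pos_mul {r : ℝ} (hr : 0 < r) (a : ℝ) : Real.sign (r * a) = Real.sign a := by
  rcases lt_trichotomy a 0 with h | rfl | h
  · rw [Real.sign_of_neg h, Real.sign_of_neg (mul_neg_of_pos_of_neg hr h)]
  · simp
  · rw [Real.sign_of_pos h, Real.sign_of_pos (mul_pos hr h)]

/-- An odd `C¹` function of the angle is an average of signs of half-planes. -/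
lemma eq_integral_sign {μ μ' : ℝ → ℂ} (hμ : ∀ α, HasDerivAt μ (μ' α) α) (hμ' : Continuous μ')
    (hodd : ∀ α, μ (α + Real.pi) = -μ α) {α : ℝ} (hα : α ∈ Icc 0 Real.pi) :
    μ α = 1 / 2 * ∫ γ in 0..Real.pi, μ' γ * (Real.sign (Real.sin (α - γ)) : ℂ) := by
  have h1 : ∫ γ in 0..α, μ' γ * (Real.sign (Real.sin (α - γ)) : ℂ) = μ α - μ 0 := by
    rw [← intervalIntegral.integral_eq_sub_of_hasDerivAt (fun x _ => hμ x)
      (hμ'.intervalIntegrable _ _)]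
    refine intervalIntegral.integral_congr_Ioo_of_le hα.1 fun γ hγ => ?_
    have : 0 < Real.sin (α - γ) :=
      Real.sin_pos_of_pos_of_lt_pi (by linarith [hγ.2]) (by linarith [hγ.1, hα.2])
    simp [Real.sign_of_pos this]
  have h2 : ∫ γ in α..Real.pi, μ' γ * (Real.sign (Real.sin (α - γ)) : ℂ)
      = -(μ Real.pi - μ α) := by
    rw [← intervalIntegral.integral_eq_sub_of_hasDerivAt (fun x _ => hμ x)
      (hμ'.intervalIntegrable _ _), ← intervalIntegral.integral_neg]
    refine intervalIntegral.integral_congr_Ioo_of_le hα.2 fun γ hγ => ?_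
    have : Real.sin (α - γ) < 0 :=
      Real.sin_neg_of_neg_of_neg_pi_lt (by linarith [hγ.1]) (by linarith [hγ.2, hα.1])
    simp [Real.sign_of_neg this]
  have hint : ∀ a b, IntervalIntegrable
      (fun γ => μ' γ * (Real.sign (Real.sin (α - γ)) : ℂ)) volume a b := by
    intro a b
    refine (hμ'.norm.intervalIntegrable a b).mono_fun ?_ (Eventually.of_forall fun γ => ?_)
    · refine (hμ'.measurable.mul (Complex.measurable_ofReal.comp ?_)).aestronglyMeasurable
      exact measurable_realSign.comp (by fun_prop)
    · simp only [norm_mul, norm_norm, Complex.norm_real]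
      refine mul_le_of_le_one_right (norm_nonneg _) ?_
      exact abs_sign_le_one _
  have h0 := hodd 0
  rw [zero_add] at h0
  rw [← intervalIntegral.integral_add_adjacent_intervals (hint 0 α) (hint α Real.pi), h1, h2, h0]
  ring

lemma latticeFreq_neg (k : Fin 2 → ℤ) : latticeFreq (-k) = -latticeFreq k := by
  ext i
  simp [latticeFreq]

lemma latticeFreq_zero : latticeFreq 0 = 0 := by
  ext i
  simp [latticeFreq]

lemma latticeFreq_ne_zero {k : Fin 2 → ℤ} (hk : k ≠ 0) : latticeFreq k ≠ 0 := by
  intro h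
  apply hk
  ext i
  simpa [latticeFreq] using congrArg (fun v : Freq => v i) h

/-- The direction whose half-plane sign occurs at angle `γ`. -/
def rotatedDirection (γ : ℝ) : Fin 2 → ℝ := ![-Real.sin γ, Real.cos γ]

/-- The method of rotations for an odd symbol: away from the origin it is an average of the signs
`sgn (k · ν)` over directions `ν`, with a continuous density. -/
lemma exists_density {m : Freq → Fin 2 → ℂ} (hm : IsDriftMultiplier m) (ho : IsOddMultiplier m)
    (l : Fin 2) : ∃ h : ℝ → ℂ, Continuous h ∧ ∀ k : Fin 2 → ℤ, k ≠ 0 →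
      m (latticeFreq k) l
        = ∫ γ in 0..Real.pi, h γ * (Real.sign (slope (rotatedDirection γ) k) : ℂ) := by
  set μ : ℝ → ℂ := fun α => m (circlePoint α) l with hμdef
  have hsm : ContDiff ℝ ∞ μ :=
    (hm.smooth l).comp_contDiff contDiff_circlePoint fun α => circlePoint_ne_zero α
  have hder : ∀ α, HasDerivAt μ (deriv μ α) α := fun α =>
    (hsm.differentiable (by simp) α).hasDerivAt
  have hcont : Continuous (deriv μ) := hsm.continuous_deriv (by simp)
  have hodd : ∀ α, μ (α + Real.pi) = -μ α := fun α => by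
    simp only [hμdef, circlePoint_add_pi, ho _ (circlePoint_ne_zero α), Pi.neg_apply]
  refine ⟨fun γ => 1 / 2 * deriv μ γ, by fun_prop, ?_⟩
  -- the formula in the upper half-plane
  have upper : ∀ k : Fin 2 → ℤ, ∀ r α : ℝ, 0 < r → α ∈ Icc 0 Real.pi →
      latticeFreq k = r • circlePoint α → m (latticeFreq k) l
        = ∫ γ in 0..Real.pi, 1 / 2 * deriv μ γ
          * (Real.sign (slope (rotatedDirection γ) k) : ℂ) := by
    intro k r α hr hα hk
    rw [hk, hm.homogeneous r _ hr (circlePoint_ne_zero α)]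
    have := eq_integral_sign hder hcont hodd hα
    rw [hμdef] at this
    simp only at this
    rw [this, ← intervalIntegral.integral_const_mul]
    congr 1 with γ
    rw [mul_assoc]
    congr 3
    have h0 : (k 0 : ℝ) = r * Real.cos α := by
      simpa [latticeFreq, circlePoint] using congrArg (fun v : Freq => v 0) hk
    have h1 : (k 1 : ℝ) = r * Real.sin α := by
      simpa [latticeFreq, circlePoint] using congrArg (fun v : Freq => v 1) hk
    rw [← sign_pos_mul hr, Real.sin_sub]
    congr 1
    simp only [slope, rotatedDirection, Fin.sum_univ_two, h0, h1, Matrix.cons_val_zero,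
      Matrix.cons_val_one]
    ring
  intro k hk
  have hne := latticeFreq_ne_zero hk
  obtain ⟨r, α, hr, hα, he⟩ := exists_polar hne
  rcases le_or_gt 0 α with h0 | h0
  · exact upper k r α hr ⟨h0, hα.2⟩ he
  · have hneg := latticeFreq_neg k
    have := upper (-k) r (α + Real.pi) hr ⟨by linarith [hα.1], by linarith⟩
      (by rw [circlePoint_add_pi, smul_neg, ← he, hneg])
    simp only [hneg, ho _ hne, slope_neg, Real.sign_neg, Complex.ofReal_neg, mul_neg,
      intervalIntegral.integral_neg, Pi.neg_apply] at this
    exact neg_injective this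

/-- Jensen's inequality for the cube, from the tangent line at the mean. -/
lemma integral_pow_three_le {X : Type*} [MeasurableSpace X] {μ : Measure X} [IsFiniteMeasure μ]
    {g : X → ℝ} (hg : Integrable g μ) (hg3 : Integrable (fun x => g x ^ 3) μ)
    (hpos : ∀ x, 0 ≤ g x) :
    (∫ x, g x ∂μ) ^ 3 ≤ μ.real univ ^ 2 * ∫ x, g x ^ 3 ∂μ := by
  set M := μ.real univ with hM
  rcases (measureReal_nonneg (μ := μ) (s := univ)).eq_or_lt with h0 | h0
  · have : μ = 0 := by
      rw [← Measure.measure_univ_eq_zero]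
      exact (measureReal_eq_zero_iff).1 h0.symm
    simp [this]
  have h0' : 0 < M := h0
  set a := (∫ x, g x ∂μ) / M with ha
  have ha0 : 0 ≤ a := div_nonneg (integral_nonneg hpos) h0'.le
  have hI : ∫ x, g x ∂μ = a * M := by rw [ha, div_mul_cancel₀ _ h0'.ne']
  have h1 : ∫ x, (3 * a ^ 2 * g x - 2 * a ^ 3) ∂μ ≤ ∫ x, g x ^ 3 ∂μ := by
    refine integral_mono ((hg.const_mul _).sub (integrable_const _)) hg3 fun x => ?_
    simp only
    nlinarith [mul_nonneg (add_nonneg (hpos x) (mul_nonneg zero_le_two ha0)) (sq_nonneg (g x - a))]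
  rw [integral_sub (hg.const_mul _) (integrable_const _), integral_const_mul, integral_const, hI,
    ← hM, smul_eq_mul] at h1
  rw [hI]
  calc (a * M) ^ 3 = M ^ 2 * (3 * a ^ 2 * (a * M) - M * (2 * a ^ 3)) := by ring
    _ ≤ M ^ 2 * ∫ x, g x ^ 3 ∂μ := by gcongr

/-- A multiplier which is an average of half-plane signs is bounded in `L³` on real trigonometric
polynomials. -/
lemma integral_norm_average_sign_le {h : ℝ → ℂ} (hh : Continuous h) :
    ∃ C : ℝ, 0 ≤ C ∧ ∀ (s : Finset (Fin 2 → ℤ)) (c : (Fin 2 → ℤ) → ℂ), IsRealTrig s c →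
      ∫ x, ‖trigPoly s (fun k => (∫ γ in 0..Real.pi, h γ *
          (Real.sign (slope (rotatedDirection γ) k) : ℂ)) * c k) x‖ ^ 3
        ≤ C * ∫ x, ‖trigPoly s c x‖ ^ 3 := by
  obtain ⟨B, hB⟩ := (isCompact_Icc (a := (0 : ℝ)) (b := Real.pi)).exists_bound_of_continuousOn
    hh.continuousOn
  have hB0 : 0 ≤ B := (norm_nonneg _).trans (hB 0 ⟨le_rfl, Real.pi_pos.le⟩)
  refine ⟨B ^ 3 * Real.pi ^ 2 * (Real.pi * 18), by positivity, fun s c hsc => ?_⟩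
  set P : Measure ℝ := volume.restrict (Ioc 0 Real.pi) with hP
  have hPuniv : P.real univ = Real.pi := by
    simp [hP, measureReal_def, Real.pi_pos.le]
  -- the half-plane multipliers applied to the polynomial
  set S : Torus → ℝ → ℂ := fun x γ =>
    trigPoly s (fun k => (Real.sign (slope (rotatedDirection γ) k) : ℂ) * c k) x with hS
  have hsl : ∀ k, Measurable fun γ : ℝ => (Real.sign (slope (rotatedDirection γ) k) : ℂ) := by
    intro k
    refine Complex.measurable_ofReal.comp (measurable_realSign.comp ?_)
    simp only [slope, rotatedDirection, Fin.sum_univ_two, Matrix.cons_val_zero, Matrix.cons_val_one]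
    fun_prop
  have hSm : Measurable (Function.uncurry S) := by
    simp only [hS, trigPoly, Function.uncurry_def]
    refine Finset.measurable_fun_sum s fun k _ => ?_
    exact (((hsl k).comp measurable_snd).mul_const _).mul
      ((character k).continuous.measurable.comp measurable_fst)
  have hSb : ∀ x γ, ‖S x γ‖ ≤ ∑ k ∈ s, ‖c k‖ := fun x γ => by
    refine norm_sum_le_of_le s fun k _ => ?_
    rw [norm_mul, norm_mul, norm_character, mul_one, Complex.norm_real]
    exact mul_le_of_le_one_left (norm_nonneg _) (abs_sign_le_one _)
  have hSb3 : ∀ x γ, ‖‖S x γ‖ ^ 3‖ ≤ (∑ k ∈ s, ‖c k‖) ^ 3 := fun x γ => by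
    rw [norm_pow, norm_norm]
    exact pow_le_pow_left₀ (norm_nonneg _) (hSb x γ) 3
  have hSx : ∀ x, Integrable (S x) P := fun x =>
    Integrable.of_bound (hSm.comp measurable_prodMk_left).aestronglyMeasurable _
      (Eventually.of_forall (hSb x))
  have hSx3 : ∀ x, Integrable (fun γ => ‖S x γ‖ ^ 3) P := fun x =>
    Integrable.of_bound ((hSm.comp measurable_prodMk_left).norm.pow_const 3).aestronglyMeasurable _
      (Eventually.of_forall (hSb3 x))
  have hprod : Integrable (Function.uncurry fun x γ => ‖S x γ‖ ^ 3)
      ((volume : Measure Torus).prod P) :=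
    Integrable.of_bound (hSm.norm.pow_const 3).aestronglyMeasurable _
      (Eventually.of_forall fun p => hSb3 p.1 p.2)
  have hpt : ∀ x, ‖trigPoly s (fun k => (∫ γ in 0..Real.pi, h γ *
      (Real.sign (slope (rotatedDirection γ) k) : ℂ)) * c k) x‖ ^ 3
      ≤ B ^ 3 * Real.pi ^ 2 * ∫ γ, ‖S x γ‖ ^ 3 ∂P := by
    intro x
    have heq : trigPoly s (fun k => (∫ γ in 0..Real.pi, h γ *
      (Real.sign (slope (rotatedDirection γ) k) : ℂ)) * c k) x = ∫ γ, h γ * S x γ ∂P := by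
      simp only [hS, trigPoly, Finset.mul_sum]
      rw [integral_finsetSum]
      · refine Finset.sum_congr rfl fun k _ => ?_
        rw [intervalIntegral.integral_of_le Real.pi_pos.le, mul_assoc, ← integral_mul_const]
        congr 1 with γ
        ring
      · intro k _
        refine Integrable.of_bound (C := B * ‖c k‖) ?_ ?_
        · exact (hh.measurable.mul (((hsl k).mul_const _).mul_const _)).aestronglyMeasurable
        · rw [hP]
          filter_upwards [ae_restrict_mem measurableSet_Ioc] with γ hγ
          rw [norm_mul, norm_mul, norm_mul, norm_character, mul_one, Complex.norm_real]
          exact mul_le_mul (hB γ ⟨hγ.1.le, hγ.2⟩)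
            (mul_le_of_le_one_left (norm_nonneg _) (abs_sign_le_one _)) (by positivity) hB0
    have hle : ‖∫ γ, h γ * S x γ ∂P‖ ≤ B * ∫ γ, ‖S x γ‖ ∂P := by
      rw [← integral_const_mul]
      refine norm_integral_le_of_norm_le ((hSx x).norm.const_mul B) ?_
      rw [hP]
      filter_upwards [ae_restrict_mem measurableSet_Ioc] with γ hγ
      rw [norm_mul]
      exact mul_le_mul_of_nonneg_right (hB γ ⟨hγ.1.le, hγ.2⟩) (norm_nonneg _)
    have hJ := integral_pow_three_le (hSx x).norm (hSx3 x) fun γ => norm_nonneg _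
    rw [hPuniv] at hJ
    calc _ = ‖∫ γ, h γ * S x γ ∂P‖ ^ 3 := by rw [heq]
      _ ≤ (B * ∫ γ, ‖S x γ‖ ∂P) ^ 3 := pow_le_pow_left₀ (norm_nonneg _) hle 3
      _ = B ^ 3 * (∫ γ, ‖S x γ‖ ∂P) ^ 3 := by ring
      _ ≤ B ^ 3 * (Real.pi ^ 2 * ∫ γ, ‖S x γ‖ ^ 3 ∂P) := by gcongr
      _ = _ := by ring
  calc _ ≤ ∫ x, B ^ 3 * Real.pi ^ 2 * ∫ γ, ‖S x γ‖ ^ 3 ∂P := by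
        refine integral_mono ?_ (hprod.integral_prod_left.const_mul _) hpt
        exact integrable_of_continuous ((continuous_trigPoly _ _).norm.pow 3)
    _ = B ^ 3 * Real.pi ^ 2 * ∫ γ, (∫ x, ‖S x γ‖ ^ 3) ∂P := by
        rw [integral_const_mul, integral_integral_swap hprod]
    _ ≤ B ^ 3 * Real.pi ^ 2 * ∫ _, (18 * ∫ x, ‖trigPoly s c x‖ ^ 3) ∂P := by
        refine mul_le_mul_of_nonneg_left (integral_mono hprod.integral_prod_right
          (integrable_const _) fun γ => ?_) (by positivity)
        exact integral_norm_sign_trigPoly_le _ hsc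
    _ = _ := by
        rw [integral_const, hPuniv, smul_eq_mul]
        ring

/-! ### Fejér means -/

/-- The discrete square `{0, …, N}²`. -/
def square (N : ℕ) : Finset (Fin 2 → ℤ) := Fintype.piFinset fun _ => Finset.Ico 0 ((N : ℤ) + 1)

lemma card_square (N : ℕ) : (square N).card = (N + 1) ^ 2 := by
  simp only [square, Fintype.card_piFinset, Int.card_Ico, Fin.prod_univ_two, sq, sub_zero,
    Int.toNat_natCast_add_one]

lemma card_square_pos (N : ℕ) : (0 : ℝ) < (square N).card := by
  rw [card_square]
  positivity

/-- The frequencies of the `N`-th Fejér kernel. -/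
def fejerFreq (N : ℕ) : Finset (Fin 2 → ℤ) :=
  (square N ×ˢ square N).image fun p => p.1 - p.2

/-- The coefficients of the `N`-th Fejér kernel `|∑_{j ∈ Q} e^{ij·x}|² / |Q|`, where
`Q = {0, …, N}²`: the proportion of pairs of points of `Q` with a given difference. -/
def fejerWeight (N : ℕ) (k : Fin 2 → ℤ) : ℝ :=
  ((square N ×ˢ square N).filter fun p => p.1 - p.2 = k).card / (square N).card

/-- The `N`-th Fejér mean of a function. -/
def fejer (N : ℕ) (f : Torus → ℂ) : Torus → ℂ :=
  trigPoly (fejerFreq N) fun k => fejerWeight N k * coeff f k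

/-- The Fejér kernel, as a function of two points of the torus, normalized to be a probability
density. -/
def fejerKernel (N : ℕ) (x y : Torus) : ℝ :=
  ((2 * Real.pi) ^ 2 * (square N).card)⁻¹
    * ‖∑ j ∈ square N, character j x * conj (character j y)‖ ^ 2

lemma neg_mem_fejerFreq {N : ℕ} : ∀ k ∈ fejerFreq N, -k ∈ fejerFreq N := by
  intro k hk
  simp only [fejerFreq, Finset.mem_image, Finset.mem_product, Prod.exists] at hk ⊢
  obtain ⟨a, b, ⟨ha, hb⟩, rfl⟩ := hk
  exact ⟨b, a, ⟨hb, ha⟩, by abel⟩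

lemma fejerWeight_neg (N : ℕ) (k : Fin 2 → ℤ) : fejerWeight N (-k) = fejerWeight N k := by
  unfold fejerWeight
  congr 2
  refine Finset.card_bij' (fun p _ => p.swap) (fun p _ => p.swap) ?_ ?_ ?_ ?_
  · rintro ⟨a, b⟩ h
    simp only [Finset.mem_filter, Finset.mem_product, Prod.swap] at h ⊢
    exact ⟨h.1.symm, by rw [← neg_sub, h.2, neg_neg]⟩
  · rintro ⟨a, b⟩ h
    simp only [Finset.mem_filter, Finset.mem_product, Prod.swap] at h ⊢
    exact ⟨h.1.symm, by rw [← neg_sub, h.2]⟩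
  · simp
  · simp

lemma fejerWeight_nonneg (N : ℕ) (k : Fin 2 → ℤ) : 0 ≤ fejerWeight N k := by
  unfold fejerWeight
  positivity

lemma fejerWeight_le_one (N : ℕ) (k : Fin 2 → ℤ) : fejerWeight N k ≤ 1 := by
  unfold fejerWeight
  rw [div_le_one (card_square_pos N)]
  norm_cast
  refine Finset.card_le_card_of_injOn Prod.fst (fun p hp => ?_) fun p hp q hq h => ?_
  · simp only [Finset.coe_filter, Finset.mem_product, Set.mem_ofPred_eq] at hp
    exact hp.1.1
  · simp only [Finset.coe_filter, Finset.mem_product, Set.mem_ofPred_eq] at hp hq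
    refine Prod.ext h ?_
    have := hp.2.trans hq.2.symm
    rw [h] at this
    exact sub_right_injective this

lemma fejerWeight_eq_zero {N : ℕ} {k : Fin 2 → ℤ} (hk : k ∉ fejerFreq N) :
    fejerWeight N k = 0 := by
  unfold fejerWeight
  rw [Finset.filter_eq_empty_iff.2]
  · simp
  · intro p hp h
    exact hk (Finset.mem_image.2 ⟨p, hp, h⟩)

lemma le_fejerWeight (N : ℕ) (k : Fin 2 → ℤ) (hN : ∀ j, 2 * |k j| ≤ N) :
    ∏ j, (1 - 2 * (|k j| : ℝ) / (N + 1)) ≤ fejerWeight N k := by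
  have hcard : (Fintype.piFinset fun j => Finset.Ico |k j| ((N : ℤ) + 1 - |k j|)).card
      ≤ ((square N ×ˢ square N).filter fun p => p.1 - p.2 = k).card := by
    refine Finset.card_le_card_of_injOn (fun l => (l + k, l)) (fun l hl => ?_) fun a _ b _ h => ?_
    · simp only [Finset.mem_coe, Fintype.mem_piFinset, Finset.mem_Ico] at hl
      simp only [Finset.coe_filter, Finset.mem_product, Set.mem_ofPred_eq, square,
        Fintype.mem_piFinset, Finset.mem_Ico, Pi.add_apply, add_sub_cancel_left, and_true]
      refine ⟨fun j => ?_, fun j => ?_⟩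
      · have := hl j
        have h1 := neg_abs_le (k j)
        have h2 := le_abs_self (k j)
        constructor <;> linarith
      · have := hl j
        have h1 := abs_nonneg (k j)
        constructor <;> linarith
    · exact (Prod.ext_iff.1 h).2
  have hcard' : ((Fintype.piFinset fun j => Finset.Ico |k j| ((N : ℤ) + 1 - |k j|)).card : ℝ)
      = ∏ j, ((N + 1) - 2 * (|k j| : ℝ)) := by
    rw [Fintype.card_piFinset]
    push_cast
    refine Finset.prod_congr rfl fun j _ => ?_
    rw [Int.card_Ico]
    have h : ((((N : ℤ) + 1 - |k j| - |k j|).toNat : ℤ) : ℝ)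
        = (((N : ℤ) + 1 - |k j| - |k j| : ℤ) : ℝ) := by
      rw [Int.toNat_of_nonneg]
      have := hN j
      linarith
    rw [← Int.cast_natCast, h]
    push_cast
    ring
  unfold fejerWeight
  rw [le_div_iff₀ (card_square_pos N)]
  calc _ = ((Fintype.piFinset fun j => Finset.Ico |k j| ((N : ℤ) + 1 - |k j|)).card : ℝ) := by
        rw [hcard', card_square]
        simp only [Fin.prod_univ_two]
        have : (N : ℝ) + 1 ≠ 0 := by positivity
        push_cast
        field_simp
    _ ≤ _ := by exact_mod_cast hcard

lemma tendsto_fejerWeight (k : Fin 2 → ℤ) :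
    Tendsto (fun N => fejerWeight N k) atTop (nhds 1) := by
  have h1 : Tendsto (fun N : ℕ => ∏ j, (1 - 2 * (|k j| : ℝ) / ((N : ℝ) + 1))) atTop
      (nhds (∏ _j : Fin 2, (1 - 0))) := by
    refine tendsto_finsetProd _ fun j _ => tendsto_const_nhds.sub ?_
    exact tendsto_const_nhds.div_atTop
      (tendsto_atTop_add_const_right _ _ tendsto_natCast_atTop_atTop)
  simp only [sub_zero, Finset.prod_const_one] at h1
  refine tendsto_of_tendsto_of_tendsto_of_le_of_le' h1 tendsto_const_nhds ?_
    (Eventually.of_forall fun N => fejerWeight_le_one N k)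
  filter_upwards [eventually_ge_atTop (∑ j, (2 * |k j|).toNat)] with N hN
  refine le_fejerWeight N k fun j => ?_
  have h2 : (2 * |k j|).toNat ≤ ∑ j, (2 * |k j|).toNat :=
    Finset.single_le_sum (f := fun j => (2 * |k j|).toNat) (fun _ _ => Nat.zero_le _)
      (Finset.mem_univ j)
  have := Int.self_le_toNat (2 * |k j|)
  omega

lemma fejerKernel_nonneg (N : ℕ) (x y : Torus) : 0 ≤ fejerKernel N x y := by
  unfold fejerKernel
  positivity

lemma continuous_fejerKernel (N : ℕ) : Continuous (Function.uncurry (fejerKernel N)) := by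
  simp only [Function.uncurry_def, fejerKernel]
  fun_prop

lemma fejerKernel_comm (N : ℕ) (x y : Torus) : fejerKernel N x y = fejerKernel N y x := by
  unfold fejerKernel
  congr 2
  rw [← Complex.norm_conj]
  simp [mul_comm]

lemma fejer_eq_integral (N : ℕ) {f : Torus → ℂ} (hf : Integrable f) (x : Torus) :
    fejer N f x = ∫ y, (fejerKernel N x y : ℂ) * f y := by
  have hker : ∀ y, (fejerKernel N x y : ℂ) = (((2 * Real.pi : ℝ) ^ 2 : ℂ) * (square N).card)⁻¹
      * ∑ p ∈ square N ×ˢ square N,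
        character (p.1 - p.2) x * conj (character (p.1 - p.2) y) := by
    intro y
    rw [fejerKernel]
    push_cast
    congr 1
    rw [← Complex.conj_mul', mul_comm, map_sum, Finset.sum_mul_sum, ← Finset.sum_product']
    refine Finset.sum_congr rfl fun p _ => ?_
    simp only [map_mul, Complex.conj_conj, sub_eq_add_neg, character_add, ← conj_character]
    ring
  have hlhs : fejer N f x = ((square N).card : ℂ)⁻¹ * ∑ p ∈ square N ×ˢ square N,
      coeff f (p.1 - p.2) * character (p.1 - p.2) x := by
    rw [Finset.sum_comp (fun k => coeff f k * character k x)
      fun p : (Fin 2 → ℤ) × (Fin 2 → ℤ) => p.1 - p.2,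
      Finset.mul_sum]
    refine Finset.sum_congr rfl fun k _ => ?_
    simp only [fejerWeight, nsmul_eq_mul]
    push_cast
    ring
  simp only [hker, mul_assoc]
  rw [integral_const_mul, hlhs, mul_inv, mul_comm _ ((square N).card : ℂ)⁻¹, mul_assoc]
  congr 1
  simp only [Finset.sum_mul, mul_assoc]
  rw [integral_finsetSum _ fun p _ => (integrable_conj_character_mul hf _).const_mul _,
    Finset.mul_sum]
  refine Finset.sum_congr rfl fun p _ => ?_
  rw [integral_const_mul, integral_conj_character_mul]
  field_simp [two_pi_sq_ne_zero]

lemma zero_mem_fejerFreq (N : ℕ) : (0 : Fin 2 → ℤ) ∈ fejerFreq N := by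
  refine Finset.mem_image.2 ⟨(0, 0), ?_, by simp⟩
  simp only [Finset.mem_product, square, Fintype.mem_piFinset, Finset.mem_Ico, Pi.zero_apply]
  constructor <;> intro _ <;> constructor <;> positivity

lemma fejerWeight_zero (N : ℕ) : fejerWeight N 0 = 1 := by
  refine le_antisymm (fejerWeight_le_one N 0) ?_
  simpa using le_fejerWeight N 0 (by simp)

lemma trigPoly_single {s : Finset (Fin 2 → ℤ)} {k : Fin 2 → ℤ} (hk : k ∈ s)
    (c : (Fin 2 → ℤ) → ℂ) (x : Torus) :
    trigPoly s (fun l => if l = k then c l else 0) x = c k * character k x := by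
  simp [trigPoly, hk]

lemma integral_fejerKernel (N : ℕ) (x : Torus) : ∫ y, fejerKernel N x y = 1 := by
  have h := fejer_eq_integral N (f := character 0)
    (integrable_of_continuous (character 0).continuous) x
  have h1 : fejer N (character 0) x = 1 := by
    have : fejer N (character 0) x = trigPoly (fejerFreq N)
        (fun l => if l = 0 then (fejerWeight N l : ℂ) else 0) x :=
      trigPoly_congr (fun k _ => by rw [coeff_character]; split_ifs <;> simp) x
    rw [this, trigPoly_single (zero_mem_fejerFreq N), fejerWeight_zero, character_zero]
    simp
  rw [h1] at h
  simp only [character_zero, mul_one] at h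
  rw [integral_complex_ofReal] at h
  exact_mod_cast h.symm

/-- Averaging against a doubly stochastic kernel does not increase the `L^p` norm. -/
lemma eLpNorm_integral_kernel_le {κ : Torus → Torus → ℝ} (hκ : Continuous (Function.uncurry κ))
    (hpos : ∀ x y, 0 ≤ κ x y) (h₁ : ∀ x, ∫ y, κ x y = 1) (h₂ : ∀ y, ∫ x, κ x y = 1)
    {p : ENNReal} (hp : 1 ≤ p) (hp' : p ≠ ⊤) {f : Torus → ℂ} (hf : AEStronglyMeasurable f volume) :
    eLpNorm (fun x => ∫ y, (κ x y : ℂ) * f y) p volume ≤ eLpNorm f p volume := by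
  have hp0 : p ≠ 0 := (zero_lt_one.trans_le hp).ne'
  have hq : 1 ≤ p.toReal := by
    rw [← ENNReal.toReal_one]
    exact ENNReal.toReal_mono hp' hp
  have hκm : Measurable fun z : Torus × Torus => ENNReal.ofReal (κ z.1 z.2) :=
    ENNReal.measurable_ofReal.comp hκ.measurable
  have hone : ∀ g : Torus → ℝ, Continuous g → (∀ y, 0 ≤ g y) → ∫ y, g y = 1 →
      ∫⁻ y, ENNReal.ofReal (g y) = 1 := fun g hg hg0 hg1 => by
    rw [← ofReal_integral_eq_lintegral_ofReal (integrable_of_continuous hg)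
      (Eventually.of_forall hg0), hg1, ENNReal.ofReal_one]
  have hpt : ∀ x, ‖∫ y, (κ x y : ℂ) * f y‖ₑ ^ p.toReal
      ≤ ∫⁻ y, ENNReal.ofReal (κ x y) * ‖f y‖ₑ ^ p.toReal := by
    intro x
    have hκx : Measurable fun y => ENNReal.ofReal (κ x y) := hκm.comp measurable_prodMk_left
    set ν : Measure Torus := volume.withDensity fun y => ENNReal.ofReal (κ x y) with hν
    have hν1 : ν univ = 1 := by
      rw [hν, withDensity_apply _ MeasurableSet.univ, setLIntegral_univ]
      exact hone _ (hκ.comp (Continuous.prodMk_right x)) (hpos x) (h₁ x)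
    have hfν : AEStronglyMeasurable f ν := hf.mono_ac (withDensity_absolutelyContinuous _ _)
    have hmul : ∀ r : ℝ, 0 ≤ r → ∫⁻ y, ‖f y‖ₑ ^ r ∂ν
        = ∫⁻ y, ENNReal.ofReal (κ x y) * ‖f y‖ₑ ^ r := fun r hr => by
      rw [hν, lintegral_withDensity_eq_lintegral_mul₀ hκx.aemeasurable
        (hf.enorm.pow_const r)]
      rfl
    have hJ := eLpNorm'_le_eLpNorm'_mul_rpow_measure_univ one_pos hq hfν
    rw [hν1, ENNReal.one_rpow, mul_one, eLpNorm'_eq_lintegral_enorm,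
      eLpNorm'_eq_lintegral_enorm] at hJ
    simp only [ENNReal.rpow_one, div_one] at hJ
    have hle : ‖∫ y, (κ x y : ℂ) * f y‖ₑ ≤ ∫⁻ y, ‖f y‖ₑ ∂ν := by
      have h1 := hmul 1 zero_le_one
      simp only [ENNReal.rpow_one] at h1
      rw [h1]
      refine (enorm_integral_le_lintegral_enorm _).trans (le_of_eq ?_)
      refine lintegral_congr fun y => ?_
      rw [enorm_mul, ← ofReal_norm (κ x y : ℂ), Complex.norm_real, Real.norm_of_nonneg (hpos x y)]
    calc _ ≤ ((∫⁻ y, ‖f y‖ₑ ^ p.toReal ∂ν) ^ (1 / p.toReal)) ^ p.toReal :=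
          ENNReal.rpow_le_rpow (hle.trans hJ) (by linarith)
      _ = ∫⁻ y, ‖f y‖ₑ ^ p.toReal ∂ν := by
          rw [← ENNReal.rpow_mul, one_div_mul_cancel (by linarith), ENNReal.rpow_one]
      _ = _ := hmul _ (by linarith)
  rw [eLpNorm_eq_lintegral_rpow_enorm_toReal hp0 hp',
    eLpNorm_eq_lintegral_rpow_enorm_toReal hp0 hp']
  refine ENNReal.rpow_le_rpow ?_ (by positivity)
  calc _ ≤ ∫⁻ x, ∫⁻ y, ENNReal.ofReal (κ x y) * ‖f y‖ₑ ^ p.toReal := lintegral_mono hpt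
    _ = ∫⁻ y, ∫⁻ x, ENNReal.ofReal (κ x y) * ‖f y‖ₑ ^ p.toReal := by
        refine lintegral_lintegral_swap ?_
        exact hκm.aemeasurable.mul (hf.enorm.pow_const p.toReal).comp_snd
    _ = _ := by
        refine lintegral_congr fun y => ?_
        have hκy : Measurable fun x => ENNReal.ofReal (κ x y) := hκm.comp measurable_prodMk_right
        rw [lintegral_mul_const _ hκy,
          hone (fun x => κ x y) (hκ.comp (Continuous.prodMk_left y)) (fun x => hpos x y) (h₂ y),
          one_mul]

/-- The Fejér means are contractions of `L^p`. -/
lemma eLpNorm_fejer_le (N : ℕ) {p : ENNReal} (hp : 1 ≤ p) (hp' : p ≠ ⊤) {f : Torus → ℂ}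
    (hf : Integrable f) : eLpNorm (fejer N f) p volume ≤ eLpNorm f p volume := by
  have : fejer N f = fun x => ∫ y, (fejerKernel N x y : ℂ) * f y :=
    funext fun x => fejer_eq_integral N hf x
  rw [this]
  refine eLpNorm_integral_kernel_le (continuous_fejerKernel N) (fejerKernel_nonneg N)
    (integral_fejerKernel N) (fun y => ?_) hp hp' hf.aestronglyMeasurable
  simp only [fejerKernel_comm N _ y]
  exact integral_fejerKernel N y

lemma fejer_sub (N : ℕ) {f g : Torus → ℂ} (hf : Integrable f) (hg : Integrable g) (x : Torus) :
    fejer N (fun x => f x - g x) x = fejer N f x - fejer N g x := by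
  have h : ∀ k, coeff (fun x => f x - g x) k = coeff f k - coeff g k := fun k => by
    have h1 := coeff_add hf (hg.const_mul (-1)) k
    rw [coeff_const_mul] at h1
    simpa only [neg_one_mul, ← sub_eq_add_neg] using h1
  simp only [fejer, trigPoly, h, ← Finset.sum_sub_distrib]
  refine Finset.sum_congr rfl fun k _ => by ring

lemma fejer_trigPoly (N : ℕ) (s : Finset (Fin 2 → ℤ)) (c : (Fin 2 → ℤ) → ℂ) (x : Torus) :
    fejer N (trigPoly s c) x = trigPoly s (fun k => fejerWeight N k * c k) x := by
  simp only [fejer, coeff_trigPoly]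
  simp only [trigPoly, mul_ite, mul_zero, ite_mul, zero_mul]
  rw [Finset.sum_ite_mem]
  refine Finset.sum_subset Finset.inter_subset_right fun k hk hk' => ?_
  rw [fejerWeight_eq_zero fun h => hk' (Finset.mem_inter.2 ⟨h, hk⟩)]
  simp

/-- The Fejér means converge in `L^p`, for `1 ≤ p < ∞`. -/
lemma tendsto_eLpNorm_fejer_sub {p : ENNReal} (hp : 1 ≤ p) (hp' : p ≠ ⊤) {f : Torus → ℂ}
    (hf : MemLp f p volume) :
    Tendsto (fun N => eLpNorm (fun x => fejer N f x - f x) p volume) atTop (nhds 0) := by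
  have : Fact (1 ≤ p) := ⟨hp⟩
  have hfi : Integrable f := hf.integrable hp
  refine ENNReal.tendsto_nhds_zero.2 fun ε hε => ?_
  have hε3 : ε / 3 ≠ 0 := by simp [hε.ne']
  obtain ⟨s, c, hsc⟩ := exists_trigPoly_eLpNorm_sub_le hp' hf hε3
  have hqi : Integrable (trigPoly s c) := integrable_of_continuous (continuous_trigPoly s c)
  have hq : Tendsto (fun N => eLpNorm (fun x => fejer N (trigPoly s c) x - trigPoly s c x) p
      (volume : Measure Torus)) atTop (nhds 0) := by
    have hb : ∀ N, eLpNorm (fun x => fejer N (trigPoly s c) x - trigPoly s c x) p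
        (volume : Measure Torus) ≤ (volume : Measure Torus) univ ^ p.toReal⁻¹
          * ENNReal.ofReal (∑ k ∈ s, ‖((fejerWeight N k : ℂ) - 1) * c k‖) := fun N => by
      refine eLpNorm_le_of_ae_bound (Eventually.of_forall fun x => ?_)
      rw [fejer_trigPoly, trigPoly, trigPoly, ← Finset.sum_sub_distrib]
      refine norm_sum_le_of_le s fun k _ => le_of_eq ?_
      rw [← sub_mul, norm_mul, norm_character, mul_one]
      congr 1
      ring
    have hz : Tendsto (fun N => ∑ k ∈ s, ‖((fejerWeight N k : ℂ) - 1) * c k‖) atTop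
        (nhds (∑ k ∈ s, ‖(((1 : ℝ) : ℂ) - 1) * c k‖)) := by
      refine tendsto_finsetSum s fun k _ => Tendsto.norm (Tendsto.mul_const _ ?_)
      exact ((Complex.continuous_ofReal.tendsto _).comp (tendsto_fejerWeight k)).sub_const 1
    have hz' := ENNReal.Tendsto.const_mul (a := (volume : Measure Torus) univ ^ p.toReal⁻¹)
      (ENNReal.tendsto_ofReal hz) (Or.inr (by simp))
    simp only [Complex.ofReal_one, sub_self, zero_mul, norm_zero, Finset.sum_const_zero,
      ENNReal.ofReal_zero, mul_zero] at hz'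
    exact tendsto_of_tendsto_of_tendsto_of_le_of_le tendsto_const_nhds hz'
      (fun _ => zero_le) hb
  filter_upwards [ENNReal.tendsto_nhds_zero.1 hq (ε / 3) (pos_iff_ne_zero.2 hε3)] with N hN
  have hcf : ∀ g, AEStronglyMeasurable (fejer N g) (volume : Measure Torus) := fun g =>
    (continuous_trigPoly _ _).aestronglyMeasurable
  have hsplit : (fun x => fejer N f x - f x)
      = ((fejer N fun x => f x - trigPoly s c x)
        + (fun x => fejer N (trigPoly s c) x - trigPoly s c x))
        - (fun x => f x - trigPoly s c x) := by
    ext x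
    simp only [Pi.add_apply, Pi.sub_apply, fejer_sub N hfi hqi]
    ring
  rw [hsplit]
  have hm : AEStronglyMeasurable (fun x => f x - trigPoly s c x) volume :=
    hf.1.sub hqi.1
  calc _ ≤ eLpNorm ((fejer N fun x => f x - trigPoly s c x)
        + (fun x => fejer N (trigPoly s c) x - trigPoly s c x)) p volume
        + eLpNorm (fun x => f x - trigPoly s c x) p volume :=
        eLpNorm_sub_le ((hcf _).add ((hcf _).sub hqi.1)) hm hp
    _ ≤ (eLpNorm (fejer N fun x => f x - trigPoly s c x) p volume
        + eLpNorm (fun x => fejer N (trigPoly s c) x - trigPoly s c x) p volume) + ε / 3 :=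
        add_le_add (eLpNorm_add_le (hcf _) ((hcf _).sub hqi.1) hp) hsc
    _ ≤ (ε / 3 + ε / 3) + ε / 3 := by
        gcongr
        exact (eLpNorm_fejer_le N hp hp' (hfi.sub hqi)).trans hsc
    _ = ε := ENNReal.add_thirds ε

/-! ### Boundedness of the drift in `L³` -/

lemma eLpNorm_three_eq {f : Torus → ℂ} (hf : Continuous f) :
    eLpNorm f 3 volume = ENNReal.ofReal ((∫ x, ‖f x‖ ^ 3) ^ (3 : ℝ)⁻¹) := by
  rw [(memLp_of_continuous hf 3).eLpNorm_eq_integral_rpow_norm (by simp) (by simp)]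
  simp only [ENNReal.toReal_ofNat, Real.rpow_ofNat]

/-- The Fejér means of a real function are real. -/
lemma isRealTrig_fejer (N : ℕ) (f : Torus → ℝ) :
    IsRealTrig (fejerFreq N) fun k => fejerWeight N k * coeff (fun x => (f x : ℂ)) k where
  neg_mem := neg_mem_fejerFreq
  conj_coeff k _ := by
    simp only [fejerWeight_neg, coeff_neg_of_real, map_mul, Complex.conj_ofReal]

lemma norm_coeff_zero_le {f : Torus → ℂ} (hf : AEStronglyMeasurable f volume) :
    ‖coeff f 0‖ₑ ≤ ENNReal.ofReal ((2 * Real.pi) ^ 2)⁻¹ *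
      (eLpNorm f 3 volume * volume (univ : Set Torus) ^ (1 / (1 : ℝ) - 1 / 3)) := by
  have h := eLpNorm_le_eLpNorm_mul_rpow_measure_univ (p := 1) (q := 3)
    (by norm_num) hf
  simp only [ENNReal.toReal_one, ENNReal.toReal_ofNat] at h
  refine le_trans ?_ (mul_le_mul_right h _)
  rw [coeff, enorm_mul, eLpNorm_one_eq_lintegral_enorm]
  refine mul_le_mul' (le_of_eq ?_) ((enorm_integral_le_lintegral_enorm _).trans (le_of_eq ?_))
  · rw [← ofReal_norm]
    congr 1
    rw [norm_inv, norm_pow, Complex.norm_real, Real.norm_of_nonneg Real.two_pi_pos.le]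
  · refine lintegral_congr fun x => ?_
    rw [conj_character]
    simp [enorm_mul, ← ofReal_norm (character _ _), norm_character]

/-- The operator `T^l` of an odd drift multiplier is bounded on `L³(𝕋²)`; the velocity is only
assumed to be integrable with the right Fourier coefficients. -/
lemma exists_eLpNorm_drift_le {m : Freq → Fin 2 → ℂ} (hm : IsDriftMultiplier m)
    (ho : IsOddMultiplier m) (l : Fin 2) : ∃ C : ENNReal, C ≠ ⊤ ∧ ∀ f v : Torus → ℝ,
      MemLp f 3 volume → Integrable v →
      (∀ k, coeff (fun x => (v x : ℂ)) k
        = m (latticeFreq k) l * coeff (fun x => (f x : ℂ)) k) →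
      eLpNorm v 3 volume ≤ C * eLpNorm f 3 volume := by
  obtain ⟨h, hh, hrep⟩ := exists_density hm ho l
  obtain ⟨C, hC, hbound⟩ := integral_norm_average_sign_le hh
  set V : ENNReal := volume (univ : Set Torus) with hV
  have hVtop : V ≠ ⊤ := measure_ne_top _ _
  have hVpow : ∀ r : ℝ, 0 ≤ r → V ^ r ≠ ⊤ := fun r hr => ENNReal.rpow_ne_top_of_nonneg hr hVtop
  refine ⟨ENNReal.ofReal (C ^ (3 : ℝ)⁻¹) + ‖m 0 l‖ₑ * (ENNReal.ofReal ((2 * Real.pi) ^ 2)⁻¹ *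
      V ^ (1 / (1 : ℝ) - 1 / 3)) * V ^ (1 / (3 : ℝ)), ?_, ?_⟩
  · refine ENNReal.add_ne_top.2 ⟨ENNReal.ofReal_ne_top, ?_⟩
    refine ENNReal.mul_ne_top (ENNReal.mul_ne_top enorm_ne_top (ENNReal.mul_ne_top
      ENNReal.ofReal_ne_top ?_)) ?_
    · exact hVpow _ (by norm_num)
    · exact hVpow _ (by norm_num)
  intro f v hf hv hcoef
  set fc : Torus → ℂ := fun x => (f x : ℂ) with hfc
  set vc : Torus → ℂ := fun x => (v x : ℂ) with hvc
  have hfc3 : MemLp fc 3 volume := hf.ofReal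
  have hfi : Integrable fc := hfc3.integrable (by norm_num)
  have hvi : Integrable vc := hv.ofReal
  have hnf : eLpNorm fc 3 volume = eLpNorm f 3 volume :=
    eLpNorm_congr_norm_ae (Eventually.of_forall fun x => by simp [hfc])
  have hnv : eLpNorm vc 3 volume = eLpNorm v 3 volume :=
    eLpNorm_congr_norm_ae (Eventually.of_forall fun x => by simp [hvc])
  rw [← hnf, ← hnv]
  -- the Fejér means of the drift are bounded in `L³`
  have hN : ∀ N, eLpNorm (fejer N vc) 3 volume ≤ (ENNReal.ofReal (C ^ (3 : ℝ)⁻¹) +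
      ‖m 0 l‖ₑ * (ENNReal.ofReal ((2 * Real.pi) ^ 2)⁻¹ *
      V ^ (1 / (1 : ℝ) - 1 / 3)) * V ^ (1 / (3 : ℝ))) * eLpNorm fc 3 volume := by
    intro N
    set c : (Fin 2 → ℤ) → ℂ := fun k => fejerWeight N k * coeff fc k with hc
    set A : Torus → ℂ := trigPoly (fejerFreq N) (fun k => (∫ γ in 0..Real.pi, h γ *
          (Real.sign (slope (rotatedDirection γ) k) : ℂ)) * c k) with hA
    have hsplit : fejer N vc = A + fun _ => m 0 l * coeff fc 0 := by
      ext x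
      have h1 := trigPoly_single (zero_mem_fejerFreq N) (fun _ => m 0 l * coeff fc 0) x
      rw [character_zero, mul_one] at h1
      rw [Pi.add_apply, ← h1, hA, trigPoly_add]
      refine trigPoly_congr (fun k _ => ?_) x
      rw [hcoef]
      by_cases hk : k = 0
      · subst hk
        simp [slope, latticeFreq_zero, fejerWeight_zero]
      · rw [if_neg hk, add_zero, hrep k hk, hc]
        ring
    have hAc : Continuous A := continuous_trigPoly _ _
    have hA3 : eLpNorm A 3 volume ≤ ENNReal.ofReal (C ^ (3 : ℝ)⁻¹) * eLpNorm fc 3 volume := by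
      refine le_trans ?_ (mul_le_mul_right (eLpNorm_fejer_le N (by norm_num) (by simp) hfi) _)
      have hfc : Continuous (fejer N fc) := continuous_trigPoly _ _
      rw [eLpNorm_three_eq hAc, eLpNorm_three_eq hfc,
        ← ENNReal.ofReal_mul (by positivity)]
      refine ENNReal.ofReal_le_ofReal ?_
      rw [← Real.mul_rpow hC (integral_nonneg fun x => by positivity)]
      refine Real.rpow_le_rpow (integral_nonneg fun x => by positivity)
        (hbound _ _ (isRealTrig_fejer N f)) (by norm_num)
    have hB3 : eLpNorm (fun _ : Torus => m 0 l * coeff fc 0) 3 volume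
        ≤ ‖m 0 l‖ₑ * (ENNReal.ofReal ((2 * Real.pi) ^ 2)⁻¹ *
      V ^ (1 / (1 : ℝ) - 1 / 3)) * V ^ (1 / (3 : ℝ)) * eLpNorm fc 3 volume := by
      rw [eLpNorm_const' _ (by simp) (by simp), enorm_mul, ENNReal.toReal_ofNat]
      calc _ ≤ ‖m 0 l‖ₑ * (ENNReal.ofReal ((2 * Real.pi) ^ 2)⁻¹ *
            (eLpNorm fc 3 volume * V ^ (1 / (1 : ℝ) - 1 / 3))) * V ^ (1 / (3 : ℝ)) := by
            gcongr
            exact norm_coeff_zero_le hfi.1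
        _ = _ := by
            generalize V ^ (1 / (1 : ℝ) - 1 / 3) = W
            ring
    rw [hsplit, add_mul]
    exact (eLpNorm_add_le hAc.aestronglyMeasurable aestronglyMeasurable_const (by norm_num)).trans
      (add_le_add hA3 hB3)
  have hL1 := tendsto_eLpNorm_fejer_sub (p := 1) le_rfl (by simp) (memLp_one_iff_integrable.2 hvi)
  have hmeas : ∀ N, AEStronglyMeasurable (fejer N vc) volume := fun N =>
    (continuous_trigPoly _ _).aestronglyMeasurable
  obtain ⟨ns, -, hns⟩ := (tendstoInMeasure_of_tendsto_eLpNorm one_ne_zero hmeas hvi.1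
    hL1).exists_seq_tendsto_ae
  exact Lp.eLpNorm_le_of_ae_tendsto (Eventually.of_forall fun i => hN (ns i))
    (fun i => hmeas (ns i)) hns

/-! ### The symbol of `L` -/

lemma hamiltonianSymbol_zero (m : Freq → Fin 2 → ℂ) : hamiltonianSymbol m 0 = 0 := by
  simp [hamiltonianSymbol, invLaplaceSymbol]

lemma norm_sq_freq (ξ : Freq) : ‖ξ‖ ^ 2 = ξ 0 ^ 2 + ξ 1 ^ 2 := by
  rw [EuclideanSpace.norm_sq_eq, Fin.sum_univ_two, Real.norm_eq_abs, Real.norm_eq_abs, sq_abs,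
    sq_abs]

lemma perp_two {m : Freq → Fin 2 → ℂ} (hm : IsDriftMultiplier m) {ξ : Freq} (hξ : ξ ≠ 0) :
    (ξ 0 : ℂ) * m ξ 0 + (ξ 1 : ℂ) * m ξ 1 = 0 := by
  simpa [Fin.sum_univ_two] using hm.perp ξ hξ

lemma norm_sq_freq_ne_zero {ξ : Freq} (hξ : ξ ≠ 0) : (ξ 0 : ℂ) ^ 2 + (ξ 1 : ℂ) ^ 2 ≠ 0 := by
  have h : ‖ξ‖ ^ 2 ≠ 0 := pow_ne_zero 2 (norm_ne_zero_iff.2 hξ)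
  rw [norm_sq_freq] at h
  exact_mod_cast h

/-- `∂₁L = T²`, on the level of symbols. -/
lemma I_mul_zero_mul_hamiltonianSymbol {m : Freq → Fin 2 → ℂ} (hm : IsDriftMultiplier m) {ξ : Freq}
    (hξ : ξ ≠ 0) : Complex.I * (ξ 0 : ℂ) * hamiltonianSymbol m ξ = m ξ 1 := by
  have h := perp_two hm hξ
  have hn := norm_sq_freq_ne_zero hξ
  rw [hamiltonianSymbol, invLaplaceSymbol, divPerpSymbol, norm_sq_freq]
  push_cast
  field_simp
  linear_combination (-(ξ 1 : ℂ)) * h + (ξ 0 : ℂ) * (ξ 1 * m ξ 0 - ξ 0 * m ξ 1) * Complex.I_sq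

/-- `∂₂L = -T¹`, on the level of symbols. -/
lemma I_mul_one_mul_hamiltonianSymbol {m : Freq → Fin 2 → ℂ} (hm : IsDriftMultiplier m) {ξ : Freq}
    (hξ : ξ ≠ 0) : Complex.I * (ξ 1 : ℂ) * hamiltonianSymbol m ξ = -m ξ 0 := by
  have h := perp_two hm hξ
  have hn := norm_sq_freq_ne_zero hξ
  rw [hamiltonianSymbol, invLaplaceSymbol, divPerpSymbol, norm_sq_freq]
  push_cast
  field_simp
  linear_combination ((ξ 0 : ℂ)) * h + (ξ 1 : ℂ) * (ξ 1 * m ξ 0 - ξ 0 * m ξ 1) * Complex.I_sq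

/-- An odd drift multiplier is purely imaginary away from the origin. -/
lemma conj_drift {m : Freq → Fin 2 → ℂ} (hm : IsDriftMultiplier m) (ho : IsOddMultiplier m)
    {ξ : Freq} (hξ : ξ ≠ 0) (l : Fin 2) : conj (m ξ l) = -m ξ l := by
  rw [← hm.conj_symm, ho ξ hξ, Pi.neg_apply]

lemma conj_drift_zero {m : Freq → Fin 2 → ℂ} (hm : IsDriftMultiplier m) (l : Fin 2) :
    conj (m 0 l) = m 0 l := by
  rw [← hm.conj_symm, neg_zero]

lemma conj_hamiltonianSymbol {m : Freq → Fin 2 → ℂ} (hm : IsDriftMultiplier m)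
    (ho : IsOddMultiplier m) (ξ : Freq) :
    conj (hamiltonianSymbol m ξ) = hamiltonianSymbol m ξ := by
  by_cases hξ : ξ = 0
  · subst hξ
    simp [hamiltonianSymbol_zero]
  · simp only [hamiltonianSymbol, invLaplaceSymbol, divPerpSymbol, map_mul, map_sub, map_inv₀,
      Complex.conj_ofReal, Complex.conj_I, conj_drift hm ho hξ]
    ring

lemma ofReal_re_hamiltonianSymbol {m : Freq → Fin 2 → ℂ} (hm : IsDriftMultiplier m)
    (ho : IsOddMultiplier m) (ξ : Freq) :
    ((hamiltonianSymbol m ξ).re : ℂ) = hamiltonianSymbol m ξ :=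
  Complex.conj_eq_iff_re.1 (conj_hamiltonianSymbol hm ho ξ)

/-! ### The rate of change of the truncated Hamiltonian -/

instance holderTriple_three : ENNReal.HolderTriple 3 3 (3 / 2) where
  inv_add_inv_eq_inv := by
    rw [ENNReal.inv_div (by simp) (by simp), ← two_mul, div_eq_mul_inv]

instance holderTriple_three_half : ENNReal.HolderTriple 3 (3 / 2) 1 where
  inv_add_inv_eq_inv := by
    rw [ENNReal.inv_div (by simp) (by simp), inv_one, ← one_div, ENNReal.div_add_div_same,
      show (1 : ENNReal) + 2 = 3 by norm_num]
    exact ENNReal.div_self (by simp) (by simp)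

lemma eLpNorm_mul_mul_le {f g h : Torus → ℂ} (hf : AEStronglyMeasurable f volume)
    (hg : AEStronglyMeasurable g volume) (hh : AEStronglyMeasurable h volume) :
    eLpNorm (fun x => f x * (g x * h x)) 1 volume
      ≤ eLpNorm f 3 volume * (eLpNorm g 3 volume * eLpNorm h 3 volume) := by
  have h1 : eLpNorm (fun x => g x * h x) (3 / 2) volume
      ≤ eLpNorm g 3 volume * eLpNorm h 3 volume :=
    eLpNorm_smul_le_mul_eLpNorm (𝕜 := ℂ) (p := 3) (q := 3) (r := 3 / 2) hh hg
  have h2 : eLpNorm (fun x => f x * (g x * h x)) 1 volume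
      ≤ eLpNorm f 3 volume * eLpNorm (fun x => g x * h x) (3 / 2) volume :=
    eLpNorm_smul_le_mul_eLpNorm (𝕜 := ℂ) (p := 3) (q := 3 / 2) (r := 1) (hg.mul hh) hf
  exact h2.trans (mul_le_mul_right h1 _)

lemma enorm_integral_mul_mul_le {f g h : Torus → ℂ} (hf : AEStronglyMeasurable f volume)
    (hg : AEStronglyMeasurable g volume) (hh : AEStronglyMeasurable h volume) :
    ‖∫ x, f x * (g x * h x)‖ₑ
      ≤ eLpNorm f 3 volume * (eLpNorm g 3 volume * eLpNorm h 3 volume) := by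
  refine (enorm_integral_le_lintegral_enorm _).trans ?_
  rw [← eLpNorm_one_eq_lintegral_enorm]
  exact eLpNorm_mul_mul_le hf hg hh

lemma integrable_mul_mul {f g h : Torus → ℂ} (hf : MemLp f 3 volume) (hg : MemLp g 3 volume)
    (hh : MemLp h 3 volume) : Integrable fun x => f x * (g x * h x) := by
  refine memLp_one_iff_integrable.1 ⟨hf.1.mul (hg.1.mul hh.1), ?_⟩
  exact (eLpNorm_mul_mul_le hf.1 hg.1 hh.1).trans_lt
    (ENNReal.mul_lt_top hf.2 (ENNReal.mul_lt_top hg.2 hh.2))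

lemma eLpNorm_conj (f : Torus → ℂ) (p : ENNReal) :
    eLpNorm (fun x => conj (f x)) p volume = eLpNorm f p volume :=
  eLpNorm_congr_norm_ae (Eventually.of_forall fun _ => Complex.norm_conj _)

lemma aestronglyMeasurable_conj {f : Torus → ℂ} (hf : AEStronglyMeasurable f volume) :
    AEStronglyMeasurable (fun x => conj (f x)) volume :=
  Complex.continuous_conj.comp_aestronglyMeasurable hf

/-- Pairings with Fejér means converge, under the integrability exponents `1/3 + 1/3 + 1/3`. -/
lemma tendsto_integral_conj_fejer_mul {f g h : Torus → ℂ} (hf : MemLp f 3 volume)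
    (hg : MemLp g 3 volume) (hh : MemLp h 3 volume) :
    Tendsto (fun N => ∫ x, conj (fejer N f x) * (g x * h x)) atTop
      (nhds (∫ x, conj (f x) * (g x * h x))) := by
  have hm : ∀ N, MemLp (fejer N f) 3 volume := fun N =>
    memLp_of_continuous (continuous_trigPoly _ _) 3
  have hc : ∀ {q : Torus → ℂ}, MemLp q 3 volume → MemLp (fun x => conj (q x)) 3 volume :=
    fun hq => ⟨aestronglyMeasurable_conj hq.1, by rw [eLpNorm_conj]; exact hq.2⟩
  rw [tendsto_iff_edist_tendsto_0]
  have hz := ENNReal.Tendsto.mul_const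
    (tendsto_eLpNorm_fejer_sub (p := 3) (by norm_num) (by simp) hf)
    (b := eLpNorm g 3 volume * eLpNorm h 3 volume)
    (Or.inr (ENNReal.mul_lt_top hg.2 hh.2).ne)
  rw [zero_mul] at hz
  refine tendsto_of_tendsto_of_tendsto_of_le_of_le tendsto_const_nhds hz (fun _ => zero_le)
    fun N => ?_
  rw [edist_eq_enorm_sub, ← integral_sub (integrable_mul_mul (hc (hm N)) hg hh)
    (integrable_mul_mul (hc hf) hg hh)]
  have : ∀ x, conj (fejer N f x) * (g x * h x) - conj (f x) * (g x * h x)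
      = conj (fejer N f x - f x) * (g x * h x) := fun x => by
    rw [map_sub, sub_mul]
  simp only [this]
  refine (enorm_integral_mul_mul_le (aestronglyMeasurable_conj ((hm N).1.sub hf.1))
    hg.1 hh.1).trans (le_of_eq ?_)
  rw [eLpNorm_conj]
  rfl

/-- The `N`-th truncation `∑ₖ w(k) L̂(k) |aₖ|²` of the Hamiltonian, as a function of the Fourier
coefficients, where `w` are the weights of the Fejér kernel. -/
def truncatedEnergy (m : Freq → Fin 2 → ℂ) (N : ℕ) (a : (Fin 2 → ℤ) → ℂ) : ℝ :=
  ∑ k ∈ fejerFreq N, fejerWeight N k * (hamiltonianSymbol m (latticeFreq k)).re * ‖a k‖ ^ 2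

/-- The `k`-th Fourier coefficient of `-∂ₗ(f vˡ)`. -/
def divFluxCoeff (f : Torus → ℝ) (v : Torus → Fin 2 → ℝ) (k : Fin 2 → ℤ) : ℂ :=
  -(Complex.I * ∑ l, (k l : ℂ) * coeff (fun x => ((f x * v x l : ℝ) : ℂ)) k)

/-- The rate of change of the truncated Hamiltonian under `∂ₜf = -∂ₗ(f vˡ)`. -/
def truncatedRate (m : Freq → Fin 2 → ℂ) (N : ℕ) (f : Torus → ℝ) (v : Torus → Fin 2 → ℝ) : ℝ :=
  ∑ k ∈ fejerFreq N, fejerWeight N k * (hamiltonianSymbol m (latticeFreq k)).re *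
    (2 * (conj (coeff (fun x => (f x : ℂ)) k) * divFluxCoeff f v k).re)

/-- The mean of `f vˡ` only sees the zero mode, because the symbol is odd. -/
lemma integral_scalar_mul_drift {m : Freq → Fin 2 → ℂ} (ho : IsOddMultiplier m)
    {f v : Torus → ℝ} {l : Fin 2} (hf : MemLp f 3 volume) (hv : MemLp v 3 volume)
    (hcoef : ∀ k, coeff (fun x => (v x : ℂ)) k
        = m (latticeFreq k) l * coeff (fun x => (f x : ℂ)) k) :
    coeff (fun x => ((f x * v x : ℝ) : ℂ)) 0
      = m 0 l * (conj (coeff (fun x => (f x : ℂ)) 0) * coeff (fun x => (f x : ℂ)) 0) := by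
  set a : (Fin 2 → ℤ) → ℂ := coeff fun x => (f x : ℂ) with ha
  have hfc : MemLp (fun x => (f x : ℂ)) 3 (volume : Measure Torus) := hf.ofReal
  have hvc : MemLp (fun x => (v x : ℂ)) 3 (volume : Measure Torus) := hv.ofReal
  have h1 : MemLp (fun _ : Torus => (1 : ℂ)) 3 volume := memLp_const 1
  have hlim := tendsto_integral_conj_fejer_mul hfc hvc h1
  have hconst : ∀ N, ∫ x, conj (fejer N (fun x => (f x : ℂ)) x) * ((v x : ℂ) * 1)
      = ((2 * Real.pi : ℝ) ^ 2 : ℂ) * (m 0 l * (conj (a 0) * a 0)) := by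
    intro N
    simp only [mul_one]
    rw [fejer, integral_conj_trigPoly_mul _ _ (hvc.integrable (by norm_num))]
    congr 1
    set S := ∑ k ∈ fejerFreq N, if k = 0 then 0 else
      conj (fejerWeight N k * a k) * (m (latticeFreq k) l * a k) with hS
    -- the contributions of `k` and `-k` cancel
    have hS0 : S = 0 := by
      have : S = -S := by
        conv_lhs => rw [hS]
        rw [hS, ← Finset.sum_neg_distrib]
        refine Finset.sum_nbij' (fun k => -k) (fun k => -k) neg_mem_fejerFreq neg_mem_fejerFreq
          (by simp) (by simp) fun k _ => ?_
        by_cases hk : k = 0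
        · simp [hk]
        · rw [if_neg hk, if_neg (neg_ne_zero.2 hk), fejerWeight_neg, latticeFreq_neg,
            ho _ (latticeFreq_ne_zero hk), ha, coeff_neg_of_real, Pi.neg_apply]
          simp only [map_mul, Complex.conj_ofReal, Complex.conj_conj]
          ring
      exact self_eq_neg.1 this
    rw [← add_zero (m 0 l * _), ← hS0, hS,
      ← Finset.add_sum_erase _ _ (zero_mem_fejerFreq N),
      ← Finset.add_sum_erase _ _ (zero_mem_fejerFreq N)]
    rw [if_pos rfl, zero_add, fejerWeight_zero, hcoef, latticeFreq_zero]
    congr 1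
    · rw [Complex.ofReal_one, one_mul]
      ring
    · refine Finset.sum_congr rfl fun k hk => ?_
      rw [if_neg (Finset.ne_of_mem_erase hk), hcoef]
  simp only [hconst] at hlim
  have heq := tendsto_nhds_unique hlim tendsto_const_nhds
  rw [coeff, inv_mul_eq_iff_eq_mul₀ two_pi_sq_ne_zero, ← heq]
  congr 1 with x
  simp [character_zero]

/-- Since `v = ∇^⊥ L f` up to a constant, the truncated rate pairs the flux with the rotated Fejér
means of `v`. -/
lemma truncatedRate_eq {m : Freq → Fin 2 → ℂ} (hm : IsDriftMultiplier m) (ho : IsOddMultiplier m)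
    (N : ℕ) {f : Torus → ℝ} {v : Torus → Fin 2 → ℝ} (hf : MemLp f 3 volume)
    (hv : ∀ l, MemLp (fun x => v x l) 3 volume)
    (hcoef : ∀ l k, coeff (fun x => (v x l : ℂ)) k
        = m (latticeFreq k) l * coeff (fun x => (f x : ℂ)) k) :
    truncatedRate m N f v = (2 * (((2 * Real.pi : ℝ) ^ 2 : ℂ)⁻¹ *
      ((∫ x, conj (fejer N (fun x => (v x 1 : ℂ)) x) * ((f x : ℂ) * (v x 0 : ℂ)))
      - ∫ x, conj (fejer N (fun x => (v x 0 : ℂ)) x) * ((f x : ℂ) * (v x 1 : ℂ)))).re) := by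
  have hfc : MemLp (fun x => (f x : ℂ)) 3 (volume : Measure Torus) := hf.ofReal
  have hvc : ∀ l, MemLp (fun x => (v x l : ℂ)) 3 (volume : Measure Torus) := fun l => (hv l).ofReal
  have hflux : ∀ l, Integrable fun x => (f x : ℂ) * (v x l : ℂ) := fun l => by
    simpa using integrable_mul_mul (memLp_const 1) hfc (hvc l)
  set a : (Fin 2 → ℤ) → ℂ := coeff fun x => (f x : ℂ) with ha
  set B : Fin 2 → (Fin 2 → ℤ) → ℂ := fun l => coeff fun x => ((f x * v x l : ℝ) : ℂ) with hB
  have hB' : ∀ l k, coeff (fun x => (f x : ℂ) * (v x l : ℂ)) k = B l k := fun l k => by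
    simp only [hB, Complex.ofReal_mul]
  rw [fejer, fejer, integral_conj_trigPoly_mul _ _ (hflux 0), integral_conj_trigPoly_mul _ _
    (hflux 1), ← mul_sub, inv_mul_cancel_left₀ two_pi_sq_ne_zero, ← Finset.sum_sub_distrib,
    Complex.re_sum, Finset.mul_sum, truncatedRate]
  refine Finset.sum_congr rfl fun k _ => ?_
  simp only [hB', hcoef, map_mul, Complex.conj_ofReal]
  by_cases hk : k = 0
  · -- the zero mode contributes nothing, as the flux of the mean is parallel to the mean drift
    subst hk
    have hmean : ∀ l, B l 0 = m 0 l * (conj (a 0) * a 0) := fun l =>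
      integral_scalar_mul_drift ho hf (hv l) (hcoef l)
    rw [latticeFreq_zero, hamiltonianSymbol_zero, hmean, hmean, conj_drift_zero hm,
      conj_drift_zero hm]
    have : ((fejerWeight N 0 : ℂ) * (m 0 1 * conj (a 0)) * (m 0 0 * (conj (a 0) * a 0))
      - (fejerWeight N 0 : ℂ) * (m 0 0 * conj (a 0)) * (m 0 1 * (conj (a 0) * a 0))) = 0 := by ring
    rw [this]
    simp
  · have hξ := latticeFreq_ne_zero hk
    have h0 := I_mul_zero_mul_hamiltonianSymbol hm hξ
    have h1 := I_mul_one_mul_hamiltonianSymbol hm hξ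
    have e0 : latticeFreq k 0 = (k 0 : ℝ) := rfl
    have e1 : latticeFreq k 1 = (k 1 : ℝ) := rfl
    rw [e0] at h0
    rw [e1] at h1
    rw [show m (latticeFreq k) 0 = -(Complex.I * ((k 1 : ℝ) : ℂ)
        * hamiltonianSymbol m (latticeFreq k)) by rw [h1, neg_neg], ← h0]
    rw [← ofReal_re_hamiltonianSymbol hm ho (latticeFreq k)]
    set L := (hamiltonianSymbol m (latticeFreq k)).re
    have hD : divFluxCoeff f v k = -(Complex.I * ((k 0 : ℂ) * B 0 k + (k 1 : ℂ) * B 1 k)) := by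
      simp only [divFluxCoeff, Fin.sum_univ_two, hB]
    rw [hD]
    simp only [map_mul, map_neg, Complex.conj_ofReal, Complex.conj_I]
    have : ((fejerWeight N k : ℂ) * (-Complex.I * ((k 0 : ℝ) : ℂ) * (L : ℂ) * conj (a k)) * B 0 k
        - (fejerWeight N k : ℂ) * (-(-Complex.I * ((k 1 : ℝ) : ℂ) * (L : ℂ)) * conj (a k)) * B 1 k)
        = ((fejerWeight N k * L : ℝ) : ℂ)
          * (conj (a k) * -(Complex.I * ((k 0 : ℂ) * B 0 k + (k 1 : ℂ) * B 1 k))) := by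
      push_cast
      ring
    rw [this, Complex.re_ofReal_mul, Complex.ofReal_re]
    change _ = 2 * (fejerWeight N k * L * (conj (a k) * _).re)
    ring

/-- The rate of change of the truncated Hamiltonian tends to zero: in the limit it is the integral
of `f v · v^⊥ = 0`. -/
lemma tendsto_truncatedRate {m : Freq → Fin 2 → ℂ} (hm : IsDriftMultiplier m)
    (ho : IsOddMultiplier m) {f : Torus → ℝ} {v : Torus → Fin 2 → ℝ} (hf : MemLp f 3 volume)
    (hv : ∀ l, MemLp (fun x => v x l) 3 volume)
    (hcoef : ∀ l k, coeff (fun x => (v x l : ℂ)) k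
        = m (latticeFreq k) l * coeff (fun x => (f x : ℂ)) k) :
    Tendsto (fun N => truncatedRate m N f v) atTop (nhds 0) := by
  have hfc : MemLp (fun x => (f x : ℂ)) 3 (volume : Measure Torus) := hf.ofReal
  have hvc : ∀ l, MemLp (fun x => (v x l : ℂ)) 3 (volume : Measure Torus) := fun l => (hv l).ofReal
  have h := (tendsto_integral_conj_fejer_mul (hvc 1) hfc (hvc 0)).sub
    (tendsto_integral_conj_fejer_mul (hvc 0) hfc (hvc 1))
  have hz : (∫ x, conj (v x 1 : ℂ) * ((f x : ℂ) * (v x 0 : ℂ)))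
      - ∫ x, conj (v x 0 : ℂ) * ((f x : ℂ) * (v x 1 : ℂ)) = 0 := by
    rw [sub_eq_zero]
    congr 1 with x
    simp only [Complex.conj_ofReal]
    ring
  rw [hz] at h
  have h' := (Complex.continuous_re.tendsto _).comp (h.const_mul (((2 * Real.pi : ℝ) ^ 2 : ℂ)⁻¹))
  simp only [mul_zero, Complex.zero_re] at h'
  simp only [truncatedRate_eq hm ho _ hf hv hcoef]
  simpa [Function.comp_def] using h'.const_mul 2

lemma enorm_truncatedRate_le {m : Freq → Fin 2 → ℂ} (hm : IsDriftMultiplier m)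
    (ho : IsOddMultiplier m) (N : ℕ) {f : Torus → ℝ} {v : Torus → Fin 2 → ℝ} (hf : MemLp f 3 volume)
    (hv : ∀ l, MemLp (fun x => v x l) 3 volume)
    (hcoef : ∀ l k, coeff (fun x => (v x l : ℂ)) k
        = m (latticeFreq k) l * coeff (fun x => (f x : ℂ)) k) :
    ‖truncatedRate m N f v‖ₑ ≤ 4 * eLpNorm f 3 volume
      * (eLpNorm (fun x => v x 0) 3 volume * eLpNorm (fun x => v x 1) 3 volume) := by
  have hfc : MemLp (fun x => (f x : ℂ)) 3 (volume : Measure Torus) := hf.ofReal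
  have hvc : ∀ l, MemLp (fun x => (v x l : ℂ)) 3 (volume : Measure Torus) := fun l => (hv l).ofReal
  have hn : ∀ g : Torus → ℝ, eLpNorm (fun x => (g x : ℂ)) 3 volume = eLpNorm g 3 volume := fun g =>
    eLpNorm_congr_norm_ae (Eventually.of_forall fun x => by simp)
  have hint : ∀ l l', ‖∫ x, conj (fejer N (fun x => (v x l : ℂ)) x) * ((f x : ℂ) * (v x l' : ℂ))‖ₑ
      ≤ eLpNorm (fun x => v x l) 3 volume
        * (eLpNorm f 3 volume * eLpNorm (fun x => v x l') 3 volume) := fun l l' => by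
    refine (enorm_integral_mul_mul_le (aestronglyMeasurable_conj
      (continuous_trigPoly _ _).aestronglyMeasurable) hfc.1 (hvc l').1).trans ?_
    rw [eLpNorm_conj, hn f, hn fun x => v x l', ← hn fun x => v x l]
    gcongr
    exact eLpNorm_fejer_le N (by norm_num) (by simp) ((hvc l).integrable (by norm_num))
  rw [truncatedRate_eq hm ho _ hf hv hcoef, enorm_mul]
  have h2 : ‖(2 : ℝ)‖ₑ = 2 := by
    rw [← ofReal_norm]
    simp
  have hre : ∀ z : ℂ, ‖z.re‖ₑ ≤ ‖z‖ₑ := fun z => by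
    rw [← ofReal_norm, ← ofReal_norm]
    exact ENNReal.ofReal_le_ofReal (Complex.abs_re_le_norm z)
  have hpi : ‖(((2 * Real.pi : ℝ) ^ 2 : ℂ)⁻¹)‖ₑ ≤ 1 := by
    rw [← ofReal_norm, norm_inv, norm_pow, Complex.norm_real, Real.norm_of_nonneg
      Real.two_pi_pos.le, ENNReal.ofReal_le_one]
    refine inv_le_one_of_one_le₀ ?_
    nlinarith [Real.pi_gt_three]
  rw [h2]
  calc _ ≤ 2 * (1 * (eLpNorm (fun x => v x 1) 3 volume
        * (eLpNorm f 3 volume * eLpNorm (fun x => v x 0) 3 volume)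
        + eLpNorm (fun x => v x 0) 3 volume
        * (eLpNorm f 3 volume * eLpNorm (fun x => v x 1) 3 volume))) := by
        refine mul_le_mul_right ((hre _).trans ?_) _
        rw [enorm_mul]
        exact mul_le_mul' hpi (enorm_sub_le.trans (add_le_add (hint 1 0) (hint 0 1)))
    _ = _ := by ring

/-! ### Weak derivatives on an interval -/

/-- Smooth real functions with compact support in `I`. -/
structure IsTimeTest (I : Set ℝ) (χ : ℝ → ℝ) : Prop where
  smooth : ContDiff ℝ ∞ χ
  compact : HasCompactSupport χ
  support : tsupport χ ⊆ I

lemma isTimeTest_deriv {I : Set ℝ} {χ : ℝ → ℝ} (h : IsTimeTest I χ) : IsTimeTest I (deriv χ) where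
  smooth := ContDiff.deriv' (n := ∞) h.smooth
  compact := h.compact.deriv
  support := tsupport_deriv_subset.trans h.support

/-- A compact subset of an open interval lies in an open subinterval with compact closure. -/
lemma exists_Icc_of_isCompact {I : Set ℝ} (hI : IsOpen I) (hc : I.OrdConnected) {t₀ : ℝ}
    (ht₀ : t₀ ∈ I) {K : Set ℝ} (hK : IsCompact K) (hKI : K ⊆ I) :
    ∃ p q : ℝ, p < t₀ ∧ t₀ < q ∧ Icc p q ⊆ I ∧ K ⊆ Ioo p q := by
  have hK' : IsCompact (insert t₀ K) := hK.insert t₀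
  have hne : (insert t₀ K).Nonempty := insert_nonempty _ _
  have hsub : insert t₀ K ⊆ I := insert_subset ht₀ hKI
  have hinf := hK'.sInf_mem hne
  have hsup := hK'.sSup_mem hne
  obtain ⟨p, hp, hp'⟩ := exists_Ioc_subset_of_mem_nhds (hI.mem_nhds (hsub hinf)) ⟨_, sub_one_lt _⟩
  obtain ⟨q, hq, hq'⟩ := exists_Ico_subset_of_mem_nhds (hI.mem_nhds (hsub hsup)) ⟨_, lt_add_one _⟩
  have hlo : ∀ x ∈ insert t₀ K, sInf (insert t₀ K) ≤ x := fun x hx => csInf_le hK'.bddBelow hx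
  have hhi : ∀ x ∈ insert t₀ K, x ≤ sSup (insert t₀ K) := fun x hx => le_csSup hK'.bddAbove hx
  obtain ⟨p', hp1, hp2⟩ := exists_between hp
  obtain ⟨q', hq1, hq2⟩ := exists_between hq
  have h0 := hlo t₀ (mem_insert _ _)
  have h1 := hhi t₀ (mem_insert _ _)
  refine ⟨p', q', by linarith, by linarith, hc.out (hp' ⟨hp1, hp2.le⟩) (hq' ⟨hq1.le, hq2⟩), ?_⟩
  intro x hx
  exact ⟨hp2.trans_le (hlo x (mem_insert_of_mem _ hx)),
    (hhi x (mem_insert_of_mem _ hx)).trans_lt hq1⟩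

lemma IsTimeTest.integrable_mul {I : Set ℝ} {χ : ℝ → ℝ} (h : IsTimeTest I χ) {a : ℝ → ℝ}
    (ha : LocallyIntegrableOn a I) : Integrable fun t => χ t * a t := by
  have h1 : IntegrableOn a (tsupport χ) := ha.integrableOn_compact_subset h.support h.compact
  obtain ⟨C, hC⟩ := h.compact.exists_bound_of_continuous h.smooth.continuous
  have h2 : IntegrableOn (fun t => χ t * a t) (tsupport χ) :=
    h1.bdd_mul (c := C) h.smooth.continuous.aestronglyMeasurable (Eventually.of_forall hC)
  refine (integrableOn_iff_integrable_of_support_subset fun t ht => ?_).1 h2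
  refine subset_tsupport χ fun h0 => ht ?_
  simp only [h0, zero_mul]

/-- A smooth bump of integral one supported in an open set. -/
lemma exists_timeTest_integral_eq_one {I : Set ℝ} (hI : IsOpen I) {t₀ : ℝ} (ht₀ : t₀ ∈ I) :
    ∃ χ, IsTimeTest I χ ∧ ∫ t, χ t = 1 := by
  obtain ⟨ε, hε, hball⟩ := Metric.isOpen_iff.1 hI t₀ ht₀
  let φ : ContDiffBump t₀ := ⟨ε / 4, ε / 2, by linarith, by linarith⟩
  refine ⟨φ.normed volume, ⟨φ.contDiff_normed, φ.hasCompactSupport_normed, ?_⟩,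
    φ.integral_normed⟩
  rw [φ.tsupport_normed_eq]
  exact (Metric.closedBall_subset_ball (by simp only [φ]; linarith)).trans hball

/-- A test function of integral zero is the derivative of a test function. -/
lemma IsTimeTest.exists_primitive {I : Set ℝ} (hI : IsOpen I) (hc : I.OrdConnected) {t₀ : ℝ}
    (ht₀ : t₀ ∈ I) {η : ℝ → ℝ} (h : IsTimeTest I η) (h0 : ∫ t, η t = 0) :
    ∃ X, IsTimeTest I X ∧ ∀ t, HasDerivAt X (η t) t := by
  obtain ⟨p, q, hp, hq, hpq, hsupp⟩ := exists_Icc_of_isCompact hI hc ht₀ h.compact h.support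
  have hcont := h.smooth.continuous
  have hsupp' : Function.support η ⊆ Ioc p q := fun t ht =>
    Ioo_subset_Ioc_self (hsupp (subset_tsupport η ht))
  set X : ℝ → ℝ := fun t => ∫ s in p..t, η s with hX
  have hder : ∀ t, HasDerivAt X (η t) t := fun t =>
    intervalIntegral.integral_hasDerivAt_right (hcont.intervalIntegrable _ _)
      (hcont.stronglyMeasurableAtFilter _ _) hcont.continuousAt
  have hzero : ∀ t, t ∉ Icc p q → X t = 0 := by
    intro t ht
    rw [mem_Icc, not_and_or, not_le, not_le] at ht
    rcases ht with ht | ht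
    · refine (intervalIntegral.integral_congr (g := fun _ => 0) fun s hs => ?_).trans (by simp)
      rw [uIcc_of_ge ht.le] at hs
      by_contra hne
      exact absurd (hsupp' hne).1 (not_lt.2 hs.2)
    · have : X t = ∫ s, η s := by
        refine intervalIntegral.integral_eq_integral_of_support_subset fun s hs => ?_
        exact ⟨(hsupp' hs).1, (hsupp' hs).2.trans ht.le⟩
      rw [this, h0]
  have hts : tsupport X ⊆ Icc p q := by
    refine closure_minimal (fun t ht => ?_) isClosed_Icc
    by_contra hne
    exact ht (hzero t hne)
  refine ⟨X, ⟨?_, ?_, hts.trans hpq⟩, hder⟩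
  · rw [show (∞ : WithTop ℕ∞) = ∞ + 1 from rfl, contDiff_succ_iff_deriv]
    refine ⟨fun t => (hder t).differentiableAt, by simp, ?_⟩
    rw [show deriv X = η from funext fun t => (hder t).deriv]
    exact h.smooth
  · exact HasCompactSupport.of_support_subset_isCompact isCompact_Icc
      ((subset_tsupport X).trans hts)

/-- The lemma of du Bois-Reymond: a locally integrable function on an open interval whose weak
derivative vanishes is almost everywhere constant. -/
lemma ae_eq_const_of_weakDeriv_eq_zero {I : Set ℝ} (hI : IsOpen I) (hc : I.OrdConnected) {f : ℝ → ℝ}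
    (hf : LocallyIntegrableOn f I) (h : ∀ χ, IsTimeTest I χ → ∫ t, deriv χ t * f t = 0) :
    ∃ c : ℝ, ∀ᵐ t, t ∈ I → f t = c := by
  rcases I.eq_empty_or_nonempty with rfl | ⟨t₀, ht₀⟩
  · exact ⟨0, by simp⟩
  obtain ⟨χ₀, hχ₀, hone⟩ := exists_timeTest_integral_eq_one hI ht₀
  set c := ∫ t, χ₀ t * f t with hcdef
  refine ⟨c, ?_⟩
  have hfc : LocallyIntegrableOn (fun t => f t - c) I :=
    hf.sub (locallyIntegrableOn_const c)
  have key := hI.ae_eq_zero_of_integral_contDiff_smul_eq_zero hfc ?_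
  · filter_upwards [key] with t ht hmem
    exact sub_eq_zero.1 (ht hmem)
  intro ψ hψ1 hψ2 hψ3
  have hψ : IsTimeTest I ψ := ⟨hψ1, hψ2, hψ3⟩
  have hψint : Integrable ψ := hψ1.continuous.integrable_of_hasCompactSupport hψ2
  have hχint : Integrable χ₀ := hχ₀.smooth.continuous.integrable_of_hasCompactSupport hχ₀.compact
  set r := ∫ t, ψ t with hr
  have hη : IsTimeTest I fun t => ψ t - r * χ₀ t := by
    refine ⟨hψ1.sub (contDiff_const.mul hχ₀.smooth), hψ2.sub hχ₀.compact.mul_left, ?_⟩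
    refine (tsupport_sub _ _).trans (union_subset hψ3 ?_)
    exact (tsupport_mul_subset_right).trans hχ₀.support
  have hη0 : ∫ t, (ψ t - r * χ₀ t) = 0 := by
    rw [integral_sub hψint (hχint.const_mul _), integral_const_mul, hone, mul_one, sub_self]
  obtain ⟨X, hX, hXd⟩ := hη.exists_primitive hI hc ht₀ hη0
  have hz := h X hX
  rw [show deriv X = fun t => ψ t - r * χ₀ t from funext fun t => (hXd t).deriv] at hz
  simp only [sub_mul, mul_assoc] at hz
  rw [integral_sub (hψ.integrable_mul hf) ((hχ₀.integrable_mul hf).const_mul _),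
    integral_const_mul] at hz
  simp only [smul_eq_mul, mul_sub]
  rw [integral_sub (hψ.integrable_mul hf) (hψint.mul_const _), integral_mul_const]
  linarith

/-- A locally integrable function with locally integrable weak derivative agrees almost everywhere
with a primitive of the latter. -/
lemma exists_primitive_of_weakDeriv {I : Set ℝ} (hI : IsOpen I) (hc : I.OrdConnected) {t₀ : ℝ}
    (ht₀ : t₀ ∈ I) {f g : ℝ → ℝ} (hf : LocallyIntegrableOn f I) (hg : LocallyIntegrableOn g I)
    (h : ∀ χ, IsTimeTest I χ → ∫ t, deriv χ t * f t = -∫ t, χ t * g t) :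
    ∃ c : ℝ, ∀ᵐ t, t ∈ I → f t = c + ∫ s in t₀..t, g s := by
  have hint : ∀ s ∈ I, ∀ t ∈ I, IntervalIntegrable g volume s t := fun s hs t ht => by
    refine ((hg.integrableOn_compact_subset (hc.uIcc_subset hs ht)
      isCompact_uIcc)).intervalIntegrable
  set G : ℝ → ℝ := fun t => ∫ s in t₀..t, g s with hG
  have hGcont : ContinuousOn G I := by
    intro t ht
    obtain ⟨p, q, hp, hq, hpq, hsub⟩ := exists_Icc_of_isCompact hI hc ht₀
      (isCompact_singleton (x := t)) (singleton_subset_iff.2 ht)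
    have hpI : p ∈ I := hpq ⟨le_rfl, (hp.trans hq).le⟩
    have hqI : q ∈ I := hpq ⟨(hp.trans hq).le, le_rfl⟩
    have h1 := intervalIntegral.continuousOn_primitive_interval' (hint p hpI q hqI)
      (a := t₀) (by rw [uIcc_of_le (hp.trans hq).le]; exact ⟨hp.le, hq.le⟩)
    rw [uIcc_of_le (hp.trans hq).le] at h1
    have ht' : t ∈ Ioo p q := hsub rfl
    exact (h1.continuousAt (Icc_mem_nhds ht'.1 ht'.2)).continuousWithinAt
  have hGloc : LocallyIntegrableOn G I := hGcont.locallyIntegrableOn hI.measurableSet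
  have hweak : ∀ χ, IsTimeTest I χ → ∫ t, deriv χ t * (f - G) t = 0 := by
    intro χ hχ
    -- integration by parts for the primitive `G`
    obtain ⟨p, q, hp, hq, hpq, hsub⟩ := exists_Icc_of_isCompact hI hc ht₀ hχ.compact hχ.support
    have hpq' : p ≤ q := (hp.trans hq).le
    have hpI : p ∈ I := hpq ⟨le_rfl, hpq'⟩
    have hqI : q ∈ I := hpq ⟨hpq', le_rfl⟩
    have hAC : AbsolutelyContinuousOnInterval G p q :=
      (hint p hpI q hqI).absolutelyContinuousOnInterval_intervalIntegral
        (by rw [uIcc_of_le hpq']; exact ⟨hp.le, hq.le⟩)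
    have hACχ : AbsolutelyContinuousOnInterval χ p q :=
      (hχ.smooth.contDiffOn.of_le (by simp)).absolutelyContinuousOnInterval
    have hparts := hAC.integral_mul_deriv_eq_deriv_mul hACχ
    have hends : χ p = 0 ∧ χ q = 0 := by
      constructor <;> refine image_eq_zero_of_notMem_tsupport fun hmem => ?_
      · exact lt_irrefl _ (hsub hmem).1
      · exact lt_irrefl _ (hsub hmem).2
    have hGd : ∫ t in p..q, deriv G t * χ t = ∫ t in p..q, χ t * g t := by
      refine intervalIntegral.integral_congr_ae ?_
      filter_upwards [(hint p hpI q hqI).ae_hasDerivAt_integral] with t ht hmem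
      rw [(ht (uIoc_subset_uIcc hmem) t₀ (by rw [uIcc_of_le hpq']; exact ⟨hp.le, hq.le⟩)).deriv,
        mul_comm]
    have hfull : ∀ F : ℝ → ℝ, (∀ t, t ∉ tsupport χ → F t = 0) → ∫ t in p..q, F t = ∫ t, F t := by
      intro F hF
      refine intervalIntegral.integral_eq_integral_of_support_subset fun t ht => ?_
      exact Ioo_subset_Ioc_self (hsub (by_contra fun hne => ht (hF t hne)))
    rw [hends.1, hends.2, mul_zero, mul_zero, sub_zero, zero_sub, hGd,
      hfull _ fun t ht => by
        rw [image_eq_zero_of_notMem_tsupport fun hmem => ht (tsupport_deriv_subset hmem), mul_zero],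
      hfull _ fun t ht => by
        rw [image_eq_zero_of_notMem_tsupport ht, zero_mul],
      ← h χ hχ] at hparts
    simp only [Pi.sub_apply, mul_sub]
    rw [integral_sub ((isTimeTest_deriv hχ).integrable_mul hf) 
      ((isTimeTest_deriv hχ).integrable_mul hGloc), sub_eq_zero,
      ← hparts]
    simp only [mul_comm]
  obtain ⟨c, hcst⟩ := ae_eq_const_of_weakDeriv_eq_zero hI hc (hf.sub hGloc) hweak
  refine ⟨c, ?_⟩
  filter_upwards [hcst] with t ht hmem
  have := ht hmem
  simp only [Pi.sub_apply] at this
  linarith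

/-- The square of a function with locally integrable weak derivative obeys the fundamental theorem
of calculus. -/
lemma exists_sq_primitive_of_weakDeriv {I : Set ℝ} (hI : IsOpen I) (hc : I.OrdConnected)
    {f g : ℝ → ℝ} (hf : LocallyIntegrableOn f I) (hg : LocallyIntegrableOn g I)
    (h : ∀ χ, IsTimeTest I χ → ∫ t, deriv χ t * f t = -∫ t, χ t * g t) :
    ∃ A : ℝ → ℝ, (∀ᵐ t, t ∈ I → f t ^ 2 = A t) ∧ ∀ s ∈ I, ∀ t ∈ I,
      IntervalIntegrable (fun r => 2 * (f r * g r)) volume s t ∧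
        A t - A s = ∫ r in s..t, 2 * (f r * g r) := by
  rcases I.eq_empty_or_nonempty with rfl | ⟨t₀, ht₀⟩
  · exact ⟨0, by simp⟩
  obtain ⟨c, hcst⟩ := exists_primitive_of_weakDeriv hI hc ht₀ hf hg h
  have hint : ∀ s ∈ I, ∀ t ∈ I, IntervalIntegrable g volume s t := fun s hs t ht =>
    ((hg.integrableOn_compact_subset (hc.uIcc_subset hs ht) isCompact_uIcc)).intervalIntegrable
  set F : ℝ → ℝ := fun t => c + ∫ s in t₀..t, g s with hF
  refine ⟨fun t => F t ^ 2, ?_, fun s hs t ht => ?_⟩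
  · filter_upwards [hcst] with t h1 h2
    rw [h1 h2]
  set Fs : ℝ → ℝ := fun r => F s + ∫ y in s..r, g y with hFs
  have hFF : ∀ r ∈ I, Fs r = F r := fun r hr => by
    simp only [hFs, hF]
    rw [add_assoc, intervalIntegral.integral_add_adjacent_intervals (hint _ ht₀ _ hs)
      (hint _ hs _ hr)]
  have hACc : AbsolutelyContinuousOnInterval (fun _ : ℝ => F s) s t :=
    contDiffOn_const.absolutelyContinuousOnInterval
  have hAC : AbsolutelyContinuousOnInterval Fs s t :=
    hACc.add ((hint s hs t ht).absolutelyContinuousOnInterval_intervalIntegral left_mem_uIcc)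
  have hae : ∀ᵐ r, r ∈ uIoc s t → 2 * (Fs r * g r) = 2 * (f r * g r) := by
    filter_upwards [hcst] with r h1 h2
    have hr := hc.uIcc_subset hs ht (uIoc_subset_uIcc h2)
    rw [hFF r hr, h1 hr]
  have hii : IntervalIntegrable (fun r => 2 * (Fs r * g r)) volume s t :=
    ((hint s hs t ht).continuousOn_mul hAC.continuousOn).const_mul 2
  refine ⟨hii.congr_ae ((ae_restrict_iff' measurableSet_uIoc).2 hae), ?_⟩
  have hFTC := hAC.integral_deriv_mul_eq_sub hAC
  rw [← intervalIntegral.integral_congr_ae hae]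
  simp only
  rw [← hFF t ht, ← hFF s hs, sq, sq, ← hFTC]
  refine intervalIntegral.integral_congr_ae ?_
  filter_upwards [(hint s hs t ht).ae_hasDerivAt_integral] with r h1 h2
  have hd : HasDerivAt Fs (g r) r :=
    (h1 (uIoc_subset_uIcc h2) s left_mem_uIcc).const_add (F s)
  rw [hd.deriv]
  ring

/-- The squared modulus of a complex function with locally integrable weak derivative obeys the
fundamental theorem of calculus. -/
lemma exists_norm_sq_primitive_of_weakDeriv {I : Set ℝ} (hI : IsOpen I) (hc : I.OrdConnected)
    {a b : ℝ → ℂ} (ha : LocallyIntegrableOn a I) (hb : LocallyIntegrableOn b I)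
    (hre : ∀ χ, IsTimeTest I χ → ∫ t, deriv χ t * (a t).re = -∫ t, χ t * (b t).re)
    (him : ∀ χ, IsTimeTest I χ → ∫ t, deriv χ t * (a t).im = -∫ t, χ t * (b t).im) :
    ∃ A : ℝ → ℝ, (∀ᵐ t, t ∈ I → ‖a t‖ ^ 2 = A t) ∧ ∀ s ∈ I, ∀ t ∈ I,
      IntervalIntegrable (fun r => 2 * (conj (a r) * b r).re) volume s t ∧
        A t - A s = ∫ r in s..t, 2 * (conj (a r) * b r).re := by
  have hR : ∀ {z : ℝ → ℂ}, LocallyIntegrableOn z I → LocallyIntegrableOn (fun t => (z t).re) I :=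
    fun hz x hx => (hz x hx).imp fun s hs => ⟨hs.1, hs.2.re⟩
  have hIm : ∀ {z : ℝ → ℂ}, LocallyIntegrableOn z I → LocallyIntegrableOn (fun t => (z t).im) I :=
    fun hz x hx => (hz x hx).imp fun s hs => ⟨hs.1, hs.2.im⟩
  obtain ⟨A, hA, hA'⟩ := exists_sq_primitive_of_weakDeriv hI hc (hR ha) (hR hb) hre
  obtain ⟨B, hB, hB'⟩ := exists_sq_primitive_of_weakDeriv hI hc (hIm ha) (hIm hb) him
  have hsum : ∀ r, 2 * (conj (a r) * b r).re
      = 2 * ((a r).re * (b r).re) + 2 * ((a r).im * (b r).im) := fun r => by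
    simp only [Complex.mul_re, Complex.conj_re, Complex.conj_im]
    ring
  simp only [hsum]
  refine ⟨fun t => A t + B t, ?_, fun s hs t ht => ⟨(hA' s hs t ht).1.add (hB' s hs t ht).1, ?_⟩⟩
  · filter_upwards [hA, hB] with t h1 h2 h3
    rw [← h1 h3, ← h2 h3, ← Complex.normSq_eq_norm_sq, Complex.normSq_apply]
    ring
  · rw [intervalIntegral.integral_add (hA' s hs t ht).1 (hB' s hs t ht).1, ← (hA' s hs t ht).2,
      ← (hB' s hs t ht).2]
    ring

/-! ### Fourier multipliers on `L²` -/

/-- The character `e^{ik·x}` as an element of `L²(𝕋²)`. -/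
abbrev characterLp (k : Fin 2 → ℤ) : L2 := ContinuousMap.toLp 2 volume ℂ (character k)

lemma inner_characterLp (k : Fin 2 → ℤ) (f : L2) :
    inner ℂ (characterLp k) f = ((2 * Real.pi : ℝ) ^ 2 : ℂ) * coeff f k := by
  rw [L2.inner_def, ← integral_conj_character_mul]
  refine integral_congr_ae ?_
  filter_upwards [ContinuousMap.coeFn_toLp (p := 2) (𝕜 := ℂ) volume (character k)] with x hx
  rw [RCLike.inner_apply, hx, mul_comm]

lemma coeff_characterLp (k l : Fin 2 → ℤ) :
    coeff (characterLp k) l = if l = k then 1 else 0 := by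
  rw [coeff_congr (ContinuousMap.coeFn_toLp (p := 2) (𝕜 := ℂ) volume (character k)),
    coeff_character]

lemma orthonormal_characterLp :
    Orthonormal ℂ fun k => ((2 * Real.pi : ℝ) : ℂ)⁻¹ • characterLp k := by
  have hpi : ((2 * Real.pi : ℝ) : ℂ) ≠ 0 := by exact_mod_cast Real.two_pi_pos.ne'
  rw [orthonormal_iff_ite]
  intro k l
  rw [inner_smul_left, inner_smul_right, inner_characterLp, coeff_characterLp, map_inv₀,
    Complex.conj_ofReal]
  split_ifs with h
  · field_simp
  · simp

lemma top_le_span_characterLp :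
    ⊤ ≤ (Submodule.span ℂ
      (range fun k => ((2 * Real.pi : ℝ) : ℂ)⁻¹ • characterLp k)).topologicalClosure := by
  have hpi : ((2 * Real.pi : ℝ) : ℂ) ≠ 0 := by exact_mod_cast Real.two_pi_pos.ne'
  have h1 : ((Submodule.span ℂ (range character)).map
      (ContinuousMap.toLp (E := ℂ) 2 (volume : Measure Torus) ℂ).toLinearMap).topologicalClosure
        = ⊤ := by
    simpa using (ContinuousMap.toLp_denseRange ℂ (volume : Measure Torus) ℂ
      (by simp : (2 : ENNReal) ≠ ⊤)).topologicalClosure_map_submodule span_character_closure_eq_top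
  rw [← h1]
  refine Submodule.topologicalClosure_mono ?_
  rw [Submodule.map_span, Submodule.span_le]
  rintro _ ⟨_, ⟨k, rfl⟩, rfl⟩
  have h2 : ((2 * Real.pi : ℝ) : ℂ) • (((2 * Real.pi : ℝ) : ℂ)⁻¹ • characterLp k)
      = characterLp k := smul_inv_smul₀ hpi _
  change characterLp k ∈ _
  rw [← h2]
  exact Submodule.smul_mem _ _ (Submodule.subset_span ⟨k, rfl⟩)

/-- The normalized characters as a Hilbert basis of `L²(𝕋²)`. -/
def characterBasis : HilbertBasis (Fin 2 → ℤ) ℂ L2 :=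
  HilbertBasis.mk orthonormal_characterLp top_le_span_characterLp

lemma characterBasis_apply (k : Fin 2 → ℤ) :
    characterBasis k = ((2 * Real.pi : ℝ) : ℂ)⁻¹ • characterLp k := by
  rw [characterBasis, HilbertBasis.coe_mk]

lemma characterBasis_repr (f : L2) (k : Fin 2 → ℤ) :
    characterBasis.repr f k = ((2 * Real.pi : ℝ) : ℂ) * coeff f k := by
  have hpi : ((2 * Real.pi : ℝ) : ℂ) ≠ 0 := by exact_mod_cast Real.two_pi_pos.ne'
  rw [HilbertBasis.repr_apply_apply, characterBasis_apply, inner_smul_left, inner_characterLp,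
    map_inv₀, Complex.conj_ofReal]
  field_simp

/-- The pointwise product of a bounded and a square summable family. -/
lemma memℓp_bounded_mul {ι : Type*} {a : ι → ℂ} {C : ℝ} (ha : ∀ i, ‖a i‖ ≤ C)
    (c : lp (fun _ : ι => ℂ) 2) :
    Memℓp (fun i => a i * c i) 2 := by
  refine memℓp_gen ?_
  have h := (c.2.summable (by simp)).mul_left (C ^ 2)
  simp only [ENNReal.toReal_ofNat, Real.rpow_ofNat] at h ⊢
  refine Summable.of_nonneg_of_le (fun i => by positivity) (fun i => ?_) h
  rw [norm_mul, mul_pow]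
  gcongr
  exact ha i

/-- The Fourier multiplier with a bounded symbol, as a linear map on `L²(𝕋²)`. -/
def symbolMap (a : Freq → ℂ) {C : ℝ} (ha : ∀ k, ‖a (latticeFreq k)‖ ≤ C) : L2 →ₗ[ℂ] L2 where
  toFun f := characterBasis.repr.symm
    ⟨fun k => a (latticeFreq k) * characterBasis.repr f k, memℓp_bounded_mul ha _⟩
  map_add' f g := by
    rw [← map_add]
    congr 1
    ext k
    simp only [map_add, lp.coeFn_add, Pi.add_apply, mul_add]
  map_smul' r f := by
    rw [RingHom.id_apply, ← map_smul]
    congr 1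
    ext k
    simp [mul_left_comm]

lemma repr_symbolMap (a : Freq → ℂ) {C : ℝ} (ha : ∀ k, ‖a (latticeFreq k)‖ ≤ C) (f : L2)
    (k : Fin 2 → ℤ) : characterBasis.repr (symbolMap a ha f) k
      = a (latticeFreq k) * characterBasis.repr f k := by
  simp [symbolMap]

lemma coeff_symbolMap (a : Freq → ℂ) {C : ℝ} (ha : ∀ k, ‖a (latticeFreq k)‖ ≤ C) (f : L2)
    (k : Fin 2 → ℤ) : coeff (symbolMap a ha f) k = a (latticeFreq k) * coeff f k := by
  have hpi : ((2 * Real.pi : ℝ) : ℂ) ≠ 0 := by exact_mod_cast Real.two_pi_pos.ne'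
  have h := repr_symbolMap a ha f k
  rw [characterBasis_repr, characterBasis_repr, mul_left_comm] at h
  exact mul_left_cancel₀ hpi h

lemma symbolMap_eq_applySymbol (a : Freq → ℂ) {C : ℝ} (ha : ∀ k, ‖a (latticeFreq k)‖ ≤ C) (f : L2) :
    symbolMap a ha f = applySymbol a f := by
  have hpi : ((2 * Real.pi : ℝ) : ℂ) ≠ 0 := by exact_mod_cast Real.two_pi_pos.ne'
  have h := characterBasis.hasSum_repr_symm
    ⟨fun k => a (latticeFreq k) * characterBasis.repr f k, memℓp_bounded_mul ha _⟩
  rw [applySymbol]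
  refine Eq.trans ?_ h.tsum_eq.symm |>.trans ?_
  · rfl
  · refine tsum_congr fun k => ?_
    simp only [characterBasis_repr, characterBasis_apply, smul_smul]
    congr 1
    field_simp

lemma isSymmetric_symbolMap (a : Freq → ℂ) {C : ℝ} (ha : ∀ k, ‖a (latticeFreq k)‖ ≤ C)
    (hreal : ∀ ξ, conj (a ξ) = a ξ) : (symbolMap a ha).IsSymmetric := by
  intro f g
  rw [← characterBasis.repr.inner_map_map, ← characterBasis.repr.inner_map_map (x := f),
    lp.inner_eq_tsum, lp.inner_eq_tsum]
  refine tsum_congr fun k => ?_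
  rw [repr_symbolMap, repr_symbolMap, RCLike.inner_apply, RCLike.inner_apply, map_mul, hreal]
  ring

/-! ### The operator `L` and the Hamiltonian -/

lemma one_le_norm_latticeFreq {k : Fin 2 → ℤ} (hk : k ≠ 0) : 1 ≤ ‖latticeFreq k‖ := by
  obtain ⟨j, hj⟩ : ∃ j, k j ≠ 0 := by
    by_contra! h
    exact hk (funext h)
  have h1 : (1 : ℝ) ≤ ‖latticeFreq k j‖ := by
    have : (1 : ℤ) ≤ |k j| := Int.one_le_abs hj
    change (1 : ℝ) ≤ |(k j : ℝ)|
    exact_mod_cast this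
  exact h1.trans (PiLp.norm_apply_le _ _)

lemma exists_norm_drift_le {m : Freq → Fin 2 → ℂ} (hm : IsDriftMultiplier m) :
    ∃ C : ℝ, 0 ≤ C ∧ ∀ ξ, ξ ≠ 0 → ∀ l, ‖m ξ l‖ ≤ C := by
  have hcont : ∀ l, Continuous fun α => m (circlePoint α) l := fun l =>
    ((hm.smooth l).comp_contDiff contDiff_circlePoint fun α => circlePoint_ne_zero α).continuous
  choose C hC using fun l => (isCompact_Icc (a := -Real.pi)
    (b := Real.pi)).exists_bound_of_continuousOn (hcont l).continuousOn
  have hmem : (0 : ℝ) ∈ Icc (-Real.pi) Real.pi := ⟨by linarith [Real.pi_pos], Real.pi_pos.le⟩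
  have hC0 : ∀ l, 0 ≤ C l := fun l => (norm_nonneg _).trans (hC l 0 hmem)
  refine ⟨∑ l, C l, Finset.sum_nonneg fun l _ => hC0 l, fun ξ hξ l => ?_⟩
  obtain ⟨r, α, hr, hα, rfl⟩ := exists_polar hξ
  rw [hm.homogeneous r _ hr (circlePoint_ne_zero α)]
  exact (hC l α ⟨hα.1.le, hα.2⟩).trans
    (Finset.single_le_sum (f := C) (fun l _ => hC0 l) (Finset.mem_univ l))

lemma exists_norm_hamiltonianSymbol_le {m : Freq → Fin 2 → ℂ} (hm : IsDriftMultiplier m) :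
    ∃ C : ℝ, ∀ k, ‖hamiltonianSymbol m (latticeFreq k)‖ ≤ C := by
  obtain ⟨C, hC0, hC⟩ := exists_norm_drift_le hm
  refine ⟨2 * C, fun k => ?_⟩
  by_cases hk : k = 0
  · subst hk
    rw [latticeFreq_zero, hamiltonianSymbol_zero, norm_zero]
    positivity
  have hξ := latticeFreq_ne_zero hk
  have h1 := one_le_norm_latticeFreq hk
  set ξ := latticeFreq k
  have hj : ∀ j, ‖(ξ j : ℂ)‖ ≤ ‖ξ‖ := fun j => by
    rw [Complex.norm_real]
    exact PiLp.norm_apply_le _ _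
  have hdiv : ‖divPerpSymbol m ξ‖ ≤ 2 * C * ‖ξ‖ := by
    rw [divPerpSymbol]
    refine (norm_sub_le _ _).trans ?_
    simp only [norm_mul, Complex.norm_I, one_mul]
    have := mul_le_mul (hj 1) (hC ξ hξ 0) (norm_nonneg _) (norm_nonneg _)
    have := mul_le_mul (hj 0) (hC ξ hξ 1) (norm_nonneg _) (norm_nonneg _)
    linarith
  rw [hamiltonianSymbol, invLaplaceSymbol, norm_mul, norm_inv, Complex.norm_real,
    Real.norm_of_nonneg (by positivity), inv_mul_le_iff₀ (by positivity)]
  refine hdiv.trans ?_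
  nlinarith [mul_le_mul_of_nonneg_left h1 (mul_nonneg hC0 (norm_nonneg ξ))]

/-- `L` is a bounded self-adjoint operator on `L²(𝕋²)`. -/
lemma exists_selfAdjoint_opL {m : Freq → Fin 2 → ℂ} (hm : IsDriftMultiplier m)
    (ho : IsOddMultiplier m) : ∃ A : L2 →L[ℂ] L2, IsSelfAdjoint A ∧ (∀ f : L2, A f = opL m f) ∧
      ∀ (f : L2) (k : Fin 2 → ℤ),
        coeff (A f) k = hamiltonianSymbol m (latticeFreq k) * coeff f k := by
  obtain ⟨C, hC⟩ := exists_norm_hamiltonianSymbol_le hm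
  have hsym := isSymmetric_symbolMap (hamiltonianSymbol m) hC (conj_hamiltonianSymbol hm ho)
  refine ⟨hsym.toSelfAdjoint, hsym.toSelfAdjoint.2, fun f => ?_, fun f k => ?_⟩
  · exact symbolMap_eq_applySymbol _ hC f
  · exact coeff_symbolMap _ hC f k

lemma opL_congr {m : Freq → Fin 2 → ℂ} {f g : Torus → ℂ} (h : f =ᵐ[volume] g) :
    opL m f = opL m g := by
  simp only [opL, applySymbol, coeff_congr h]

/-- Parseval's identity for the Hamiltonian. -/
lemma integral_mul_opL_eq_tsum {m : Freq → Fin 2 → ℂ} (hm : IsDriftMultiplier m)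
    (ho : IsOddMultiplier m) {f : Torus → ℝ} (hf : MemLp (fun x => (f x : ℂ)) 2 volume) :
    Integrable (fun x => (f x : ℂ) * opL m (fun y => (f y : ℂ)) x) ∧
    Summable (fun k => (hamiltonianSymbol m (latticeFreq k)).re
      * ‖coeff (fun x => (f x : ℂ)) k‖ ^ 2) ∧
    ∫ x, (f x : ℂ) * opL m (fun y => (f y : ℂ)) x
      = (((2 * Real.pi) ^ 2 * ∑' k, (hamiltonianSymbol m (latticeFreq k)).re
      * ‖coeff (fun x => (f x : ℂ)) k‖ ^ 2 : ℝ) : ℂ) := by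
  obtain ⟨A, -, hA, hcoef⟩ := exists_selfAdjoint_opL hm ho
  set F : L2 := hf.toLp _ with hF
  have hFf : F =ᵐ[volume] fun x => (f x : ℂ) := hf.coeFn_toLp
  have hop : opL m (fun y => (f y : ℂ)) = A F := by
    rw [hA, opL_congr hFf]
  have hfc : ∀ k, coeff (fun x => (f x : ℂ)) k = coeff F k := fun k => (coeff_congr hFf k).symm
  have hae : (fun x => (f x : ℂ) * opL m (fun y => (f y : ℂ)) x)
      =ᵐ[volume] fun x => inner ℂ (F x) (A F x) := by
    filter_upwards [hFf] with x hx
    rw [hop, RCLike.inner_apply, hx, Complex.conj_ofReal, mul_comm]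
  have hsum : HasSum (fun k => (((2 * Real.pi) ^ 2 * ((hamiltonianSymbol m (latticeFreq k)).re
      * ‖coeff F k‖ ^ 2) : ℝ) : ℂ)) (inner ℂ F (A F)) := by
    rw [← characterBasis.repr.inner_map_map]
    have h := lp.hasSum_inner (𝕜 := ℂ) (G := fun _ : Fin 2 → ℤ => ℂ) (characterBasis.repr F)
      (characterBasis.repr (A F))
    have hterm : ∀ k, (((2 * Real.pi) ^ 2 * ((hamiltonianSymbol m (latticeFreq k)).re
        * ‖coeff F k‖ ^ 2) : ℝ) : ℂ)
        = inner ℂ (characterBasis.repr F k) (characterBasis.repr (A F) k) := fun k => by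
      rw [RCLike.inner_apply, characterBasis_repr, characterBasis_repr, hcoef, map_mul,
        Complex.conj_ofReal, ← ofReal_re_hamiltonianSymbol hm ho, Complex.ofReal_re]
      push_cast
      rw [← Complex.conj_mul']
      ring
    simp only [hterm]
    exact h
  have hsumR : Summable fun k => (hamiltonianSymbol m (latticeFreq k)).re * ‖coeff F k‖ ^ 2 := by
    have h1 := Complex.summable_ofReal.1 hsum.summable
    exact (summable_mul_left_iff (by positivity)).1 h1
  refine ⟨(L2.integrable_inner F (A F)).congr hae.symm, ?_, ?_⟩
  · simpa only [hfc] using hsumR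
  · rw [integral_congr_ae hae, ← L2.inner_def, ← hsum.tsum_eq, ← Complex.ofReal_tsum,
      tsum_mul_left]
    simp only [hfc]

/-- The truncated Hamiltonians converge to the Hamiltonian. -/
lemma tendsto_truncatedEnergy {m : Freq → Fin 2 → ℂ} {a : (Fin 2 → ℤ) → ℂ}
    (ha : Summable fun k => (hamiltonianSymbol m (latticeFreq k)).re * ‖a k‖ ^ 2) :
    Tendsto (fun N => truncatedEnergy m N a) atTop
      (nhds (∑' k, (hamiltonianSymbol m (latticeFreq k)).re * ‖a k‖ ^ 2)) := by
  have heq : ∀ N, truncatedEnergy m N a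
      = ∑' k, fejerWeight N k * ((hamiltonianSymbol m (latticeFreq k)).re * ‖a k‖ ^ 2) := by
    intro N
    rw [tsum_eq_sum (s := fejerFreq N) fun k hk => by rw [fejerWeight_eq_zero hk, zero_mul]]
    exact Finset.sum_congr rfl fun k _ => mul_assoc _ _ _
  simp only [heq]
  refine tendsto_tsum_of_dominated_convergence ha.norm (fun k => ?_)
    (Eventually.of_forall fun N k => ?_)
  · simpa using (tendsto_fejerWeight k).mul_const
      ((hamiltonianSymbol m (latticeFreq k)).re * ‖a k‖ ^ 2)
  · rw [norm_mul, Real.norm_of_nonneg (fejerWeight_nonneg N k)]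
    exact mul_le_of_le_one_left (norm_nonneg _) (fejerWeight_le_one N k)

/-! ### The even amplitude of an odd multiplier -/

lemma hamiltonianSymbol_smul {m : Freq → Fin 2 → ℂ} (hm : IsDriftMultiplier m) {c : ℝ} (hc : 0 < c)
    {ξ : Freq} (hξ : ξ ≠ 0) :
    hamiltonianSymbol m (c • ξ) = (c : ℂ)⁻¹ * hamiltonianSymbol m ξ := by
  have hc' : (c : ℂ) ≠ 0 := by exact_mod_cast hc.ne'
  have hn : (‖ξ‖ : ℂ) ≠ 0 := by exact_mod_cast norm_ne_zero_iff.2 hξ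
  simp only [hamiltonianSymbol, invLaplaceSymbol, divPerpSymbol, hm.homogeneous c ξ hc hξ,
    norm_smul, Real.norm_of_nonneg hc.le, PiLp.smul_apply, smul_eq_mul]
  push_cast
  field_simp

lemma hamiltonianSymbol_neg {m : Freq → Fin 2 → ℂ} (ho : IsOddMultiplier m) {ξ : Freq}
    (hξ : ξ ≠ 0) : hamiltonianSymbol m (-ξ) = hamiltonianSymbol m ξ := by
  simp only [hamiltonianSymbol, invLaplaceSymbol, divPerpSymbol, ho ξ hξ, norm_neg, PiLp.neg_apply,
    Pi.neg_apply]
  push_cast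
  ring

lemma contDiffOn_ofReal_coord (j : Fin 2) (s : Set Freq) :
    ContDiffOn ℝ ∞ (fun ξ : Freq => ((ξ j : ℝ) : ℂ)) s :=
  (Complex.ofRealCLM.contDiff.comp
    (EuclideanSpace.proj j : Freq →L[ℝ] ℝ).contDiff).contDiffOn

lemma contDiffOn_norm_freq : ContDiffOn ℝ ∞ (fun ξ : Freq => ‖ξ‖) {0}ᶜ :=
  fun _ hξ => (contDiffAt_norm ℝ hξ).contDiffWithinAt

lemma contDiffOn_hamiltonianSymbol {m : Freq → Fin 2 → ℂ} (hm : IsDriftMultiplier m) :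
    ContDiffOn ℝ ∞ (hamiltonianSymbol m) {0}ᶜ := by
  have h1 : ContDiffOn ℝ ∞ invLaplaceSymbol {0}ᶜ :=
    (Complex.ofRealCLM.contDiff.comp_contDiffOn (contDiffOn_norm_freq.pow 2)).inv fun ξ hξ => by
      have : ‖ξ‖ ≠ 0 := norm_ne_zero_iff.2 hξ
      exact Complex.ofReal_ne_zero.2 (pow_ne_zero 2 this)
  exact h1.mul (((contDiffOn_const.mul (contDiffOn_ofReal_coord 1 _)).mul (hm.smooth 0)).sub
    ((contDiffOn_const.mul (contDiffOn_ofReal_coord 0 _)).mul (hm.smooth 1)))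

/-- The function `ℓ(ξ) = |ξ| L̂(ξ)`. It is real since `m` is purely imaginary. -/
lemma exists_amplitude {m : Freq → Fin 2 → ℂ} (hm : IsDriftMultiplier m) (ho : IsOddMultiplier m) :
    ∃ ell : Freq → ℝ,
      ContDiffOn ℝ ∞ ell {0}ᶜ ∧
      (∀ (c : ℝ) (ξ : Freq), 0 < c → ξ ≠ 0 → ell (c • ξ) = ell ξ) ∧
      (∀ ξ, ξ ≠ 0 → ell (-ξ) = ell ξ) ∧
      (∀ ξ, ξ ≠ 0 → m ξ 0 = Complex.I * (-(ξ 1 : ℂ)) * (‖ξ‖ : ℂ)⁻¹ * (ell ξ : ℂ) ∧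
        m ξ 1 = Complex.I * (ξ 0 : ℂ) * (‖ξ‖ : ℂ)⁻¹ * (ell ξ : ℂ)) ∧
      (∀ ξ, ξ ≠ 0 → hamiltonianSymbol m ξ = (‖ξ‖ : ℂ)⁻¹ * (ell ξ : ℂ)) := by
  have hsymb : ∀ ξ : Freq, ξ ≠ 0 → hamiltonianSymbol m ξ
      = (‖ξ‖ : ℂ)⁻¹ * ((‖ξ‖ * (hamiltonianSymbol m ξ).re : ℝ) : ℂ) := fun ξ hξ => by
    have hn : (‖ξ‖ : ℂ) ≠ 0 := by exact_mod_cast norm_ne_zero_iff.2 hξ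
    rw [Complex.ofReal_mul, ofReal_re_hamiltonianSymbol hm ho, inv_mul_cancel_left₀ hn]
  refine ⟨fun ξ => ‖ξ‖ * (hamiltonianSymbol m ξ).re, ?_, fun c ξ hc hξ => ?_, fun ξ hξ => ?_,
    fun ξ hξ => ⟨?_, ?_⟩, hsymb⟩
  · exact contDiffOn_norm_freq.mul
      (Complex.reCLM.contDiff.comp_contDiffOn (contDiffOn_hamiltonianSymbol hm))
  · simp only []
    rw [hamiltonianSymbol_smul hm hc hξ, norm_smul, Real.norm_of_nonneg hc.le, ← Complex.ofReal_inv,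
      Complex.re_ofReal_mul]
    field_simp
  · simp only [norm_neg, hamiltonianSymbol_neg ho hξ]
  · rw [mul_assoc _ (‖ξ‖ : ℂ)⁻¹, ← hsymb ξ hξ]
    linear_combination I_mul_one_mul_hamiltonianSymbol hm hξ
  · rw [mul_assoc _ (‖ξ‖ : ℂ)⁻¹, ← hsymb ξ hξ, I_mul_zero_mul_hamiltonianSymbol hm hξ]

/-! ### The surface quasi-geostrophic multiplier -/

lemma isDriftMultiplier_sqg : IsDriftMultiplier sqgMultiplier where
  smooth l := by
    have hinv : ContDiffOn ℝ ∞ (fun ξ : Freq => (‖ξ‖ : ℂ)⁻¹) {0}ᶜ :=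
      (Complex.ofRealCLM.contDiff.comp_contDiffOn contDiffOn_norm_freq).inv fun ξ hξ =>
        Complex.ofReal_ne_zero.2 (norm_ne_zero_iff.2 hξ)
    have h : ∀ j, ContDiffOn ℝ ∞ (fun ξ : Freq => Complex.I * (ξ j : ℂ) / (‖ξ‖ : ℂ)) {0}ᶜ :=
      fun j => (contDiffOn_const.mul (contDiffOn_ofReal_coord j _)).mul hinv
    fin_cases l
    · exact (h 1).neg
    · exact h 0
  homogeneous c ξ hc hξ := by
    have hc' : (c : ℂ) ≠ 0 := by exact_mod_cast hc.ne'
    have hn : (‖ξ‖ : ℂ) ≠ 0 := by exact_mod_cast norm_ne_zero_iff.2 hξ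
    have h : ∀ j, Complex.I * ((c * ξ j : ℝ) : ℂ) / ((c * ‖ξ‖ : ℝ) : ℂ)
        = Complex.I * (ξ j : ℂ) / (‖ξ‖ : ℂ) := fun j => by
      push_cast
      field_simp
    simp only [sqgMultiplier, norm_smul, Real.norm_of_nonneg hc.le, PiLp.smul_apply, smul_eq_mul, h]
  conj_symm ξ l := by
    fin_cases l <;> simp [sqgMultiplier]
  perp ξ _ := by
    simp only [Fin.sum_univ_two, sqgMultiplier, Matrix.cons_val_zero, Matrix.cons_val_one]
    ring

lemma isOddMultiplier_sqg : IsOddMultiplier sqgMultiplier := fun ξ _ => by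
  ext l
  fin_cases l <;> simp [sqgMultiplier, neg_div]

lemma hamiltonianSymbol_sqg (ξ : Freq) : hamiltonianSymbol sqgMultiplier ξ = (‖ξ‖ : ℂ)⁻¹ := by
  by_cases hξ : ξ = 0
  · simp [hξ, hamiltonianSymbol_zero]
  have hn : (‖ξ‖ : ℂ) ≠ 0 := by exact_mod_cast norm_ne_zero_iff.2 hξ
  have hsq : (‖ξ‖ : ℂ) ^ 2 = (ξ 0 : ℂ) ^ 2 + (ξ 1 : ℂ) ^ 2 := by exact_mod_cast norm_sq_freq ξ
  simp only [hamiltonianSymbol, invLaplaceSymbol, divPerpSymbol, sqgMultiplier,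
    Matrix.cons_val_zero, Matrix.cons_val_one]
  push_cast
  field_simp
  linear_combination -((ξ 0 : ℂ) ^ 2 + (ξ 1 : ℂ) ^ 2) * Complex.I_sq - hsq

lemma hMinusHalfTerm_eq (f : Torus → ℂ) (k : Fin 2 → ℤ) :
    hMinusHalfTerm f k
      = (hamiltonianSymbol sqgMultiplier (latticeFreq k)).re * ‖coeff f k‖ ^ 2 := by
  rw [hMinusHalfTerm, hamiltonianSymbol_sqg, ← Complex.ofReal_inv, Complex.ofReal_re]

/-! ### Fourier coefficients of a weak solution -/

lemma restrict_slab (I : Set ℝ) : (volume : Measure (ℝ × Torus)).restrict (I ×ˢ univ)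
    = ((volume : Measure ℝ).restrict I).prod (volume : Measure Torus) := by
  rw [Measure.volume_eq_prod, ← Measure.prod_restrict, Measure.restrict_univ]

lemma integrable_prod_of_locallyIntegrableOn {I K : Set ℝ} {g : ℝ × Torus → ℝ}
    (hg : LocallyIntegrableOn g (I ×ˢ univ)) (hK : IsCompact K) (hKI : K ⊆ I) :
    Integrable g ((volume.restrict K).prod volume) := by
  rw [← restrict_slab]
  exact hg.integrableOn_compact_subset (prod_mono hKI subset_rfl) (hK.prod isCompact_univ)

lemma continuous_conj_character_snd (k : Fin 2 → ℤ) :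
    Continuous fun p : ℝ × Torus => conj (character k p.2) :=
  Complex.continuous_conj.comp ((character k).continuous.comp continuous_snd)

lemma integrable_prod_conj_character_mul {μ : Measure ℝ} [SFinite μ] {g : ℝ × Torus → ℝ}
    (hg : Integrable g (μ.prod volume)) (k : Fin 2 → ℤ) :
    Integrable (fun p : ℝ × Torus => conj (character k p.2) * (g p : ℂ)) (μ.prod volume) :=
  hg.ofReal.bdd_mul (c := 1) (continuous_conj_character_snd k).aestronglyMeasurable
    (Eventually.of_forall fun p => by rw [RCLike.norm_conj, norm_character])

lemma locallyIntegrableOn_coeff {I : Set ℝ} (hI : IsOpen I) {g : ℝ × Torus → ℝ}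
    (hg : LocallyIntegrableOn g (I ×ˢ univ)) (k : Fin 2 → ℤ) :
    LocallyIntegrableOn (fun t => coeff (fun x => (g (t, x) : ℂ)) k) I := by
  rw [locallyIntegrableOn_iff hI.isLocallyClosed]
  intro K hKI hK
  exact (integrable_prod_conj_character_mul
    (integrable_prod_of_locallyIntegrableOn hg hK hKI) k).integral_prod_left.const_mul _

lemma ae_integrable_slice {I : Set ℝ} (hI : IsOpen I) (hc : I.OrdConnected) {g : ℝ × Torus → ℝ}
    (hg : LocallyIntegrableOn g (I ×ˢ univ)) :
    ∀ᵐ t ∂(volume.restrict I), Integrable fun x => g (t, x) := by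
  have h : ∀ p q : ℚ, ∀ᵐ t, (p : ℝ) ∈ I → (q : ℝ) ∈ I → t ∈ Icc (p : ℝ) q →
      Integrable fun x => g (t, x) := fun p q => by
    by_cases hp : (p : ℝ) ∈ I
    · by_cases hq : (q : ℝ) ∈ I
      · have h1 := (integrable_prod_of_locallyIntegrableOn hg isCompact_Icc
          (hc.out hp hq)).prod_right_ae
        rw [ae_restrict_iff' measurableSet_Icc] at h1
        filter_upwards [h1] with t ht _ _ using ht
      · exact Eventually.of_forall fun t _ h => absurd h hq
    · exact Eventually.of_forall fun t h => absurd h hp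
  rw [ae_restrict_iff' hI.measurableSet]
  filter_upwards [ae_all_iff.2 fun p => ae_all_iff.2 (h p)] with t ht htI
  obtain ⟨ε, hε, hball⟩ := Metric.isOpen_iff.1 hI t htI
  rw [Real.ball_eq_Ioo] at hball
  obtain ⟨p, hp, hpt⟩ := exists_rat_btwn (show t - ε < t by linarith)
  obtain ⟨q, htq, hq⟩ := exists_rat_btwn (show t < t + ε by linarith)
  exact ht p q (hball ⟨hp, by linarith⟩) (hball ⟨by linarith, hq⟩) ⟨hpt.le, htq.le⟩

/-- Pairing a function on space-time with `η(t) e^{-ik·x}`. -/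
lemma integral_timeTest_mul_conj_character {I : Set ℝ} {η : ℝ → ℝ}
    (hη : IsTimeTest I η) {g : ℝ × Torus → ℝ} (hg : LocallyIntegrableOn g (I ×ˢ univ))
    (k : Fin 2 → ℤ) (z : ℂ) :
    IntegrableOn (fun p => g p * (η p.1 * (z * conj (character k p.2)).re)) (I ×ˢ univ) ∧
    ∫ p in I ×ˢ univ, g p * (η p.1 * (z * conj (character k p.2)).re)
      = (2 * Real.pi) ^ 2 * ∫ t, η t * (z * coeff (fun x => (g (t, x) : ℂ)) k).re := by
  set G : ℝ × Torus → ℂ := fun p => (η p.1 : ℂ) * (conj (character k p.2) * (g p : ℂ)) with hG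
  have hηc : Continuous fun p : ℝ × Torus => (η p.1 : ℂ) :=
    Complex.continuous_ofReal.comp (hη.smooth.continuous.comp continuous_fst)
  obtain ⟨C, hC⟩ := hη.compact.exists_bound_of_continuous hη.smooth.continuous
  have hzero : ∀ p : ℝ × Torus, p ∉ tsupport η ×ˢ (univ : Set Torus) → η p.1 = 0 := fun p hp =>
    image_eq_zero_of_notMem_tsupport fun h => hp ⟨h, mem_univ _⟩
  have hint : Integrable G := by
    refine (integrableOn_iff_integrable_of_support_subset (s := tsupport η ×ˢ univ)
      fun p hp => ?_).1 ?_
    · by_contra h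
      exact hp (by simp [hG, hzero p h])
    · rw [IntegrableOn, restrict_slab]
      exact (integrable_prod_conj_character_mul
        (integrable_prod_of_locallyIntegrableOn hg hη.compact hη.support) k).bdd_mul (c := C)
        hηc.aestronglyMeasurable
        (Eventually.of_forall fun p => by rw [Complex.norm_real]; exact hC p.1)
  have hre : (fun p => g p * (η p.1 * (z * conj (character k p.2)).re))
      = fun p => (z * G p).re := by
    funext p
    rw [hG, show z * ((η p.1 : ℂ) * (conj (character k p.2) * (g p : ℂ)))
      = ((g p * η p.1 : ℝ) : ℂ) * (z * conj (character k p.2)) by push_cast; ring,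
      Complex.re_ofReal_mul, mul_assoc]
  rw [hre]
  refine ⟨(hint.const_mul z).re.integrableOn, ?_⟩
  rw [setIntegral_eq_integral_of_forall_compl_eq_zero fun p hp => ?_]
  · have h1 : ∀ t, ∫ x, z * G (t, x) = ((2 * Real.pi) ^ 2 : ℝ)
        * ((η t : ℂ) * (z * coeff (fun x => (g (t, x) : ℂ)) k)) := fun t => by
      simp only [hG]
      rw [integral_const_mul, integral_const_mul, integral_conj_character_mul]
      push_cast
      ring
    have h2 : Integrable fun t => ∫ x, z * G (t, x) := (hint.const_mul z).integral_prod_left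
    have h3 : ∫ p, (z * G p).re = (∫ p, z * G p).re := integral_re (hint.const_mul z)
    have h4 : (∫ t, ∫ x, z * G (t, x)).re = ∫ t, (∫ x, z * G (t, x)).re := (integral_re h2).symm
    rw [h3, Measure.volume_eq_prod, integral_prod _ (hint.const_mul z), h4, ← integral_const_mul]
    simp only [h1, Complex.re_ofReal_mul]
  · have : p ∉ tsupport η ×ˢ (univ : Set Torus) := fun h => hp ⟨hη.support h.1, h.2⟩
    simp [hG, hzero p this]

/-- The test function `η(t) Re(z e^{-ik·x})`. -/
lemma isTestFunction_timeTest_mul_character {I : Set ℝ} {η : ℝ → ℝ} (hη : IsTimeTest I η)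
    (k : Fin 2 → ℤ) (z : ℂ) :
    IsTestFunction I fun p => η p.1 * (z * conj (character k p.2)).re := by
  have hsub : tsupport (fun p : ℝ × Torus => η p.1 * (z * conj (character k p.2)).re)
      ⊆ tsupport η ×ˢ univ := by
    refine closure_minimal (fun p hp => ⟨subset_tsupport η fun h => hp (by simp [h]), mem_univ _⟩)
      ((isClosed_tsupport η).prod isClosed_univ)
  refine ⟨?_, ?_, hsub.trans (prod_mono hη.support subset_rfl)⟩
  · simp only [character_coe]
    have h1 : ContDiff ℝ ∞ fun p : ℝ × (Fin 2 → ℝ) =>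
        Complex.exp (Complex.I * ∑ j, (k j : ℂ) * ((p.2 j : ℝ) : ℂ)) := by
      refine ContDiff.cexp (contDiff_const.mul (ContDiff.sum fun j _ => contDiff_const.mul ?_))
      exact Complex.ofRealCLM.contDiff.comp
        ((contDiff_apply ℝ ℝ j).comp contDiff_snd)
    exact (hη.smooth.comp contDiff_fst).mul
      (Complex.reCLM.contDiff.comp (contDiff_const.mul (Complex.conjCLE.contDiff.comp h1)))
  · exact (hη.compact.isCompact.prod isCompact_univ).of_isClosed_subset (isClosed_tsupport _) hsub

lemma timeDeriv_timeTest_mul_character (η : ℝ → ℝ) (k : Fin 2 → ℤ) (z : ℂ) (p : ℝ × Torus) :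
    timeDeriv (fun p => η p.1 * (z * conj (character k p.2)).re) p
      = deriv η p.1 * (z * conj (character k p.2)).re := by
  simp only [timeDeriv, deriv_mul_const_field]

lemma character_coe_single (k : Fin 2 → ℤ) (l : Fin 2) (s : ℝ) :
    character k (Pi.single l (s : Circ)) = Complex.exp (Complex.I * (k l * s)) := by
  have h : (Pi.single l (s : Circ) : Torus) = fun j => ((Pi.single l s : Fin 2 → ℝ) j : Circ) := by
    funext j
    by_cases hj : j = l
    · subst hj; simp
    · simp [hj]
  rw [h, character_coe, Finset.sum_eq_single l (fun j _ hj => by simp [hj]) (by simp),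
    Pi.single_eq_same]

lemma spaceDeriv_timeTest_mul_character (η : ℝ → ℝ) (k : Fin 2 → ℤ) (z : ℂ) (l : Fin 2)
    (p : ℝ × Torus) :
    spaceDeriv l (fun p => η p.1 * (z * conj (character k p.2)).re) p
      = η p.1 * ((-(Complex.I * k l) * z) * conj (character k p.2)).re := by
  set w : ℂ := z * conj (character k p.2) with hw
  have h1 : HasDerivAt (fun s : ℝ => Complex.exp (-(Complex.I * k l) * s))
      (-(Complex.I * k l)) 0 := by
    have h := (((hasDerivAt_id (0 : ℂ)).const_mul (-(Complex.I * (k l : ℂ)))).cexp).comp_ofReal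
      (z := 0)
    simpa using h
  have h2 : HasDerivAt (fun s : ℝ => (w * Complex.exp (-(Complex.I * k l) * s)).re)
      ((w * (-(Complex.I * k l))).re) 0 :=
    Complex.reCLM.hasFDerivAt.comp_hasDerivAt (0 : ℝ) (h1.const_mul w)
  have h3 : ∀ s : ℝ, (z * conj (character k (p.2 + Pi.single l (s : Circ)))).re
      = (w * Complex.exp (-(Complex.I * k l) * s)).re := fun s => by
    rw [character_map_add, character_coe_single, map_mul, ← Complex.exp_conj, hw, mul_assoc]
    simp only [map_mul, Complex.conj_I, Complex.conj_ofReal, map_intCast, neg_mul, mul_assoc]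
  simp only [spaceDeriv, h3]
  rw [(h2.const_mul (η p.1)).deriv, hw]
  ring_nf

lemma eLpNorm_three_pow {f : Torus → ℝ} :
    eLpNorm f 3 volume ^ 3 = ∫⁻ x, ‖f x‖ₑ ^ 3 := by
  have h := eLpNorm_nnreal_pow_eq_lintegral (f := f) (μ := volume) (p := 3) (by norm_num)
  simpa [ENNReal.rpow_ofNat] using h

lemma lintegral_slice_enorm_pow_ne_top {I : Set ℝ} {θ : ℝ × Torus → ℝ}
    (hθ : MemLp θ 3 (volume.restrict (I ×ˢ univ))) :
    AEMeasurable (fun t => ∫⁻ x, ‖θ (t, x)‖ₑ ^ 3) (volume.restrict I) ∧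
    ∫⁻ t in I, ∫⁻ x, ‖θ (t, x)‖ₑ ^ 3 ≠ ⊤ := by
  rw [restrict_slab] at hθ
  have hm : AEMeasurable (fun p => ‖θ p‖ₑ ^ 3) ((volume.restrict I).prod volume) :=
    hθ.1.enorm.pow_const 3
  refine ⟨hm.lintegral_prod_right', ?_⟩
  rw [← lintegral_prod _ hm]
  have h := eLpNorm_nnreal_pow_eq_lintegral (f := θ)
    (μ := (volume.restrict I).prod (volume : Measure Torus)) (p := 3) (by norm_num)
  have h' : ∫⁻ p, ‖θ p‖ₑ ^ 3 ∂((volume.restrict I).prod (volume : Measure Torus))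
      = eLpNorm θ 3 ((volume.restrict I).prod volume) ^ 3 := by
    simpa [ENNReal.rpow_ofNat] using h.symm
  rw [h']
  exact ENNReal.pow_ne_top hθ.2.ne

lemma ae_memLp_slice {I : Set ℝ} {θ : ℝ × Torus → ℝ}
    (hθ : MemLp θ 3 (volume.restrict (I ×ˢ univ))) :
    ∀ᵐ t ∂(volume.restrict I), MemLp (fun x => θ (t, x)) 3 volume := by
  obtain ⟨hm, hfin⟩ := lintegral_slice_enorm_pow_ne_top hθ
  rw [restrict_slab] at hθ
  filter_upwards [hθ.1.prodMk_left, ae_lt_top' hm hfin] with t ht1 ht2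
  refine ⟨ht1, ?_⟩
  rw [← eLpNorm_three_pow] at ht2
  exact (ENNReal.pow_lt_top_iff.1 ht2).resolve_right (by norm_num)

/-- The equation for one Fourier coefficient: `∂ₜθ̂(k) = -i k_l (θuˡ)^(k)` weakly on `I`. -/
lemma IsWeakSolution.weakDeriv_coeff {m : Freq → Fin 2 → ℂ} {I : Set ℝ} (hI : IsOpen I)
    {θ : ℝ × Torus → ℝ} {u : ℝ × Torus → Fin 2 → ℝ} (h : IsWeakSolution m I θ u)
    (k : Fin 2 → ℤ) (z : ℂ) {χ : ℝ → ℝ} (hχ : IsTimeTest I χ) :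
    ∫ t, deriv χ t * (z * coeff (fun x => (θ (t, x) : ℂ)) k).re
      = -∫ t, χ t * (z * divFluxCoeff (fun x => θ (t, x)) (fun x => u (t, x)) k).re := by
  have htr := h.transport _ (isTestFunction_timeTest_mul_character hχ k z)
  simp only [timeDeriv_timeTest_mul_character, spaceDeriv_timeTest_mul_character] at htr
  obtain ⟨hi0, he0⟩ := integral_timeTest_mul_conj_character (isTimeTest_deriv hχ)
    h.locInt_scalar k z
  have hF := fun l => integral_timeTest_mul_conj_character hχ (h.locInt_flux l) k
    (-(Complex.I * k l) * z)
  rw [integral_add hi0 (integrable_finsetSum _ fun l _ => (hF l).1),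
    integral_finsetSum _ fun l _ => (hF l).1, he0] at htr
  simp only [(hF _).2] at htr
  rw [← Finset.mul_sum, ← mul_add] at htr
  have h0 := (mul_eq_zero.1 htr).resolve_left (by positivity)
  rw [eq_neg_of_add_eq_zero_left h0, ← integral_finsetSum]
  · congr 1
    refine integral_congr_ae (Eventually.of_forall fun t => ?_)
    simp only [← Finset.mul_sum, ← Complex.re_sum]
    rw [divFluxCoeff, mul_neg, Finset.mul_sum, Finset.mul_sum, ← Finset.sum_neg_distrib]
    congr 2
    refine Finset.sum_congr rfl fun l _ => ?_
    ring
  · intro l _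
    have hl := locallyIntegrableOn_coeff hI (h.locInt_flux l) k
    refine hχ.integrable_mul fun t ht => ?_
    obtain ⟨s, hs, hsi⟩ := hl t ht
    exact ⟨s, hs, (hsi.const_mul _).re⟩

lemma locallyIntegrableOn_divFluxCoeff {m : Freq → Fin 2 → ℂ} {I : Set ℝ} (hI : IsOpen I)
    {θ : ℝ × Torus → ℝ} {u : ℝ × Torus → Fin 2 → ℝ} (h : IsWeakSolution m I θ u)
    (k : Fin 2 → ℤ) :
    LocallyIntegrableOn (fun t => divFluxCoeff (fun x => θ (t, x)) (fun x => u (t, x)) k) I := by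
  rw [locallyIntegrableOn_iff hI.isLocallyClosed]
  intro K hKI hK
  have hl := fun l => (locallyIntegrableOn_coeff hI (h.locInt_flux l) k).integrableOn_compact_subset
    hKI hK
  exact ((integrable_finsetSum _ fun l _ => (hl l).const_mul (k l : ℂ)).const_mul Complex.I).neg

/-- The squared modulus of a Fourier coefficient of a weak solution is absolutely continuous. -/
lemma IsWeakSolution.exists_norm_sq_coeff_primitive {m : Freq → Fin 2 → ℂ} {I : Set ℝ}
    (hI : IsOpen I) (hc : I.OrdConnected) {θ : ℝ × Torus → ℝ} {u : ℝ × Torus → Fin 2 → ℝ}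
    (h : IsWeakSolution m I θ u) (k : Fin 2 → ℤ) :
    ∃ A : ℝ → ℝ, (∀ᵐ t, t ∈ I → ‖coeff (fun x => (θ (t, x) : ℂ)) k‖ ^ 2 = A t) ∧
      ∀ s ∈ I, ∀ t ∈ I,
        IntervalIntegrable (fun r => 2 * (conj (coeff (fun x => (θ (r, x) : ℂ)) k)
          * divFluxCoeff (fun x => θ (r, x)) (fun x => u (r, x)) k).re) volume s t ∧
        A t - A s = ∫ r in s..t, 2 * (conj (coeff (fun x => (θ (r, x) : ℂ)) k)
          * divFluxCoeff (fun x => θ (r, x)) (fun x => u (r, x)) k).re := by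
  refine exists_norm_sq_primitive_of_weakDeriv hI hc
    (locallyIntegrableOn_coeff hI h.locInt_scalar k)
    (locallyIntegrableOn_divFluxCoeff hI h k) (fun χ hχ => ?_) fun χ hχ => ?_
  · simpa using h.weakDeriv_coeff hI k 1 hχ
  · simpa using h.weakDeriv_coeff hI k (-Complex.I) hχ

/-- At almost every time the velocity is in `L³` together with the scalar. -/
lemma IsWeakSolution.ae_slice {m : Freq → Fin 2 → ℂ} (hm : IsDriftMultiplier m)
    (ho : IsOddMultiplier m) {I : Set ℝ} (hI : IsOpen I) (hc : I.OrdConnected)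
    {θ : ℝ × Torus → ℝ} {u : ℝ × Torus → Fin 2 → ℝ}
    (hθ : MemLp θ 3 (volume.restrict (I ×ˢ univ))) (h : IsWeakSolution m I θ u) :
    ∃ C : ENNReal, C ≠ ⊤ ∧ ∀ᵐ t ∂(volume.restrict I), MemLp (fun x => θ (t, x)) 3 volume ∧
      (∀ l, MemLp (fun x => u (t, x) l) 3 volume) ∧
      (∀ l k, coeff (fun x => (u (t, x) l : ℂ)) k
        = m (latticeFreq k) l * coeff (fun x => (θ (t, x) : ℂ)) k) ∧
      ∀ l, eLpNorm (fun x => u (t, x) l) 3 volume ≤ C * eLpNorm (fun x => θ (t, x)) 3 volume := by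
  choose C hCtop hC using exists_eLpNorm_drift_le hm ho
  refine ⟨C 0 + C 1, ENNReal.add_ne_top.2 ⟨hCtop 0, hCtop 1⟩, ?_⟩
  filter_upwards [ae_memLp_slice hθ, h.drift_eq,
    ae_all_iff.2 fun l => ae_integrable_slice hI hc (h.locInt_drift l)] with t ht1 ht2 ht3
  have hle := fun l => hC l (fun x => θ (t, x)) (fun x => u (t, x) l) ht1 (ht3 l) (ht2 l)
  refine ⟨ht1, fun l => ⟨(ht3 l).1, (hle l).trans_lt
    (ENNReal.mul_lt_top (hCtop l).lt_top ht1.2)⟩, ht2, fun l => (hle l).trans ?_⟩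
  gcongr
  fin_cases l
  · exact le_self_add
  · exact le_add_self

/-! ### Conservation of the Hamiltonian -/

/-- The quadratic Fourier form of the Hamiltonian is finite and constant in time. The truncated
forms are absolutely continuous; their derivatives tend to zero and are dominated by the integrable
function `t ↦ ‖θ(t)‖₃³`. -/
lemma IsWeakSolution.exists_tsum_eq_const {m : Freq → Fin 2 → ℂ} (hm : IsDriftMultiplier m)
    (ho : IsOddMultiplier m) {I : Set ℝ} (hI : IsOpen I) (hc : I.OrdConnected)
    {θ : ℝ × Torus → ℝ} {u : ℝ × Torus → Fin 2 → ℝ}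
    (hθ : MemLp θ 3 (volume.restrict (I ×ˢ univ))) (h : IsWeakSolution m I θ u) :
    ∃ c : ℝ, ∀ᵐ t ∂(volume.restrict I), ∑' k, (hamiltonianSymbol m (latticeFreq k)).re
      * ‖coeff (fun x => (θ (t, x) : ℂ)) k‖ ^ 2 = c := by
  rcases I.eq_empty_or_nonempty with rfl | hne
  · exact ⟨0, by simp⟩
  obtain ⟨C, hCtop, hslice⟩ := h.ae_slice hm ho hI hc hθ
  obtain ⟨hmeas, hfin⟩ := lintegral_slice_enorm_pow_ne_top hθ
  choose A hA hAint using fun k => h.exists_norm_sq_coeff_primitive hI hc k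
  set rate : ℕ → ℝ → ℝ := fun N t => truncatedRate m N (fun x => θ (t, x)) (fun x => u (t, x))
    with hrate
  set E : ℕ → ℝ → ℝ := fun N t => ∑ k ∈ fejerFreq N,
    fejerWeight N k * (hamiltonianSymbol m (latticeFreq k)).re * A k t with hE
  have hrint : ∀ N, ∀ s ∈ I, ∀ t ∈ I, IntervalIntegrable (rate N) volume s t :=
    fun N s hs t ht => by
      have := IntervalIntegrable.sum (fejerFreq N) fun k _ => ((hAint k s hs t ht).1).const_mul
        (fejerWeight N k * (hamiltonianSymbol m (latticeFreq k)).re)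
      refine this.congr fun r _ => ?_
      simp only [Finset.sum_apply, hrate, truncatedRate]
  have hEint : ∀ N, ∀ s ∈ I, ∀ t ∈ I, E N t - E N s = ∫ r in s..t, rate N r :=
    fun N s hs t ht => by
      simp only [hE, hrate, truncatedRate]
      rw [intervalIntegral.integral_finsetSum fun k _ => ((hAint k s hs t ht).1).const_mul _,
        ← Finset.sum_sub_distrib]
      refine Finset.sum_congr rfl fun k _ => ?_
      rw [intervalIntegral.integral_const_mul, ← (hAint k s hs t ht).2, mul_sub]
  -- the dominating function `4 C² ‖θ(t)‖₃³`
  set G : ℝ → ENNReal := fun t => 4 * C ^ 2 * ∫⁻ x, ‖θ (t, x)‖ₑ ^ 3 with hG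
  have hGm : AEMeasurable G (volume.restrict I) := hmeas.const_mul _
  have hGfin : ∫⁻ t in I, G t ≠ ⊤ := by
    rw [hG, lintegral_const_mul'' _ hmeas]
    exact ENNReal.mul_ne_top (ENNReal.mul_ne_top (by simp) (ENNReal.pow_ne_top hCtop)) hfin
  have hGint : Integrable (fun t => (G t).toReal) (volume.restrict I) :=
    integrable_toReal_of_lintegral_ne_top hGm hGfin
  have hbound : ∀ N, ∀ᵐ t ∂(volume.restrict I), ‖rate N t‖ ≤ (G t).toReal := fun N => by
    filter_upwards [hslice, ae_lt_top' hGm hGfin] with t ⟨h1, h2, h3, h4⟩ ht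
    have hle : ‖rate N t‖ₑ ≤ G t := by
      refine (enorm_truncatedRate_le hm ho N h1 h2 h3).trans ?_
      rw [hG]
      simp only []
      rw [← eLpNorm_three_pow]
      refine (mul_le_mul_right (mul_le_mul' (h4 0) (h4 1)) _).trans (le_of_eq ?_)
      ring
    rw [← toReal_enorm]
    exact ENNReal.toReal_mono ht.ne hle
  have hlim : ∀ᵐ t ∂(volume.restrict I), Tendsto (fun N => rate N t) atTop (nhds 0) := by
    filter_upwards [hslice] with t ⟨h1, h2, h3, h4⟩
    exact tendsto_truncatedRate hm ho h1 h2 h3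
  have hconv : ∀ s ∈ I, ∀ t ∈ I, Tendsto (fun N => E N t - E N s) atTop (nhds 0) :=
    fun s hs t ht => by
      have hsub : uIoc s t ⊆ I := uIoc_subset_uIcc.trans (hc.uIcc_subset hs ht)
      have hdct := intervalIntegral.tendsto_integral_filter_of_dominated_convergence
        (μ := volume) (a := s) (b := t) (l := atTop) (F := rate) (f := fun _ => (0 : ℝ))
        (fun r => (G r).toReal)
        (Eventually.of_forall fun N =>
          (intervalIntegrable_iff.1 (hrint N s hs t ht)).aestronglyMeasurable)
        (Eventually.of_forall fun N =>
          (ae_restrict_iff' hI.measurableSet).1 (hbound N) |>.mono fun r hr hrm => hr (hsub hrm))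
        (intervalIntegrable_iff.2 (IntegrableOn.mono_set hGint hsub))
        ((ae_restrict_iff' hI.measurableSet).1 hlim |>.mono fun r hr hrm => hr (hsub hrm))
      simpa only [hEint _ s hs t ht, intervalIntegral.integral_zero] using hdct
  have hgood : ∀ᵐ t ∂(volume.restrict I), t ∈ I ∧ Tendsto (fun N => E N t) atTop
      (nhds (∑' k, (hamiltonianSymbol m (latticeFreq k)).re
        * ‖coeff (fun x => (θ (t, x) : ℂ)) k‖ ^ 2)) := by
    have hA' := (ae_restrict_iff' hI.measurableSet).2 (ae_all_iff.2 hA |>.mono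
      fun t ht htI k => ht k htI)
    filter_upwards [hslice, hA', ae_restrict_mem hI.measurableSet] with t ⟨h1, _⟩ h2 htI
    refine ⟨htI, ?_⟩
    have hL2 : MemLp (fun x => (θ (t, x) : ℂ)) 2 volume :=
      (h1.mono_exponent (by norm_num)).ofReal
    have := tendsto_truncatedEnergy (integral_mul_opL_eq_tsum hm ho hL2).2.1
    simpa only [truncatedEnergy, h2] using this
  have : NeBot (ae (volume.restrict I)) := by
    rw [ae_neBot, Ne, Measure.restrict_eq_zero]
    exact (hI.measure_pos volume hne).ne'
  obtain ⟨s, hsI, hs⟩ := hgood.exists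
  exact ⟨∑' k, (hamiltonianSymbol m (latticeFreq k)).re
      * ‖coeff (fun x => (θ (s, x) : ℂ)) k‖ ^ 2, hgood.mono fun t ⟨htI, ht⟩ =>
    sub_eq_zero.1 (tendsto_nhds_unique (ht.sub hs) (hconv s hsI t htI))⟩

lemma ae_memLp_two_slice {I : Set ℝ} {θ : ℝ × Torus → ℝ}
    (hθ : MemLp θ 3 (volume.restrict (I ×ˢ univ))) :
    ∀ᵐ t ∂(volume.restrict I), MemLp (fun x => (θ (t, x) : ℂ)) 2 volume :=
  (ae_memLp_slice hθ).mono fun _ ht => (ht.mono_exponent (by norm_num)).ofReal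

end ActiveScalar

end

theorem theorem1p5 :
    (∀ m : ActiveScalar.Freq → Fin 2 → ℂ,
      ActiveScalar.IsDriftMultiplier m → ActiveScalar.IsOddMultiplier m →
      -- the symbol of `L` is `|ξ|⁻¹ ℓ(ξ)` with `ℓ` real, even, homogeneous of degree `0`, smooth
      (∃ ell : ActiveScalar.Freq → ℝ,
        ContDiffOn ℝ ∞ ell {0}ᶜ ∧
        (∀ (c : ℝ) (ξ : ActiveScalar.Freq), 0 < c → ξ ≠ 0 → ell (c • ξ) = ell ξ) ∧
        (∀ ξ, ξ ≠ 0 → ell (-ξ) = ell ξ) ∧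
        (∀ ξ, ξ ≠ 0 → m ξ 0 = Complex.I * (-(ξ 1 : ℂ)) * (‖ξ‖ : ℂ)⁻¹ * (ell ξ : ℂ) ∧
          m ξ 1 = Complex.I * (ξ 0 : ℂ) * (‖ξ‖ : ℂ)⁻¹ * (ell ξ : ℂ)) ∧
        (∀ ξ, ξ ≠ 0 →
          ActiveScalar.hamiltonianSymbol m ξ = (‖ξ‖ : ℂ)⁻¹ * (ell ξ : ℂ))) ∧
      -- `L` is a bounded self-adjoint operator on `L²(𝕋²)` with this symbol
      (∃ A : ActiveScalar.L2 →L[ℂ] ActiveScalar.L2,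
        IsSelfAdjoint A ∧
        (∀ f : ActiveScalar.L2, A f = ActiveScalar.opL m f) ∧
        (∀ (f : ActiveScalar.L2) (k : Fin 2 → ℤ),
          ActiveScalar.coeff (A f) k
            = ActiveScalar.hamiltonianSymbol m (ActiveScalar.latticeFreq k)
              * ActiveScalar.coeff f k)) ∧
      -- the Hamiltonian is conserved
      (∀ I : Set ℝ, IsOpen I → I.OrdConnected →
        ∀ (θ : ℝ × ActiveScalar.Torus → ℝ) (u : ℝ × ActiveScalar.Torus → Fin 2 → ℝ),
        MemLp θ 3 (volume.restrict (I ×ˢ univ)) →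
        ActiveScalar.IsWeakSolution m I θ u →
        (∀ᵐ t ∂(volume.restrict I),
          MemLp (fun x => (θ (t, x) : ℂ)) 2 volume ∧
          Integrable (fun x => (θ (t, x) : ℂ)
            * ActiveScalar.opL m (fun y => (θ (t, y) : ℂ)) x)) ∧
        ∃ c : ℝ, ∀ᵐ t ∂(volume.restrict I), ActiveScalar.hamiltonian m θ t = (c : ℂ))) ∧
    -- the surface quasi-geostrophic equation: `L = (-Δ)^{-1/2}`, and the `H^{-1/2}` norm is conserved
    (ActiveScalar.IsDriftMultiplier ActiveScalar.sqgMultiplier ∧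
      ActiveScalar.IsOddMultiplier ActiveScalar.sqgMultiplier ∧
      (∀ ξ, ActiveScalar.hamiltonianSymbol ActiveScalar.sqgMultiplier ξ = (‖ξ‖ : ℂ)⁻¹) ∧
      (∀ I : Set ℝ, IsOpen I → I.OrdConnected →
        ∀ (θ : ℝ × ActiveScalar.Torus → ℝ) (u : ℝ × ActiveScalar.Torus → Fin 2 → ℝ),
        MemLp θ 3 (volume.restrict (I ×ˢ univ)) →
        ActiveScalar.IsWeakSolution ActiveScalar.sqgMultiplier I θ u →
        (∀ᵐ t ∂(volume.restrict I),
          Summable (ActiveScalar.hMinusHalfTerm (fun x => (θ (t, x) : ℂ)))) ∧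
        ∃ c : ℝ, ∀ᵐ t ∂(volume.restrict I),
          ActiveScalar.hMinusHalfNorm (fun x => (θ (t, x) : ℂ)) = c)) := by
  refine ⟨fun m hm ho => ⟨ActiveScalar.exists_amplitude hm ho,
      ActiveScalar.exists_selfAdjoint_opL hm ho, fun I hI hc θ u hθ hsol => ⟨?_, ?_⟩⟩,
    ActiveScalar.isDriftMultiplier_sqg, ActiveScalar.isOddMultiplier_sqg,
    ActiveScalar.hamiltonianSymbol_sqg, fun I hI hc θ u hθ hsol => ⟨?_, ?_⟩⟩
  · filter_upwards [ActiveScalar.ae_memLp_two_slice hθ] with t ht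
    exact ⟨ht, (ActiveScalar.integral_mul_opL_eq_tsum hm ho ht).1⟩
  · obtain ⟨c, hconst⟩ := hsol.exists_tsum_eq_const hm ho hI hc hθ
    refine ⟨(2 * Real.pi) ^ 2 * c, ?_⟩
    filter_upwards [ActiveScalar.ae_memLp_two_slice hθ, hconst] with t ht htc
    rw [ActiveScalar.hamiltonian, (ActiveScalar.integral_mul_opL_eq_tsum hm ho ht).2.2, htc]
  · filter_upwards [ActiveScalar.ae_memLp_two_slice hθ] with t ht
    have h := (ActiveScalar.integral_mul_opL_eq_tsum ActiveScalar.isDriftMultiplier_sqg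
      ActiveScalar.isOddMultiplier_sqg ht).2.1
    simpa only [← ActiveScalar.hMinusHalfTerm_eq] using h
  · obtain ⟨c, hconst⟩ := hsol.exists_tsum_eq_const ActiveScalar.isDriftMultiplier_sqg
      ActiveScalar.isOddMultiplier_sqg hI hc hθ
    refine ⟨Real.sqrt c, ?_⟩
    filter_upwards [hconst] with t ht
    simp only [ActiveScalar.hMinusHalfNorm, ActiveScalar.hMinusHalfTerm_eq, ht]
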